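/- Let $k\ge 1$, let $2\le r_1<\dots<r_k$ and $s_1,\dots,s_k>0$ be integers, and let the T-link $T((r_1,s_1),\dots,(r_k,s_k))$ be the closure of the braid $$(\sigma_1\sigma_2\cdots\sigma_{r_1-1})^{s_1}(\sigma_1\sigma_2\cdots\sigma_{r_2-1})^{s_2}\cdots(\sigma_1\sigma_2\cdots\sigma_{r_k-1})^{s_k}$$ on $r_k$ strands, where $\sigma_1,\dots,\sigma_{r_k-1}$ are the standard generators of the braid group $B_{r_k}$. Then there are an integer $n\ge 1$ and a positive braid on $n$ strands, given by a word in $\sigma_1,\dots,\sigma_{n-1}$ (without inverses) that contains the positive full twist $(\sigma_1\sigma_2\cdots\sigma_{n-1})^n$ on all $n$ strands as a subword of consecutive letters, whose closure is ambient isotopic in $\mathbb{R}^3$ to $T((r_1,s_1),\dots,(r_k,s_k))$. (For $n=1$ the full twist is the trivial braid.) -/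

import Mathlib

noncomputable section

/-- Positions of the strands: while the generator `σ_i` is performed (time `t` from `0`
to `1`), the strand that starts in position `k` is at the point `(ρ, y)` of the half-plane `ρ > 0`.
The strands in positions `i` and `i + 1` exchange places by a clockwise half-turn about
`(i + 1/2, 0)`, the one that starts in position `i` passing over (`y ≥ 0`); every other strand rests
at `(k, 0)`. -/
def strandPoint (i k : ℕ) (t : ℝ) : ℝ × ℝ :=
  if k = i then
    ((i : ℝ) + 1 / 2 - Real.cos (Real.pi * t) / 2, Real.sin (Real.pi * t) / 2)
  else if k = i + 1 then
    ((i : ℝ) + 1 / 2 + Real.cos (Real.pi * t) / 2, -(Real.sin (Real.pi * t) / 2))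
  else ((k : ℝ), 0)

/-- The point of `ℝ³` with cylindrical coordinates `(ρ, θ, y)`, where `p = (ρ, y)`. -/
def cylPoint (p : ℝ × ℝ) (θ : ℝ) : EuclideanSpace ℝ (Fin 3) :=
  !₂[p.1 * Real.cos θ, p.1 * Real.sin θ, p.2]

/-- `w = [i₁, …, i_m]` stands for the positive braid word `σ_{i₁} ⋯ σ_{i_m}` on `n` strands:
every letter is one of `1, …, n - 1`. -/
def IsPositiveBraidWord (n : ℕ) (w : List ℕ) : Prop :=
  ∀ i ∈ w, 1 ≤ i ∧ i < n

/-- The closure in `ℝ³` of the positive braid `σ_{i₁} ⋯ σ_{i_m}` on `n` strands, winding around the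
third coordinate axis.  The full angle is cut into `m + 1` equal sectors: the first `m` of them
carry the letters of the word in their order, the last one carries the `n` parallel arcs that join
the end of the braid to its beginning. -/
def closedBraid (n : ℕ) (w : List ℕ) : Set (EuclideanSpace ℝ (Fin 3)) :=
  {x | ∃ (j : Fin w.length) (k : ℕ) (t : ℝ), 1 ≤ k ∧ k ≤ n ∧ t ∈ Set.Icc (0 : ℝ) 1 ∧
      x = cylPoint (strandPoint (w.get j) k t)
        (2 * Real.pi * (((j : ℕ) : ℝ) + t) / ((w.length : ℝ) + 1))} ∪
  {x | ∃ (k : ℕ) (t : ℝ), 1 ≤ k ∧ k ≤ n ∧ t ∈ Set.Icc (0 : ℝ) 1 ∧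
      x = cylPoint ((k : ℝ), 0)
        (2 * Real.pi * ((w.length : ℝ) + t) / ((w.length : ℝ) + 1))}

/-- Two subsets of `ℝ³` (in particular two links) are equivalent if an ambient isotopy of `ℝ³`
carries the first to the second. -/
def AmbientIsotopic (L L' : Set (EuclideanSpace ℝ (Fin 3))) : Prop :=
  ∃ H : unitInterval → (EuclideanSpace ℝ (Fin 3) ≃ₜ EuclideanSpace ℝ (Fin 3)),
    Continuous (fun p : unitInterval × EuclideanSpace ℝ (Fin 3) => H p.1 p.2) ∧
    (∀ x, H 0 x = x) ∧ H 1 '' L = L'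

/-- The word `(σ₁ σ₂ ⋯ σ_{r-1})^s`. -/
def torusWord (r s : ℕ) : List ℕ :=
  (List.replicate s (List.range' 1 (r - 1))).flatten

/-- The positive full twist `(σ₁ σ₂ ⋯ σ_{n-1})^n` on `n` strands (the empty word if `n = 1`). -/
def fullTwistWord (n : ℕ) : List ℕ :=
  torusWord n n

/-- `[(r₁, s₁), …, (r_k, s_k)]` satisfies `2 ≤ r₁ < ⋯ < r_k` and all `s_i > 0`. -/
def IsTLinkData (l : List (ℕ × ℕ)) : Prop :=
  (∀ p ∈ l, 2 ≤ p.1 ∧ 0 < p.2) ∧ l.Pairwise (fun p q => p.1 < q.1)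

/-- The standard braid word `(σ₁⋯σ_{r₁-1})^{s₁} ⋯ (σ₁⋯σ_{r_k-1})^{s_k}` of a T-link. -/
def tLinkWord (l : List (ℕ × ℕ)) : List ℕ :=
  l.flatMap (fun p => torusWord p.1 p.2)

/-- The T-link `T((r₁, s₁), …, (r_k, s_k))`, `k ≥ 1`: the closure of its standard braid, which has
`r_k` strands. -/
def tLink (l : List (ℕ × ℕ)) (hl : l ≠ []) : Set (EuclideanSpace ℝ (Fin 3)) :=
  closedBraid (l.getLast hl).1 (tLinkWord l)

end

/-!
The proof has a combinatorial half, in the positive braid monoid, and a geometric half, which shows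
that the moves used in the first one do not change the closure in `ℝ³`.

Write `δ_r = σ₁ ⋯ σ_{r-1}`, so that the T-link is the closure of `δ_{r₁}^{s₁} ⋯ δ_{r_k}^{s_k}`. More
generally, consider `W v δ_R^s` on `R` strands, where `W` is a product of the same kind with all
`r_i ≤ R`, and `v` is a positive word in the `σ_i` with `i < s` and `i < R`.
`hasFullTwist_closedBraid` shows by induction that its closure is that of a positive braid with a
full twist.
* If `s ≥ R`, then `δ_R^s` contains the full twist `δ_R^R`.
* If `W` ends in `δ_R^a`, then `v` can be passed through powers of `δ_R`, because
  `σ_{i+1} δ_R = δ_R σ_i`. Either `a + s ≥ R`, and `R - s` of the factors of `δ_R^a` complete a full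
  twist, or `v` passes through all of `δ_R^a`, and the two powers merge to `δ_R^{a+s}`.
* Otherwise `δ_R^s = δ_{R-1}^s σ_{R-1} ⋯ σ_{R-s}` (`torusBraid_succ_pow`), and `σ_{R-1}` occurs only
  once in the whole word. Conjugation and destabilization remove it together with the last
  strand. What is left over, `δ_{R-1}^s σ_{R-2} ⋯ σ_{R-s}`, either has `s = R - 1`, and contains
  a full twist, or equals `σ_{s-1} ⋯ σ₁ δ_{R-1}^s` (`torusBraid_pow_wrap_word`), so that the
  leftover letters can be added to `v`.

The moves needed are thus the relations of the braid monoid (`linkEquiv_comm`, `linkEquiv_braid`),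
conjugation (`linkEquiv_rotate`) and destabilization (`linkEquiv_destabilize`). They are realized by
homeomorphisms of `ℝ³` with compact support; by the Alexander trick
(`LinkEquiv.ambientIsotopic`), such a homeomorphism is isotopic to the identity. The main tool
is an isotopy extension theorem for strands that move along straight lines in the levels of a chart
(`linkEquiv_of_strandHomotopy`), usually that of cylindrical coordinates. For the braid
relations, the strands involved can be put into layers such that each strand passes
over those of lower layers; strands in different layers can be separated and then move
independently (`linkEquiv_of_layers`). For destabilization, the half-planes through the axis are
turned by `π` around the middle of the braid, so that the strand to be removed becomes the
innermost one, which runs once around the axis with nothing else between, and can be pulled across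
the axis (`linkEquiv_innermost`).
-/

noncomputable section
open Set Filter Topology

/-! ### Compactly supported homeomorphisms -/

/-- Euclidean three-space. -/
abbrev E3 : Type := EuclideanSpace ℝ (Fin 3)

/-- Two subsets of `ℝ³` are equivalent if a homeomorphism of `ℝ³` that is the identity off a
compact set carries the first to the second. -/
def LinkEquiv (L L' : Set E3) : Prop :=
  ∃ (φ : E3 ≃ₜ E3) (K : Set E3), IsCompact K ∧ (∀ x, x ∉ K → φ x = x) ∧ φ '' L = L'

theorem LinkEquiv.refl (L : Set E3) : LinkEquiv L L :=
  ⟨Homeomorph.refl _, ∅, isCompact_empty, fun _ _ => rfl, by simp⟩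

theorem LinkEquiv.symm {L L' : Set E3} (h : LinkEquiv L L') : LinkEquiv L' L := by
  obtain ⟨φ, K, hK, hid, rfl⟩ := h
  refine ⟨φ.symm, K, hK, fun x hx => ?_, ?_⟩
  · rw [Homeomorph.symm_apply_eq, hid x hx]
  · rw [← image_comp]; simp

theorem LinkEquiv.trans {L L' L'' : Set E3} (h : LinkEquiv L L') (h' : LinkEquiv L' L'') :
    LinkEquiv L L'' := by
  obtain ⟨φ, K, hK, hid, rfl⟩ := h
  obtain ⟨ψ, K', hK', hid', rfl⟩ := h'
  refine ⟨φ.trans ψ, K ∪ K', hK.union hK', fun x hx => ?_, ?_⟩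
  · simp only [mem_union, not_or] at hx
    simp [hid x hx.1, hid' x hx.2]
  · rw [← image_comp]; rfl

/-- The Alexander trick: `H_s(x) = s φ(x / s)` is an isotopy from the identity to a compactly
supported homeomorphism `φ`; it is continuous at `s = 0` because `φ` has bounded displacement. -/
theorem LinkEquiv.ambientIsotopic {L L' : Set E3} (h : LinkEquiv L L') : AmbientIsotopic L L' := by
  obtain ⟨φ, K, hK, hid, rfl⟩ := h
  have hcd : Continuous fun x : E3 => φ x - x := by fun_prop
  obtain ⟨C, hC⟩ : ∃ C : ℝ, ∀ x, ‖φ x - x‖ ≤ C := by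
    obtain ⟨C, hC⟩ := hK.exists_bound_of_continuousOn hcd.continuousOn
    refine ⟨max C 0, fun x => ?_⟩
    by_cases hx : x ∈ K
    · exact (hC x hx).trans (le_max_left _ _)
    · simp [hid x hx]
  let H : unitInterval → (E3 ≃ₜ E3) := fun s =>
    if hs : (s : ℝ) = 0 then Homeomorph.refl _ else
      (Homeomorph.smulOfNeZero ((s : ℝ)⁻¹) (inv_ne_zero hs)).trans
        (φ.trans (Homeomorph.smulOfNeZero (s : ℝ) hs))
  have hH : ∀ (s : unitInterval) (x : E3),
      H s x = x + (s : ℝ) • (φ ((s : ℝ)⁻¹ • x) - (s : ℝ)⁻¹ • x) := by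
    intro s x
    by_cases hs : (s : ℝ) = 0
    · have : H s = Homeomorph.refl _ := dif_pos hs
      simp [this, hs]
    · have : H s = (Homeomorph.smulOfNeZero ((s : ℝ)⁻¹) (inv_ne_zero hs)).trans
        (φ.trans (Homeomorph.smulOfNeZero (s : ℝ) hs)) := dif_neg hs
      simp only [this, Homeomorph.trans_apply, smul_sub, smul_smul, mul_inv_cancel₀ hs]
      simp [Homeomorph.smulOfNeZero]
  refine ⟨H, ?_, fun x => by simp [hH], ?_⟩
  · simp only [hH]
    rw [continuous_iff_continuousAt]
    rintro ⟨s, x⟩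
    refine ContinuousAt.add continuousAt_snd ?_
    by_cases hs : (s : ℝ) = 0
    · have h0 : Tendsto (fun p : unitInterval × E3 => ‖(p.1 : ℝ)‖ * C) (𝓝 (s, x)) (𝓝 0) := by
        have : Continuous fun p : unitInterval × E3 => ‖(p.1 : ℝ)‖ * C := by fun_prop
        simpa [hs] using this.tendsto (s, x)
      have : Tendsto (fun p : unitInterval × E3 =>
          (p.1 : ℝ) • (φ ((p.1 : ℝ)⁻¹ • p.2) - (p.1 : ℝ)⁻¹ • p.2)) (𝓝 (s, x)) (𝓝 0) := by
        refine squeeze_zero_norm (fun p => ?_) h0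
        rw [norm_smul]
        exact mul_le_mul_of_nonneg_left (hC _) (norm_nonneg _)
      simpa [ContinuousAt, hs] using this
    · have h1 : ContinuousAt (fun p : unitInterval × E3 => (p.1 : ℝ)) (s, x) := by fun_prop
      have h2 : ContinuousAt (fun p : unitInterval × E3 => (p.1 : ℝ)⁻¹ • p.2) (s, x) :=
        (h1.inv₀ hs).smul continuousAt_snd
      exact h1.smul (ContinuousAt.comp (f := fun p : unitInterval × E3 => (p.1 : ℝ)⁻¹ • p.2)
        (g := fun x => φ x - x) hcd.continuousAt h2)
  · congr 1
    ext x : 1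
    simp [hH]

/-- A continuous bijection that is the identity off a compact set is a homeomorphism. -/
theorem exists_homeomorph_of_eq_off_compact {X : Type*} [TopologicalSpace X] [T2Space X]
    {f : X → X} (hf : Continuous f) (hb : Function.Bijective f) {K : Set X} (hK : IsCompact K)
    (hid : ∀ x, x ∉ K → f x = x) : ∃ φ : X ≃ₜ X, ∀ x, φ x = f x := by
  have hcl : ∀ x ∈ closure Kᶜ, f x = x := by
    have : IsClosed {x | f x = x} := isClosed_eq hf continuous_id
    exact fun x hx => closure_minimal (fun y hy => hid y hy) this hx
  refine ⟨(Equiv.ofBijective f hb).toHomeomorphOfContinuousClosed hf ?_, fun x => rfl⟩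
  intro C hC
  have : (Equiv.ofBijective f hb) '' C = f '' (C ∩ K) ∪ C ∩ closure Kᶜ := by
    ext y
    constructor
    · rintro ⟨x, hx, rfl⟩
      by_cases hxK : x ∈ K
      · exact Or.inl ⟨x, ⟨hx, hxK⟩, rfl⟩
      · right
        have : Equiv.ofBijective f hb x = x := hid x hxK
        rw [this]
        exact ⟨hx, subset_closure hxK⟩
    · rintro (⟨x, hx, rfl⟩ | ⟨hy, hy'⟩)
      · exact ⟨x, hx.1, rfl⟩
      · exact ⟨y, hy, hcl y hy'⟩
  rw [this]
  exact ((hK.inter_left hC).image hf).isClosed.union (hC.inter isClosed_closure)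

/-- A homeomorphism supported in a compact subset of the source of a chart `e` of `ℝ³` acts on
`ℝ³`, by the identity off the chart. -/
theorem linkEquiv_of_chart {X : Type*} [TopologicalSpace X] [T2Space X]
    (e : OpenPartialHomeomorph X E3) (ψ : X ≃ₜ X) {K : Set X} (hK : IsCompact K)
    (hKs : K ⊆ e.source) (hid : ∀ x, x ∉ K → ψ x = x) {A A' : Set X} {L₀ : Set E3}
    (hA : A ⊆ e.source) (hA' : ψ '' A = A') (hL : ∀ x ∈ e.source, e x ∈ L₀ → ψ x = x) :
    LinkEquiv (L₀ ∪ e '' A) (L₀ ∪ e '' A') := by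
  classical
  have hid' : ∀ x, x ∉ K → ψ.symm x = x := fun x hx => by
    rw [Homeomorph.symm_apply_eq, hid x hx]
  have key : ∀ (χ : X ≃ₜ X), (∀ x, x ∉ K → χ x = x) → ∀ x ∈ e.source, χ x ∈ e.source := by
    intro χ hχ x hx
    by_cases hxK : χ x ∈ K
    · exact hKs hxK
    · have := hχ _ hxK
      rw [χ.injective this]; exact hx
  let F : (X ≃ₜ X) → E3 → E3 := fun χ y => if y ∈ e.target then e (χ (e.symm y)) else y
  have hF : ∀ (χ : X ≃ₜ X), (∀ x, x ∉ K → χ x = x) → Continuous (F χ) := by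
    intro χ hχ
    have hcl : IsClosed (e '' K) :=
      (hK.image_of_continuousOn (e.continuousOn.mono hKs)).isClosed
    rw [continuous_iff_continuousAt]
    intro y
    by_cases hy : y ∈ e.target
    · have hev : F χ =ᶠ[𝓝 y] fun y => e (χ (e.symm y)) := by
        filter_upwards [e.open_target.mem_nhds hy] with z hz
        simp [F, hz]
      refine ContinuousAt.congr ?_ hev.symm
      have h1 : ContinuousAt e.symm y := e.continuousAt_symm hy
      have h2 : ContinuousAt e (χ (e.symm y)) :=
        e.continuousAt (key χ hχ _ (e.map_target hy))
      exact ContinuousAt.comp (f := fun y => χ (e.symm y)) h2 (χ.continuous.continuousAt.comp h1)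
    · have hev : F χ =ᶠ[𝓝 y] id := by
        have : y ∈ (e '' K)ᶜ := by
          rintro ⟨x, hx, rfl⟩
          exact hy (e.map_source (hKs hx))
        filter_upwards [hcl.isOpen_compl.mem_nhds this] with z hz
        by_cases hz' : z ∈ e.target
        · have : e.symm z ∉ K := fun h => hz ⟨_, h, e.right_inv hz'⟩
          simp [F, hz', hχ _ this, e.right_inv hz']
        · simp [F, hz']
      exact continuousAt_id.congr hev.symm
  have hinv : ∀ χ : X ≃ₜ X, (∀ x, x ∉ K → χ x = x) → ∀ y, F χ.symm (F χ y) = y := by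
    intro χ hχ y
    by_cases hy : y ∈ e.target
    · have h1 := key χ hχ _ (e.map_target hy)
      simp [F, hy, e.map_source h1, e.left_inv h1, e.right_inv hy]
    · simp [F, hy]
  let Φ : E3 ≃ₜ E3 :=
    { toFun := F ψ
      invFun := F ψ.symm
      left_inv := hinv ψ hid
      right_inv := fun y => by simpa using hinv ψ.symm hid' y
      continuous_toFun := hF ψ hid
      continuous_invFun := hF ψ.symm hid' }
  refine ⟨Φ, e '' K, hK.image_of_continuousOn (e.continuousOn.mono hKs), ?_, ?_⟩
  · intro y hy
    change F ψ y = y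
    by_cases hy' : y ∈ e.target
    · have : e.symm y ∉ K := fun h => hy ⟨_, h, e.right_inv hy'⟩
      simp [F, hy', hid _ this, e.right_inv hy']
    · simp [F, hy']
  · have h1 : ∀ x ∈ e.source, Φ (e x) = e (ψ x) := fun x hx => by
      change F ψ (e x) = _
      simp [F, e.map_source hx, e.left_inv hx]
    have h2 : ∀ y ∈ L₀, Φ y = y := fun y hy => by
      by_cases hy' : y ∈ e.target
      · obtain ⟨x, hx, rfl⟩ : ∃ x ∈ e.source, e x = y := ⟨_, e.map_target hy', e.right_inv hy'⟩
        rw [h1 x hx, hL x hx hy]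
      · change F ψ y = y
        simp [F, hy']
    rw [image_union, ← hA', image_image, image_image]
    congr 1
    · rw [image_congr h2, image_id']
    · exact image_congr fun x hx => h1 x (hA hx)

/-! ### Moving finitely many strands -/

/-- A plane: a meridional half-plane with coordinates `(ρ, y)`, or a horizontal plane. -/
abbrev Plane : Type := ℝ × ℝ

/-- A fibrewise perturbation of the identity by a contraction with compact support is a
homeomorphism. -/
theorem exists_fiberwise_homeomorph {u : Plane × ℝ → Plane} (hu : Continuous u)
    (hlip : ∀ t p p', ‖u (p, t) - u (p', t)‖ ≤ 1 / 2 * ‖p - p'‖) {K : Set (Plane × ℝ)}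
    (hK : IsCompact K) (hid : ∀ q, q ∉ K → u q = 0) :
    ∃ ψ : (Plane × ℝ) ≃ₜ (Plane × ℝ), ∀ q, ψ q = (q.1 + u q, q.2) := by
  refine exists_homeomorph_of_eq_off_compact (f := fun q => (q.1 + u q, q.2)) (by fun_prop)
    ⟨?_, ?_⟩ hK fun q hq => by simp [hid q hq]
  · rintro ⟨p, t⟩ ⟨p', t'⟩ h
    simp only [Prod.mk.injEq] at h
    obtain ⟨h, rfl⟩ := h
    have h1 : p - p' = u (p', t) - u (p, t) := by
      rw [sub_eq_sub_iff_add_eq_add, h, add_comm]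
    have h2 := hlip t p' p
    rw [← h1, norm_sub_rev p' p] at h2
    have : ‖p - p'‖ = 0 := by linarith [norm_nonneg (p - p')]
    rw [norm_sub_eq_zero_iff] at this
    rw [this]
  · rintro ⟨p, t⟩
    have hc : ContractingWith (1 / 2) (fun z => p - u (z, t)) := by
      refine ⟨by rw [← NNReal.coe_lt_coe]; norm_num, LipschitzWith.of_dist_le_mul fun z z' => ?_⟩
      have := hlip t z' z
      rw [dist_eq_norm, dist_eq_norm, norm_sub_rev z z']
      simpa using this
    refine ⟨(hc.fixedPoint, t), ?_⟩
    have := hc.fixedPoint_isFixedPt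
    simp only [Function.IsFixedPt] at this
    rw [sub_eq_iff_eq_add] at this
    simpa using this.symm

/-- Points `a i t` of the plane that are at distance at least `ε` from one another can be pushed to
points `b i t` that are much closer to them, by a homeomorphism preserving every level `t`. -/
theorem exists_push {ι : Type*} [Fintype ι] {a b : ι → ℝ → Plane}
    (ha : ∀ i, Continuous (a i)) (hb : ∀ i, Continuous (b i)) {ε lo hi : ℝ} (hε : 0 < ε)
    (hclose : ∀ i t, ‖b i t - a i t‖ ≤ ε / (2 * (Fintype.card ι + 1)))
    (hsep : ∀ i j, i ≠ j → ∀ t ∈ Icc lo hi, ε ≤ ‖a i t - a j t‖)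
    (hends : ∀ i t, t ∉ Ioo lo hi → a i t = b i t) :
    ∃ ψ : (Plane × ℝ) ≃ₜ (Plane × ℝ),
      (∀ q, ψ q ≠ q → q.2 ∈ Ioo lo hi ∧ ∃ i, ‖q.1 - a i q.2‖ ≤ ε) ∧
      ∀ i, ∀ t ∈ Icc lo hi, ψ (a i t, t) = (b i t, t) := by
  classical
  let f : ι → Plane × ℝ → ℝ := fun i q => max 0 (1 - ‖q.1 - a i q.2‖ / ε)
  let u : Plane × ℝ → Plane := fun q => ∑ i, f i q • (b i q.2 - a i q.2)
  have hf0 : ∀ i q, ε ≤ ‖q.1 - a i q.2‖ → f i q = 0 := fun i q h => by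
    refine max_eq_left ?_
    have := (one_le_div hε).2 h
    linarith
  have hu : Continuous u := by
    refine continuous_finsetSum _ fun i _ => ?_
    have := ha i
    have := hb i
    fun_prop
  have hsupp : ∀ q, u q ≠ 0 → q.2 ∈ Ioo lo hi ∧ ∃ i, ‖q.1 - a i q.2‖ ≤ ε := by
    intro q hq
    obtain ⟨i, _, hi⟩ := Finset.exists_ne_zero_of_sum_ne_zero hq
    refine ⟨?_, i, ?_⟩
    · by_contra h
      exact hi (by simp [hends i _ h])
    · by_contra h
      exact hi (by simp [hf0 i q (not_le.1 h).le])
  let K : Set (Plane × ℝ) :=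
    ⋃ i, (fun z : Plane × ℝ => (a i z.2 + z.1, z.2)) '' (Metric.closedBall 0 ε ×ˢ Icc lo hi)
  have hK : IsCompact K := isCompact_iUnion fun i => by
    have := ha i
    exact ((isCompact_closedBall _ _).prod isCompact_Icc).image (by fun_prop)
  have hKid : ∀ q, q ∉ K → u q = 0 := by
    intro q hq
    by_contra h
    obtain ⟨h1, i, h2⟩ := hsupp q h
    refine hq (mem_iUnion.2 ⟨i, (q.1 - a i q.2, q.2), ⟨by simpa using h2,
      Ioo_subset_Icc_self h1⟩, ?_⟩)
    simp
  have hlip : ∀ t p p', ‖u (p, t) - u (p', t)‖ ≤ 1 / 2 * ‖p - p'‖ := by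
    intro t p p'
    have hterm : ∀ i, ‖f i (p, t) • (b i t - a i t) - f i (p', t) • (b i t - a i t)‖ ≤
        ‖p - p'‖ / (2 * (Fintype.card ι + 1)) := by
      intro i
      rw [← sub_smul, norm_smul]
      have h1 : ‖f i (p, t) - f i (p', t)‖ ≤ ‖p - p'‖ / ε := by
        rw [Real.norm_eq_abs]
        refine (abs_max_sub_max_le_max _ _ _ _).trans ?_
        simp only [sub_self, abs_zero]
        refine max_le (by positivity) ?_
        rw [show 1 - ‖p - a i t‖ / ε - (1 - ‖p' - a i t‖ / ε) =
          (‖p' - a i t‖ - ‖p - a i t‖) / ε by ring, abs_div, abs_of_pos hε]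
        gcongr
        refine (abs_norm_sub_norm_le _ _).trans ?_
        rw [sub_sub_sub_cancel_right, norm_sub_rev]
      calc _ ≤ ‖p - p'‖ / ε * (ε / (2 * (Fintype.card ι + 1))) := by
            gcongr
            exact hclose i t
        _ = _ := by field_simp
    calc _ = ‖∑ i, (f i (p, t) • (b i t - a i t) - f i (p', t) • (b i t - a i t))‖ := by
          rw [Finset.sum_sub_distrib]
      _ ≤ ∑ _i : ι, ‖p - p'‖ / (2 * (Fintype.card ι + 1)) :=
          norm_sum_le_of_le _ fun i _ => hterm i
      _ ≤ 1 / 2 * ‖p - p'‖ := by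
          rw [Finset.sum_const, Finset.card_univ, nsmul_eq_mul]
          have : (0 : ℝ) ≤ Fintype.card ι := by positivity
          have h3 : (Fintype.card ι : ℝ) / (Fintype.card ι + 1) ≤ 1 := by
            rw [div_le_one (by positivity)]; linarith
          calc _ = (Fintype.card ι : ℝ) / (Fintype.card ι + 1) * (1 / 2 * ‖p - p'‖) := by
                field_simp
            _ ≤ 1 * (1 / 2 * ‖p - p'‖) := by gcongr
            _ = _ := one_mul _
  obtain ⟨ψ, hψ⟩ := exists_fiberwise_homeomorph hu hlip hK hKid
  refine ⟨ψ, fun q hq => hsupp q fun h => hq (by simp [hψ, h]), fun i t ht => ?_⟩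
  rw [hψ]
  have : u (a i t, t) = b i t - a i t := by
    simp only [u]
    rw [Finset.sum_eq_single i]
    · simp [f]
    · intro j _ hj
      rw [hf0 j _ (hsep i j hj.symm t ht), zero_smul]
    · simp
  simp [this]

/-- The straight-line homotopy between two families of strands. -/
def strandHomotopy {ι : Type*} (c c' : ι → ℝ → Plane) (s : ℝ) (i : ι) (t : ℝ) : Plane :=
  c i t + s • (c' i t - c i t)

/-- Isotopy extension for strands: if the straight-line homotopy from `c` to `c'` never makes two
strands collide, it is realized by a homeomorphism that preserves levels and is supported near the
traces of the strands.  It is a composite of finitely many small pushes. -/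
theorem exists_homeomorph_of_strandHomotopy {ι : Type*} [Fintype ι] {c c' : ι → ℝ → Plane}
    (hc : ∀ i, Continuous (c i)) (hc' : ∀ i, Continuous (c' i)) {lo hi : ℝ}
    (hends : ∀ i t, t ∉ Ioo lo hi → c i t = c' i t)
    (hne : ∀ i j, i ≠ j → ∀ t ∈ Icc lo hi, ∀ s ∈ Icc (0 : ℝ) 1,
      strandHomotopy c c' s i t ≠ strandHomotopy c c' s j t)
    {W : Set (Plane × ℝ)} (hW : IsOpen W)
    (hcW : ∀ i, ∀ t ∈ Icc lo hi, ∀ s ∈ Icc (0 : ℝ) 1, (strandHomotopy c c' s i t, t) ∈ W) :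
    ∃ (ψ : (Plane × ℝ) ≃ₜ (Plane × ℝ)) (K : Set (Plane × ℝ)), IsCompact K ∧ K ⊆ W ∧
      (∀ q, ψ q ≠ q → q ∈ K ∧ q.2 ∈ Ioo lo hi) ∧
      ∀ i, ∀ t ∈ Icc lo hi, ψ (c i t, t) = (c' i t, t) := by
  classical
  have hcont : ∀ i, Continuous fun z : ℝ × ℝ => strandHomotopy c c' z.1 i z.2 := fun i => by
    have := hc i
    have := hc' i
    unfold strandHomotopy
    fun_prop
  have hcomp : IsCompact (Icc (0 : ℝ) 1 ×ˢ Icc lo hi) := isCompact_Icc.prod isCompact_Icc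
  let S : Set (Plane × ℝ) :=
    ⋃ i, (fun z : ℝ × ℝ => (strandHomotopy c c' z.1 i z.2, z.2)) '' (Icc (0 : ℝ) 1 ×ˢ Icc lo hi)
  have hS : IsCompact S := isCompact_iUnion fun i => by
    have := hcont i
    exact hcomp.image (by fun_prop)
  have hSW : S ⊆ W := by
    refine iUnion_subset fun i => ?_
    rintro _ ⟨z, hz, rfl⟩
    exact hcW i _ hz.2 _ hz.1
  obtain ⟨δ, hδ, hδW⟩ := hS.exists_cthickening_subset_open hW hSW
  have hsep : ∃ ε > 0, ∀ i j, i ≠ j → ∀ t ∈ Icc lo hi, ∀ s ∈ Icc (0 : ℝ) 1,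
      ε ≤ ‖strandHomotopy c c' s i t - strandHomotopy c c' s j t‖ := by
    have h1 : ∀ x : ι × ι, ∃ ε > 0, x.1 ≠ x.2 → ∀ t ∈ Icc lo hi, ∀ s ∈ Icc (0 : ℝ) 1,
        ε ≤ ‖strandHomotopy c c' s x.1 t - strandHomotopy c c' s x.2 t‖ := by
      rintro ⟨i, j⟩
      by_cases hij : i = j
      · exact ⟨1, one_pos, fun h => (h hij).elim⟩
      rcases (Icc (0 : ℝ) 1 ×ˢ Icc lo hi).eq_empty_or_nonempty with he | hne'
      · refine ⟨1, one_pos, fun _ t ht s hs => ?_⟩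
        have : (s, t) ∈ Icc (0 : ℝ) 1 ×ˢ Icc lo hi := ⟨hs, ht⟩
        simp [he] at this
      · have hg : Continuous fun z : ℝ × ℝ =>
            ‖strandHomotopy c c' z.1 i z.2 - strandHomotopy c c' z.1 j z.2‖ :=
          ((hcont i).sub (hcont j)).norm
        obtain ⟨z, hz, hmin⟩ := hcomp.exists_isMinOn hne' hg.continuousOn
        refine ⟨_, norm_pos_iff.2 (sub_ne_zero.2 (hne i j hij z.2 hz.2 z.1 hz.1)), ?_⟩
        intro _ t ht s hs
        exact hmin (show (s, t) ∈ _ from ⟨hs, ht⟩)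
    choose g hg0 hg using h1
    rcases isEmpty_or_nonempty ι with he | hn
    · exact ⟨1, one_pos, fun i => (he.false i).elim⟩
    · obtain ⟨x, -, hx⟩ := Finset.exists_min_image (Finset.univ : Finset (ι × ι)) g
        Finset.univ_nonempty
      exact ⟨g x, hg0 x, fun i j hij t ht s hs =>
        (hx (i, j) (Finset.mem_univ _)).trans (hg (i, j) hij t ht s hs)⟩
  obtain ⟨ε₁, hε₁, hsep⟩ := hsep
  -- Pushes of strands at distance `ε` from one another only affect the `δ`-neighbourhood of the
  -- traces `S`.
  set ε := min δ ε₁ with hεdef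
  have hε : 0 < ε := lt_min hδ hε₁
  have hD : ∃ D : ℝ, 0 ≤ D ∧ ∀ i t, ‖c' i t - c i t‖ ≤ D := by
    have h1 : ∀ i, ∃ D : ℝ, ∀ t, ‖c' i t - c i t‖ ≤ D := fun i => by
      obtain ⟨C, hC⟩ := isCompact_Icc (a := lo) (b := hi) |>.exists_bound_of_continuousOn
        ((hc' i).sub (hc i)).continuousOn
      refine ⟨max C 0, fun t => ?_⟩
      by_cases ht : t ∈ Icc lo hi
      · exact (hC t ht).trans (le_max_left _ _)
      · rw [hends i t fun h => ht (Ioo_subset_Icc_self h)]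
        simp
    choose D hD using h1
    have hD0 : ∀ i, 0 ≤ D i := fun i => (norm_nonneg _).trans (hD i 0)
    exact ⟨∑ i, D i, Finset.sum_nonneg fun i _ => hD0 i, fun i t =>
      (hD i t).trans (Finset.single_le_sum (fun i _ => hD0 i) (Finset.mem_univ i))⟩
  obtain ⟨D, hD0, hD⟩ := hD
  -- The homotopy is cut into `N` steps, each of them short enough for `exists_push`.
  set η := ε / (2 * ((Fintype.card ι : ℝ) + 1)) with hη
  have hη0 : 0 < η := by positivity
  obtain ⟨N, hN⟩ := exists_nat_gt (D / η)
  have hN0 : (0 : ℝ) < N := (by positivity : (0 : ℝ) ≤ D / η).trans_lt hN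
  have hDN : D / N ≤ η := by
    rw [div_lt_iff₀ hη0] at hN
    rw [div_le_iff₀ hN0]
    linarith
  have main : ∀ k : ℕ, k ≤ N → ∃ ψ : (Plane × ℝ) ≃ₜ (Plane × ℝ),
      (∀ q, ψ q ≠ q → q ∈ Metric.cthickening δ S ∧ q.2 ∈ Ioo lo hi) ∧
      ∀ i, ∀ t ∈ Icc lo hi, ψ (c i t, t) = (strandHomotopy c c' (k / N) i t, t) := by
    intro k
    induction k with
    | zero => exact fun _ => ⟨Homeomorph.refl _, by simp, by simp [strandHomotopy]⟩
    | succ k ih =>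
      intro hk
      obtain ⟨ψ, hψ, hψc⟩ := ih (by omega)
      have hk0 : ((k : ℝ) / N) ∈ Icc (0 : ℝ) 1 :=
        ⟨by positivity, by rw [div_le_one hN0]; exact_mod_cast (by omega : k ≤ N)⟩
      have hcs : ∀ s i, Continuous (strandHomotopy c c' s i) := fun s i =>
        (hcont i).comp (f := fun t => (s, t)) (by fun_prop)
      obtain ⟨χ, hχ, hχc⟩ := exists_push (a := strandHomotopy c c' (k / N))
        (b := strandHomotopy c c' ((k + 1 : ℕ) / N)) (lo := lo) (hi := hi) (hcs _) (hcs _) hε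
        (fun i t => by
          have : strandHomotopy c c' ((k + 1 : ℕ) / N) i t - strandHomotopy c c' (k / N) i t =
              (1 / N : ℝ) • (c' i t - c i t) := by
            simp only [strandHomotopy]
            rw [add_sub_add_left_eq_sub, ← sub_smul]
            congr 1
            push_cast
            ring
          rw [this, norm_smul, Real.norm_eq_abs, abs_of_nonneg (by positivity)]
          calc _ ≤ 1 / (N : ℝ) * D := by gcongr; exact hD i t
            _ = D / N := by ring
            _ ≤ _ := hDN)
        (fun i j hij t ht => (min_le_right _ _).trans (hsep i j hij t ht _ hk0))
        (fun i t ht => by simp [strandHomotopy, hends i t ht])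
      refine ⟨ψ.trans χ, fun q hq => ?_, fun i t ht => by simp [hψc i t ht, hχc i t ht]⟩
      by_cases h : ψ q = q
      · have h' : χ q ≠ q := by simpa [h] using hq
        obtain ⟨h1, i, h2⟩ := hχ q h'
        refine ⟨Metric.mem_cthickening_of_dist_le q
          (strandHomotopy c c' (k / N) i q.2, q.2) δ S ?_ ?_, h1⟩
        · exact mem_iUnion.2 ⟨i, (k / N, q.2), ⟨hk0, Ioo_subset_Icc_self h1⟩, rfl⟩
        · rw [Prod.dist_eq, dist_self, dist_eq_norm]
          exact max_le (h2.trans (min_le_left _ _)) hδ.le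
      · exact hψ q h
  obtain ⟨ψ, hψ, hψc⟩ := main N le_rfl
  refine ⟨ψ, _, hS.cthickening, hδW, hψ, fun i t ht => ?_⟩
  rw [hψc i t ht, div_self hN0.ne']
  simp [strandHomotopy]

/-- The part of `ℝ³` swept out by the strands `c` at the levels `t ∈ [lo, hi]` of a chart `e`. -/
def strandImage {ι : Type*} (e : Plane × ℝ → E3) (c : ι → ℝ → Plane) (lo hi : ℝ) : Set E3 :=
  {x | ∃ i, ∃ t ∈ Icc lo hi, x = e (c i t, t)}

/-- In a chart of `ℝ³`, strands may be moved along straight lines as long as they collide neither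
with one another nor with the rest `L₀` of the link. -/
theorem linkEquiv_of_strandHomotopy (e : OpenPartialHomeomorph (Plane × ℝ) E3) {ι : Type*}
    [Fintype ι] {c c' : ι → ℝ → Plane}
    (hc : ∀ i, Continuous (c i)) (hc' : ∀ i, Continuous (c' i)) {lo hi : ℝ}
    (hends : ∀ i t, t ∉ Ioo lo hi → c i t = c' i t)
    (hne : ∀ i j, i ≠ j → ∀ t ∈ Icc lo hi, ∀ s ∈ Icc (0 : ℝ) 1,
      strandHomotopy c c' s i t ≠ strandHomotopy c c' s j t)
    {W : Set (Plane × ℝ)} (hW : IsOpen W) (hWe : W ⊆ e.source)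
    (hcW : ∀ i, ∀ t ∈ Icc lo hi, ∀ s ∈ Icc (0 : ℝ) 1, (strandHomotopy c c' s i t, t) ∈ W)
    {L₀ : Set E3} (hL₀ : ∀ q ∈ W, q.2 ∈ Ioo lo hi → e q ∉ L₀) :
    LinkEquiv (L₀ ∪ strandImage e c lo hi) (L₀ ∪ strandImage e c' lo hi) := by
  obtain ⟨ψ, K, hK, hKW, hψ, hψc⟩ :=
    exists_homeomorph_of_strandHomotopy hc hc' hends hne hW hcW
  have hco : ∀ d : ι → ℝ → Plane, strandImage e d lo hi =
      e '' {q | ∃ i, ∃ t ∈ Icc lo hi, q = (d i t, t)} := by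
    intro d
    ext x
    constructor
    · rintro ⟨i, t, ht, rfl⟩
      exact ⟨_, ⟨i, t, ht, rfl⟩, rfl⟩
    · rintro ⟨_, ⟨i, t, ht, rfl⟩, rfl⟩
      exact ⟨i, t, ht, rfl⟩
  rw [hco, hco]
  refine linkEquiv_of_chart e ψ hK (hKW.trans hWe)
    (fun q hq => by_contra fun h => hq (hψ q h).1) ?_ ?_ ?_
  · rintro _ ⟨i, t, ht, rfl⟩
    have := hcW i t ht 0 (by simp)
    simp only [strandHomotopy, zero_smul, add_zero] at this
    exact hWe this
  · ext q
    constructor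
    · rintro ⟨_, ⟨i, t, ht, rfl⟩, rfl⟩
      exact ⟨i, t, ht, hψc i t ht⟩
    · rintro ⟨i, t, ht, rfl⟩
      exact ⟨_, ⟨i, t, ht, rfl⟩, hψc i t ht⟩
  · intro q _ hq'
    by_contra h
    obtain ⟨h1, h2⟩ := hψ q h
    exact hL₀ q (hKW h1) h2 hq'

/-! ### Cylindrical coordinates -/

theorem cylPoint_zero (p : Plane) (θ : ℝ) : cylPoint p θ 0 = p.1 * Real.cos θ := rfl
theorem cylPoint_one (p : Plane) (θ : ℝ) : cylPoint p θ 1 = p.1 * Real.sin θ := rfl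
theorem cylPoint_two (p : Plane) (θ : ℝ) : cylPoint p θ 2 = p.2 := rfl

theorem cylPoint_ext {x : E3} {p : Plane} {θ : ℝ} (h0 : x 0 = p.1 * Real.cos θ)
    (h1 : x 1 = p.1 * Real.sin θ) (h2 : x 2 = p.2) : x = cylPoint p θ := by
  ext i
  fin_cases i
  · exact h0
  · exact h1
  · exact h2

theorem continuous_cylPoint : Continuous fun q : Plane × ℝ => cylPoint q.1 q.2 := by
  unfold cylPoint
  refine (PiLp.continuous_toLp 2 _).comp (continuous_pi fun i => ?_)
  fin_cases i <;> simp <;> fun_prop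

theorem cylPoint_periodic (p : Plane) (θ : ℝ) : cylPoint p (θ + 2 * Real.pi) = cylPoint p θ :=
  cylPoint_ext (by simp [cylPoint_zero]) (by simp [cylPoint_one]) (by simp [cylPoint_two])

theorem cylPoint_sub_two_pi (p : Plane) (θ : ℝ) : cylPoint p (θ - 2 * Real.pi) = cylPoint p θ := by
  rw [← cylPoint_periodic, sub_add_cancel]

/-- The distance from the axis. -/
def rad (x : E3) : ℝ := Real.sqrt (x 0 ^ 2 + x 1 ^ 2)

theorem continuous_rad : Continuous rad := by
  unfold rad
  fun_prop

theorem rad_nonneg (x : E3) : 0 ≤ rad x := Real.sqrt_nonneg _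

theorem rad_cylPoint {p : Plane} (hp : 0 ≤ p.1) (θ : ℝ) : rad (cylPoint p θ) = p.1 := by
  rw [rad, cylPoint_zero, cylPoint_one, mul_pow, mul_pow, ← mul_add, Real.cos_sq_add_sin_sq,
    mul_one, Real.sqrt_sq hp]

/-- The projection of `x` to the plane of the first two coordinates, as a complex number,
multiplied by `-e^{-iα}`.  Its argument is the angle of `x` minus `α + π`, so that the branch cut of
the argument lies at the angle `α`. -/
def turned (α : ℝ) (x : E3) : ℂ :=
  -Complex.exp (-(α * Complex.I)) * (x 0 + x 1 * Complex.I)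

theorem continuous_turned (α : ℝ) : Continuous (turned α) := by
  unfold turned
  fun_prop

theorem turned_cylPoint (α : ℝ) (p : Plane) (θ : ℝ) :
    turned α (cylPoint p θ) =
      p.1 * (Complex.cos ((θ - α - Real.pi : ℝ)) +
        Complex.sin ((θ - α - Real.pi : ℝ)) * Complex.I) := by
  rw [turned, cylPoint_zero, cylPoint_one, ← Complex.exp_mul_I]
  have : ((p.1 * Real.cos θ : ℝ) : ℂ) + ((p.1 * Real.sin θ : ℝ) : ℂ) * Complex.I =
      p.1 * Complex.exp (θ * Complex.I) := by
    rw [Complex.exp_mul_I]; push_cast; ring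
  rw [this]
  have h2 : (((θ - α - Real.pi : ℝ) : ℂ) * Complex.I) =
      θ * Complex.I + -(α * Complex.I) - Real.pi * Complex.I := by push_cast; ring
  rw [h2, Complex.exp_sub, Complex.exp_add, Complex.exp_pi_mul_I]
  ring

theorem arg_turned_cylPoint {α : ℝ} {p : Plane} (hp : 0 < p.1) {θ : ℝ}
    (hθ : θ ∈ Ioc α (α + 2 * Real.pi)) :
    Complex.arg (turned α (cylPoint p θ)) = θ - α - Real.pi := by
  rw [turned_cylPoint]
  exact Complex.arg_mul_cos_add_sin_mul_I hp ⟨by linarith [hθ.1], by linarith [hθ.2]⟩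

theorem norm_turned (α : ℝ) (x : E3) : ‖turned α x‖ = rad x := by
  have h : ‖Complex.exp (-(α * Complex.I))‖ = 1 := by
    have := Complex.norm_exp_ofReal_mul_I (-α)
    push_cast at this
    rwa [neg_mul] at this
  rw [turned, norm_mul, norm_neg, h, one_mul, Complex.norm_add_mul_I, rad]

/-- Every point is given by cylindrical coordinates with a prescribed range for the angle. -/
theorem exists_cylPoint (α : ℝ) (x : E3) :
    x = cylPoint (rad x, x 2) (α + Real.pi + Complex.arg (turned α x)) := by
  have h1 : (x 0 + x 1 * Complex.I : ℂ) =
      rad x * Complex.exp ((α + Real.pi + Complex.arg (turned α x) : ℝ) * Complex.I) := by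
    have h2 := Complex.norm_mul_exp_arg_mul_I (turned α x)
    rw [norm_turned] at h2
    have h3 : (((α + Real.pi + Complex.arg (turned α x) : ℝ) : ℂ) * Complex.I) =
      α * Complex.I + Real.pi * Complex.I + Complex.arg (turned α x) * Complex.I := by
      push_cast; ring
    rw [h3, Complex.exp_add, Complex.exp_add, Complex.exp_pi_mul_I]
    have h4 : Complex.exp (α * Complex.I) * Complex.exp (-(α * Complex.I)) = 1 := by
      rw [← Complex.exp_add]; simp
    calc (x 0 + x 1 * Complex.I : ℂ) =
        -Complex.exp (α * Complex.I) * turned α x := by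
          rw [turned]
          linear_combination -(x 0 + x 1 * Complex.I : ℂ) * h4
      _ = _ := by nth_rewrite 1 [← h2]; ring
  rw [Complex.exp_mul_I] at h1
  refine cylPoint_ext ?_ ?_ rfl
  · have := congrArg Complex.re h1
    simpa [← Complex.ofReal_cos, ← Complex.ofReal_sin, -Complex.ofReal_add] using this
  · have := congrArg Complex.im h1
    simpa [← Complex.ofReal_cos, ← Complex.ofReal_sin, -Complex.ofReal_add] using this

/-- Cylindrical coordinates as a chart, with angles in `(α, α + 2π)`. -/
def cylChart (α : ℝ) : OpenPartialHomeomorph (Plane × ℝ) E3 where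
  toFun q := cylPoint q.1 q.2
  invFun x := ((rad x, x 2), α + Real.pi + Complex.arg (turned α x))
  source := {q | 0 < q.1.1 ∧ q.2 ∈ Ioo α (α + 2 * Real.pi)}
  target := {x | turned α x ∈ Complex.slitPlane}
  map_source' := by
    rintro ⟨p, θ⟩ ⟨hp, hθ⟩
    simp only [mem_ofPred_eq] at hp hθ ⊢
    rw [Complex.mem_slitPlane_iff_arg, arg_turned_cylPoint hp ⟨hθ.1, hθ.2.le⟩]
    refine ⟨fun h => by linarith [hθ.2], fun h => ?_⟩
    have := norm_turned α (cylPoint p θ)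
    rw [h, rad_cylPoint hp.le, norm_zero] at this
    exact hp.ne this
  map_target' := by
    intro x hx
    rw [mem_ofPred_eq, Complex.mem_slitPlane_iff_arg] at hx
    refine ⟨?_, ?_, ?_⟩
    · simp only
      rw [← norm_turned α, norm_pos_iff]
      exact hx.2
    · have := Complex.neg_pi_lt_arg (turned α x)
      simp only
      linarith
    · have := lt_of_le_of_ne (Complex.arg_le_pi (turned α x)) hx.1
      simp only
      linarith
  left_inv' := by
    rintro ⟨p, θ⟩ ⟨hp, hθ⟩
    simp only at hp hθ ⊢
    rw [arg_turned_cylPoint hp ⟨hθ.1, hθ.2.le⟩, rad_cylPoint hp.le, cylPoint_two]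
    simp
  right_inv' := fun x _ => (exists_cylPoint α x).symm
  open_source := by
    refine IsOpen.inter (isOpen_lt continuous_const continuous_fst.fst) ?_
    exact isOpen_Ioo.preimage continuous_snd
  open_target := Complex.isOpen_slitPlane.preimage (continuous_turned α)
  continuousOn_toFun := continuous_cylPoint.continuousOn
  continuousOn_invFun := by
    have h1 : ContinuousOn (fun x => Complex.arg (turned α x))
        {x | turned α x ∈ Complex.slitPlane} := fun x hx =>
      ((Complex.continuousAt_arg hx).comp (continuous_turned α).continuousAt).continuousWithinAt
    have h2 := continuous_rad
    fun_prop

@[simp] theorem cylChart_apply (α : ℝ) (q : Plane × ℝ) : cylChart α q = cylPoint q.1 q.2 := rfl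

/-- Cylindrical coordinates are unique when the angles are restricted to `(α, α + 2π]`. -/
theorem cylPoint_inj {α : ℝ} {p p' : Plane} {θ θ' : ℝ} (hp : 0 < p.1) (hp' : 0 < p'.1)
    (hθ : θ ∈ Ioc α (α + 2 * Real.pi)) (hθ' : θ' ∈ Ioc α (α + 2 * Real.pi))
    (h : cylPoint p θ = cylPoint p' θ') : p = p' ∧ θ = θ' := by
  refine ⟨Prod.ext ?_ ?_, ?_⟩
  · rw [← rad_cylPoint hp.le θ, h, rad_cylPoint hp'.le]
  · have := congrArg (fun x : E3 => x 2) h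
    simpa [cylPoint_two] using this
  · have h1 := arg_turned_cylPoint hp hθ
    rw [h, arg_turned_cylPoint hp' hθ'] at h1
    linarith

/-- The coordinates `(ρ, y)` of a point are unique. -/
theorem cylPoint_inj_left {p p' : Plane} {θ θ' : ℝ} (hp : 0 < p.1) (hp' : 0 < p'.1)
    (h : cylPoint p θ = cylPoint p' θ') : p = p' := by
  refine Prod.ext ?_ ?_
  · rw [← rad_cylPoint hp.le θ, h, rad_cylPoint hp'.le]
  · have := congrArg (fun x : E3 => x 2) h
    simpa [cylPoint_two] using this

/-! ### Strands in layers -/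

theorem strandHomotopy_fst {ι : Type*} (c c' : ι → ℝ → Plane) (s : ℝ) (i : ι) (t : ℝ) :
    (strandHomotopy c c' s i t).1 = (1 - s) * (c i t).1 + s * (c' i t).1 := by
  simp [strandHomotopy]; ring

theorem strandHomotopy_snd {ι : Type*} (c c' : ι → ℝ → Plane) (s : ℝ) (i : ι) (t : ℝ) :
    (strandHomotopy c c' s i t).2 = (1 - s) * (c i t).2 + s * (c' i t).2 := by
  simp [strandHomotopy]; ring

theorem convex_comb_pos {s x y : ℝ} (hs : s ∈ Icc (0 : ℝ) 1) (hx : 0 < x) (hy : 0 < y) :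
    0 < (1 - s) * x + s * y := by
  rcases hs.1.eq_or_lt with rfl | h
  · simpa using hx
  · have := mul_nonneg (sub_nonneg.2 hs.2) hx.le
    have := mul_pos h hy
    linarith

/-- Strands in a sector of the solid torus `ρ > 0` move freely apart from the rest of the link. -/
theorem linkEquiv_sector {ι : Type*} [Fintype ι] {c c' : ι → ℝ → Plane}
    (hc : ∀ i, Continuous (c i)) (hc' : ∀ i, Continuous (c' i)) {α lo hi : ℝ}
    (hlo : α < lo) (hhi : hi < α + 2 * Real.pi)
    (hends : ∀ i t, t ∉ Ioo lo hi → c i t = c' i t)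
    (hne : ∀ i j, i ≠ j → ∀ t ∈ Icc lo hi, ∀ s ∈ Icc (0 : ℝ) 1,
      strandHomotopy c c' s i t ≠ strandHomotopy c c' s j t)
    (hpos : ∀ i t, 0 < (c i t).1) (hpos' : ∀ i t, 0 < (c' i t).1)
    {L₀ : Set E3} (hL₀ : ∀ p θ, 0 < p.1 → θ ∈ Ioo lo hi → cylPoint p θ ∉ L₀) :
    LinkEquiv (L₀ ∪ strandImage (cylChart α) c lo hi)
      (L₀ ∪ strandImage (cylChart α) c' lo hi) := by
  refine linkEquiv_of_strandHomotopy (cylChart α) hc hc' hends hne (cylChart α).open_source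
    Subset.rfl ?_ ?_
  · intro i t ht s hs
    refine ⟨?_, by linarith [ht.1], by linarith [ht.2]⟩
    simp only [strandHomotopy_fst]
    exact convex_comb_pos hs (hpos i t) (hpos' i t)
  · intro q hq ht
    exact hL₀ _ _ hq.1 ht

/-- Two systems of strands with the same ends are equivalent if the strands can be assigned
layers `e` such that, in both of them, strands of a higher layer pass over those of a lower one
(`y` is larger where `ρ` agrees), and strands of one layer keep their order. The strands
are first pulled apart in the `y`-direction according to their layers; then the layers do not
obstruct one another. -/
theorem linkEquiv_of_layers {ι : Type*} [Fintype ι] {c c' : ι → ℝ → Plane}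
    (hc : ∀ i, Continuous (c i)) (hc' : ∀ i, Continuous (c' i)) {α lo hi : ℝ}
    (hlo : α < lo) (hhi : hi < α + 2 * Real.pi)
    (hends : ∀ i t, t ∉ Ioo lo hi → c i t = c' i t)
    (hflat : ∀ i t, t ∉ Ioo lo hi → (c i t).2 = 0)
    (hpos : ∀ i t, 0 < (c i t).1) (hpos' : ∀ i t, 0 < (c' i t).1) (e : ι → ℤ)
    (hover : ∀ i j, e j < e i → ∀ t ∈ Icc lo hi, (c i t).1 = (c j t).1 → (c j t).2 < (c i t).2)
    (hover' : ∀ i j, e j < e i → ∀ t ∈ Icc lo hi,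
      (c' i t).1 = (c' j t).1 → (c' j t).2 < (c' i t).2)
    (hlevel : ∀ i j, i ≠ j → e i = e j → ∀ t ∈ Icc lo hi,
      ((c i t).1 < (c j t).1 ∧ (c' i t).1 < (c' j t).1) ∨
      ((c j t).1 < (c i t).1 ∧ (c' j t).1 < (c' i t).1))
    {L₀ : Set E3} (hL₀ : ∀ p θ, 0 < p.1 → θ ∈ Ioo lo hi → cylPoint p θ ∉ L₀) :
    LinkEquiv (L₀ ∪ strandImage (cylChart α) c lo hi)
      (L₀ ∪ strandImage (cylChart α) c' lo hi) := by
  -- A height that is positive inside the sector, zero outside, and bounds `|y|` for all strands.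
  let b : ℝ → ℝ := fun t =>
    (∑ i, |(c i t).2| + ∑ i, |(c' i t).2|) + max 0 (min (t - lo) (hi - t))
  have hb : Continuous b := by
    have h1 : Continuous fun t => ∑ i, |(c i t).2| :=
      continuous_finsetSum _ fun i _ => by have := hc i; fun_prop
    have h2 : Continuous fun t => ∑ i, |(c' i t).2| :=
      continuous_finsetSum _ fun i _ => by have := hc' i; fun_prop
    fun_prop
  have hb0 : ∀ t, t ∉ Ioo lo hi → b t = 0 := by
    intro t ht
    have h1 : min (t - lo) (hi - t) ≤ 0 := by
      by_contra h
      rw [not_le, lt_min_iff] at h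
      exact ht ⟨by linarith, by linarith⟩
    simp [b, hflat _ t ht, ← hends _ t ht, h1]
  have hbpos : ∀ t ∈ Ioo lo hi, 0 < b t := by
    intro t ht
    have h1 : 0 < min (t - lo) (hi - t) := lt_min (by linarith [ht.1]) (by linarith [ht.2])
    have h2 : 0 ≤ ∑ i, |(c i t).2| := Finset.sum_nonneg fun _ _ => abs_nonneg _
    have h3 : 0 ≤ ∑ i, |(c' i t).2| := Finset.sum_nonneg fun _ _ => abs_nonneg _
    simp only [b]
    linarith [le_max_right 0 (min (t - lo) (hi - t))]
  have hbc : ∀ i j t, i ≠ j → |(c i t).2| + |(c j t).2| ≤ b t := by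
    classical
    intro i j t hij
    have h3 : 0 ≤ ∑ i, |(c' i t).2| := Finset.sum_nonneg fun _ _ => abs_nonneg _
    have h4 : |(c i t).2| + |(c j t).2| ≤ ∑ i, |(c i t).2| := by
      rw [← Finset.sum_pair (f := fun i => |(c i t).2|) hij]
      exact Finset.sum_le_sum_of_subset_of_nonneg (Finset.subset_univ _)
        fun _ _ _ => abs_nonneg _
    simp only [b]
    linarith [le_max_left 0 (min (t - lo) (hi - t))]
  have hbc' : ∀ i j t, i ≠ j → |(c' i t).2| + |(c' j t).2| ≤ b t := by
    classical
    intro i j t hij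
    have h3 : 0 ≤ ∑ i, |(c i t).2| := Finset.sum_nonneg fun _ _ => abs_nonneg _
    have h4 : |(c' i t).2| + |(c' j t).2| ≤ ∑ i, |(c' i t).2| := by
      rw [← Finset.sum_pair (f := fun i => |(c' i t).2|) hij]
      exact Finset.sum_le_sum_of_subset_of_nonneg (Finset.subset_univ _)
        fun _ _ _ => abs_nonneg _
    simp only [b]
    linarith [le_max_left 0 (min (t - lo) (hi - t))]
  let lift : (ι → ℝ → Plane) → ι → ℝ → Plane := fun d i t => ((d i t).1, (d i t).2 + 2 * b t * e i)
  have hlift : ∀ d : ι → ℝ → Plane, (∀ i, Continuous (d i)) → ∀ i, Continuous (lift d i) := by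
    intro d hd i
    have := hd i
    fun_prop
  have hlift0 : ∀ d : ι → ℝ → Plane, ∀ i t, t ∉ Ioo lo hi → d i t = lift d i t := by
    intro d i t ht
    simp [lift, hb0 t ht]
  -- Pulling the layers of `d` apart creates no collision.
  have hsplit : ∀ d : ι → ℝ → Plane,
      (∀ i j, e j < e i → ∀ t ∈ Icc lo hi, (d i t).1 = (d j t).1 → (d j t).2 < (d i t).2) →
      (∀ i j, i ≠ j → e i = e j → ∀ t ∈ Icc lo hi, (d i t).1 ≠ (d j t).1) →
      ∀ i j, i ≠ j → ∀ t ∈ Icc lo hi, ∀ s ∈ Icc (0 : ℝ) 1,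
      strandHomotopy d (lift d) s i t ≠ strandHomotopy d (lift d) s j t := by
    intro d h1 h2 i j hij t ht s hs heq
    have hf := congrArg Prod.fst heq
    have hg := congrArg Prod.snd heq
    simp only [strandHomotopy_fst, strandHomotopy_snd, lift] at hf hg
    have hf' : (d i t).1 = (d j t).1 := by linarith
    have hbt : 0 ≤ b t := by
      by_cases h : t ∈ Ioo lo hi
      · exact (hbpos t h).le
      · exact (hb0 t h).ge
    have hsb : 0 ≤ s * b t := mul_nonneg hs.1 hbt
    rcases lt_trichotomy (e i) (e j) with h | h | h
    · have h3 := h1 j i h t ht hf'.symm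
      have h4 : (e i : ℝ) < e j := by exact_mod_cast h
      nlinarith
    · exact h2 i j hij h t ht hf'
    · have h3 := h1 i j h t ht hf'
      have h4 : (e j : ℝ) < e i := by exact_mod_cast h
      nlinarith
  have hne : ∀ i j, i ≠ j → e i = e j → ∀ t ∈ Icc lo hi, (c i t).1 ≠ (c j t).1 := by
    intro i j hij h t ht
    rcases hlevel i j hij h t ht with h | h
    · exact h.1.ne
    · exact h.1.ne'
  have hne' : ∀ i j, i ≠ j → e i = e j → ∀ t ∈ Icc lo hi, (c' i t).1 ≠ (c' j t).1 := by
    intro i j hij h t ht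
    rcases hlevel i j hij h t ht with h | h
    · exact h.2.ne
    · exact h.2.ne'
  have hfar : ∀ i j, e j < e i → ∀ t ∈ Ioo lo hi, ∀ s ∈ Icc (0 : ℝ) 1,
      strandHomotopy (lift c) (lift c') s i t ≠ strandHomotopy (lift c) (lift c') s j t := by
    intro i j h t ht s hs heq
    have hg := congrArg Prod.snd heq
    simp only [strandHomotopy_snd, lift] at hg
    have hij : i ≠ j := by rintro rfl; exact h.false
    have h4 : (e j : ℝ) + 1 ≤ e i := by exact_mod_cast h
    have h5 := hbpos t ht
    have h6 : b t ≤ b t * (e i - e j) := by nlinarith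
    have h7 := hbc i j t hij
    have h8 := hbc' i j t hij
    have h9 : 0 < ((c i t).2 + 2 * b t * e i) - ((c j t).2 + 2 * b t * e j) := by
      have := neg_abs_le (c i t).2
      have := le_abs_self (c j t).2
      linarith
    have h10 : 0 < ((c' i t).2 + 2 * b t * e i) - ((c' j t).2 + 2 * b t * e j) := by
      have := neg_abs_le (c' i t).2
      have := le_abs_self (c' j t).2
      linarith
    have := convex_comb_pos hs h9 h10
    linarith
  have step1 := linkEquiv_sector hc (hlift c hc) hlo hhi (hlift0 c) (hsplit c hover hne) hpos
    (fun i t => hpos i t) hL₀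
  have step3 := linkEquiv_sector hc' (hlift c' hc') hlo hhi (hlift0 c') (hsplit c' hover' hne')
    hpos' (fun i t => hpos' i t) hL₀
  refine step1.trans (LinkEquiv.trans ?_ step3.symm)
  refine linkEquiv_sector (hlift c hc) (hlift c' hc') hlo hhi (fun i t ht => ?_) ?_
    (fun i t => hpos i t) (fun i t => hpos' i t) hL₀
  · rw [← hlift0 c i t ht, ← hlift0 c' i t ht, hends i t ht]
  · intro i j hij t ht s hs
    rcases lt_trichotomy (e i) (e j) with h | h | h
    · by_cases ht' : t ∈ Ioo lo hi
      · exact (hfar j i h t ht' s hs).symm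
      · intro heq
        have hf := congrArg Prod.fst heq
        simp only [strandHomotopy_fst, lift, ← hends _ t ht'] at hf
        have := hover j i h t ht (by linarith)
        rw [hflat _ t ht', hflat _ t ht'] at this
        exact this.false
    · intro heq
      have hf := congrArg Prod.fst heq
      simp only [strandHomotopy_fst, lift] at hf
      rcases hlevel i j hij h t ht with h | h
      · have := convex_comb_pos hs (sub_pos.2 h.1) (sub_pos.2 h.2)
        linarith
      · have := convex_comb_pos hs (sub_pos.2 h.1) (sub_pos.2 h.2)
        linarith
    · by_cases ht' : t ∈ Ioo lo hi
      · exact hfar i j h t ht' s hs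
      · intro heq
        have hf := congrArg Prod.fst heq
        simp only [strandHomotopy_fst, lift, ← hends _ t ht'] at hf
        have := hover i j h t ht (by linarith)
        rw [hflat _ t ht', hflat _ t ht'] at this
        exact this.false

/-! ### Closed braids and their strands -/

/-- The position reached by the strand in position `k` when the generator `σ_i` is performed. -/
def swapPos (i k : ℕ) : ℕ := if k = i then i + 1 else if k = i + 1 then i else k

theorem swapPos_swapPos (i k : ℕ) : swapPos i (swapPos i k) = k := by
  unfold swapPos
  split_ifs <;> omega

theorem swapPos_injective (i : ℕ) : Function.Injective (swapPos i) := fun k l h => by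
  rw [← swapPos_swapPos i k, h, swapPos_swapPos]

theorem swapPos_mem_Icc {n i k : ℕ} (hi : 1 ≤ i) (hin : i ≠ n) (hk : k ∈ Icc 1 n) :
    swapPos i k ∈ Icc 1 n := by
  rw [mem_Icc] at hk ⊢
  unfold swapPos
  split_ifs <;> omega

theorem strandPoint_self (i : ℕ) (t : ℝ) : strandPoint i i t =
    ((i : ℝ) + 1 / 2 - Real.cos (Real.pi * t) / 2, Real.sin (Real.pi * t) / 2) := by
  simp [strandPoint]

theorem strandPoint_succ (i : ℕ) (t : ℝ) : strandPoint i (i + 1) t =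
    ((i : ℝ) + 1 / 2 + Real.cos (Real.pi * t) / 2, -(Real.sin (Real.pi * t) / 2)) := by
  simp [strandPoint]

theorem strandPoint_of_ne {i k : ℕ} (h : k ≠ i) (h' : k ≠ i + 1) (t : ℝ) :
    strandPoint i k t = ((k : ℝ), 0) := by
  simp [strandPoint, h, h']

theorem strandPoint_zero (i k : ℕ) : strandPoint i k 0 = ((k : ℝ), 0) := by
  unfold strandPoint
  split_ifs with h h'
  · subst h; ext <;> simp
  · subst h'; ext
    · simp; ring
    · simp
  · rfl

theorem strandPoint_one (i k : ℕ) : strandPoint i k 1 = ((swapPos i k : ℝ), 0) := by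
  unfold strandPoint swapPos
  split_ifs with h h'
  · ext
    · simp; ring
    · simp
  · ext
    · simp; ring
    · simp
  · rfl

theorem continuous_strandPoint (i k : ℕ) : Continuous (strandPoint i k) := by
  unfold strandPoint
  split_ifs <;> fun_prop

theorem strandPoint_bounds (i : ℕ) {k : ℕ} (hk : k = i ∨ k = i + 1) (t : ℝ) :
    (i : ℝ) ≤ (strandPoint i k t).1 ∧ (strandPoint i k t).1 ≤ i + 1 := by
  have h1 := Real.cos_le_one (Real.pi * t)
  have h2 := Real.neg_one_le_cos (Real.pi * t)
  rcases hk with rfl | rfl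
  · rw [strandPoint_self]; constructor <;> simp only <;> linarith
  · rw [strandPoint_succ]; constructor <;> simp only <;> linarith

theorem strandPoint_pos {i k : ℕ} (hi : 1 ≤ i) (hk : 1 ≤ k) (t : ℝ) :
    0 < (strandPoint i k t).1 := by
  by_cases h : k = i ∨ k = i + 1
  · have : (1 : ℝ) ≤ i := by exact_mod_cast hi
    linarith [(strandPoint_bounds i h t).1]
  · rw [not_or] at h
    rw [strandPoint_of_ne h.1 h.2]
    exact Nat.cast_pos.2 hk

/-- While `σ_i` is performed, only the strands in positions `i` and `i + 1` change their order. -/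
theorem strandPoint_lt {i k l : ℕ} (hkl : k < l) (h : ¬(k = i ∧ l = i + 1)) (t : ℝ) :
    (strandPoint i k t).1 < (strandPoint i l t).1 := by
  by_cases hk : k = i ∨ k = i + 1
  · have hl : l ≠ i ∧ l ≠ i + 1 := by omega
    rw [strandPoint_of_ne hl.1 hl.2]
    have : (i : ℝ) + 1 < l := by exact_mod_cast (by omega : i + 1 < l)
    exact (strandPoint_bounds i hk t).2.trans_lt this
  · rw [not_or] at hk
    rw [strandPoint_of_ne hk.1 hk.2]
    by_cases hl : l = i ∨ l = i + 1
    · have : (k : ℝ) < i := by exact_mod_cast (by omega : k < i)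
      exact this.trans_le (strandPoint_bounds i hl t).1
    · rw [not_or] at hl
      rw [strandPoint_of_ne hl.1 hl.2]
      exact Nat.cast_lt.2 hkl

/-- The strand that starts in position `i` passes over the one that starts in position `i + 1`. -/
theorem strandPoint_over {i : ℕ} {t : ℝ} (ht : t ∈ Icc (0 : ℝ) 1)
    (h : (strandPoint i i t).1 = (strandPoint i (i + 1) t).1) :
    (strandPoint i (i + 1) t).2 < (strandPoint i i t).2 := by
  rw [strandPoint_self, strandPoint_succ] at h ⊢
  simp only at h ⊢
  have hc : Real.cos (Real.pi * t) = 0 := by linarith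
  have hs : 0 ≤ Real.sin (Real.pi * t) :=
    Real.sin_nonneg_of_nonneg_of_le_pi (mul_nonneg Real.pi_pos.le ht.1)
      (mul_le_of_le_one_right Real.pi_pos.le ht.2)
  have hs' : Real.sin (Real.pi * t) ≠ 0 := fun h0 => by
    have := Real.sin_sq_add_cos_sq (Real.pi * t)
    rw [h0, hc] at this
    norm_num at this
  have := lt_of_le_of_ne hs hs'.symm
  linarith

/-- The strands in positions `k ∈ K` during the sector of angles `[θ₀, θ₀ + ω]` in which `σ_i` is
performed. -/
def sweep (K : Set ℕ) (ω : ℝ) (i : ℕ) (θ₀ : ℝ) : Set E3 :=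
  {x | ∃ k ∈ K, ∃ t ∈ Icc (0 : ℝ) 1, x = cylPoint (strandPoint i k t) (θ₀ + ω * t)}

/-- The strands in positions `k ∈ K` while the letters of a word are performed, in sectors of
width `ω` starting at the angle `θ₀`. -/
def braidArc (K : Set ℕ) (ω : ℝ) : List ℕ → ℝ → Set E3
  | [], _ => ∅
  | i :: v, θ₀ => sweep K ω i θ₀ ∪ braidArc K ω v (θ₀ + ω)

/-- Parallel arcs in the positions `k ∈ K`, for angles in `[a, b]`. -/
def restArc (K : Set ℕ) (a b : ℝ) : Set E3 :=
  {x | ∃ k ∈ K, ∃ θ ∈ Icc a b, x = cylPoint ((k : ℝ), 0) θ}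

/-- The closed braid on `n` strands of a word whose letters take sectors of an arbitrary width
`ω`.  Letters `i > n` are allowed; they do nothing. -/
def wideBraid (n : ℕ) (ω : ℝ) (v : List ℕ) : Set E3 :=
  braidArc (Icc 1 n) ω v 0 ∪ restArc (Icc 1 n) (ω * v.length) (2 * Real.pi)

theorem mem_braidArc {K : Set ℕ} {ω : ℝ} {v : List ℕ} {θ₀ : ℝ} {x : E3} :
    x ∈ braidArc K ω v θ₀ ↔ ∃ j : Fin v.length, ∃ k ∈ K, ∃ t ∈ Icc (0 : ℝ) 1,
      x = cylPoint (strandPoint (v.get j) k t) (θ₀ + ω * (((j : ℕ) : ℝ) + t)) := by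
  induction v generalizing θ₀ with
  | nil => simp [braidArc]
  | cons i v ih =>
    rw [braidArc, mem_union, ih]
    simp only [List.length_cons, Fin.exists_fin_succ (n := v.length)]
    refine or_congr ?_ ?_
    · simp [sweep]
    · refine exists_congr fun j => ?_
      simp only [List.get_eq_getElem, Fin.val_succ, List.getElem_cons_succ, Nat.cast_add,
        Nat.cast_one]
      refine exists_congr fun k => and_congr_right fun _ => exists_congr fun t =>
        and_congr_right fun _ => ?_
      rw [show θ₀ + ω + ω * (((j : ℕ) : ℝ) + t) = θ₀ + ω * (((j : ℕ) : ℝ) + 1 + t) by ring]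

theorem braidArc_append (K : Set ℕ) (ω : ℝ) (v v' : List ℕ) (θ₀ : ℝ) :
    braidArc K ω (v ++ v') θ₀ = braidArc K ω v θ₀ ∪ braidArc K ω v' (θ₀ + ω * v.length) := by
  induction v generalizing θ₀ with
  | nil => simp [braidArc]
  | cons i v ih =>
    rw [List.cons_append, braidArc, ih, braidArc, union_assoc]
    congr 3
    push_cast [List.length_cons]
    ring

theorem closedBraid_eq_wideBraid (n : ℕ) (w : List ℕ) :
    closedBraid n w = wideBraid n (2 * Real.pi / (w.length + 1)) w := by
  have hm : (0 : ℝ) < w.length + 1 := by positivity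
  ext x
  refine or_congr ?_ ?_
  · rw [mem_braidArc]
    constructor
    · rintro ⟨j, k, t, h1, h2, ht, rfl⟩
      exact ⟨j, k, ⟨h1, h2⟩, t, ht, by congr 1; ring⟩
    · rintro ⟨j, k, ⟨h1, h2⟩, t, ht, rfl⟩
      exact ⟨j, k, t, h1, h2, ht, by congr 1; ring⟩
  · constructor
    · rintro ⟨k, t, h1, h2, ht, rfl⟩
      have hp := Real.pi_pos
      refine ⟨k, ⟨h1, h2⟩, _, ⟨?_, ?_⟩, rfl⟩
      · rw [div_mul_eq_mul_div]
        gcongr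
        linarith [ht.1]
      · rw [div_le_iff₀ hm]
        gcongr
        exact ht.2
    · rintro ⟨k, ⟨h1, h2⟩, θ, hθ, rfl⟩
      have hp := Real.pi_pos
      refine ⟨k, θ * (w.length + 1) / (2 * Real.pi) - w.length, h1, h2, ⟨?_, ?_⟩, ?_⟩
      · rw [sub_nonneg, le_div_iff₀ (by positivity)]
        have := hθ.1
        rw [div_mul_eq_mul_div, div_le_iff₀ hm] at this
        linarith
      · rw [sub_le_iff_le_add, div_le_iff₀ (by positivity)]
        nlinarith [hθ.2]
      · congr 1
        field_simp
        ring

theorem exists_of_mem_braidArc {K : Set ℕ} {ω : ℝ} (hω : 0 ≤ ω) {v : List ℕ}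
    (hv : ∀ i ∈ v, 1 ≤ i) (hK : ∀ k ∈ K, 1 ≤ k) {θ₀ : ℝ} {x : E3} (hx : x ∈ braidArc K ω v θ₀) :
    ∃ p θ, 0 < p.1 ∧ θ ∈ Icc θ₀ (θ₀ + ω * v.length) ∧ x = cylPoint p θ := by
  obtain ⟨j, k, hk, t, ht, rfl⟩ := mem_braidArc.1 hx
  refine ⟨_, _, strandPoint_pos (hv _ (List.get_mem _ _)) (hK k hk) t, ⟨?_, ?_⟩, rfl⟩
  · have := mul_nonneg hω (add_nonneg (Nat.cast_nonneg (α := ℝ) (j : ℕ)) ht.1)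
    linarith
  · have : ((j : ℕ) : ℝ) + 1 ≤ v.length := by exact_mod_cast j.2
    gcongr
    linarith [ht.2]

/-- The strand that starts in position `k`, followed through all letters of a word; the `j`-th
letter is performed while `j ≤ t ≤ j + 1`, and the strand rests before and after. -/
def strandPath : List ℕ → ℕ → ℝ → Plane
  | [], k, _ => ((k : ℝ), 0)
  | i :: v, k, t => if t ≤ 1 then strandPoint i k (max t 0) else strandPath v (swapPos i k) (t - 1)

/-- The position in which the strand from position `k` ends. -/
def endPos : List ℕ → ℕ → ℕ
  | [], k => k
  | i :: v, k => endPos v (swapPos i k)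

theorem strandPath_of_nonpos (v : List ℕ) (k : ℕ) {t : ℝ} (ht : t ≤ 0) :
    strandPath v k t = ((k : ℝ), 0) := by
  cases v with
  | nil => rfl
  | cons i v =>
    rw [strandPath, if_pos (by linarith), max_eq_right ht, strandPoint_zero]

theorem strandPath_of_length_le (v : List ℕ) (k : ℕ) {t : ℝ} (ht : v.length ≤ t) :
    strandPath v k t = ((endPos v k : ℝ), 0) := by
  induction v generalizing k t with
  | nil => rfl
  | cons i v ih =>
    push_cast [List.length_cons] at ht
    rw [strandPath, endPos]
    split_ifs with h
    · have h1 : t = 1 := le_antisymm h (by linarith [Nat.cast_nonneg (α := ℝ) v.length])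
      have h2 : v = [] := by
        rw [← List.length_eq_zero_iff]
        have : (v.length : ℝ) ≤ 0 := by linarith
        exact_mod_cast le_antisymm this (Nat.cast_nonneg _)
      subst h1 h2
      simp [strandPoint_one, endPos]
    · exact ih _ (by linarith)

theorem continuous_strandPath (v : List ℕ) (k : ℕ) : Continuous (strandPath v k) := by
  induction v generalizing k with
  | nil => exact continuous_const
  | cons i v ih =>
    refine Continuous.if_le ?_ ?_ continuous_id continuous_const ?_
    · exact (continuous_strandPoint i k).comp (by fun_prop)
    · exact (ih _).comp (by fun_prop)
    · rintro t rfl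
      rw [strandPath_of_nonpos _ _ (by simp)]
      simp [strandPoint_one]

theorem strandPath_pos {v : List ℕ} (hv : ∀ i ∈ v, 1 ≤ i) {k : ℕ} (hk : 1 ≤ k) (t : ℝ) :
    0 < (strandPath v k t).1 := by
  induction v generalizing k t with
  | nil => simpa [strandPath] using by omega
  | cons i v ih =>
    have hi := hv i (by simp)
    rw [strandPath]
    split_ifs
    · exact strandPoint_pos hi hk _
    · refine ih (fun j hj => hv j (by simp [hj])) ?_ _
      unfold swapPos
      split_ifs <;> omega

/-- The strands of a nonempty word, followed from beginning to end, cover its arc. -/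
theorem braidArc_eq_strandPath {n : ℕ} {ω : ℝ} {v : List ℕ} (hne : v ≠ [])
    (hv : ∀ i ∈ v, 1 ≤ i ∧ i ≠ n) (θ₀ : ℝ) :
    braidArc (Icc 1 n) ω v θ₀ = {x | ∃ k ∈ Icc 1 n, ∃ t ∈ Icc (0 : ℝ) v.length,
      x = cylPoint (strandPath v k t) (θ₀ + ω * t)} := by
  induction v generalizing θ₀ with
  | nil => exact (hne rfl).elim
  | cons i v ih =>
    obtain ⟨hi, hin⟩ := hv i (by simp)
    rw [braidArc]
    ext x
    constructor
    · rintro (⟨k, hk, t, ht, rfl⟩ | hx)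
      · refine ⟨k, hk, t, ⟨ht.1, ht.2.trans ?_⟩, ?_⟩
        · push_cast [List.length_cons]
          linarith [Nat.cast_nonneg (α := ℝ) v.length]
        · rw [strandPath, if_pos ht.2, max_eq_left ht.1]
      · have hv0 : v ≠ [] := by rintro rfl; simp [braidArc] at hx
        rw [ih hv0 fun j hj => hv j (by simp [hj])] at hx
        obtain ⟨k, hk, t, ht, rfl⟩ := hx
        refine ⟨swapPos i k, swapPos_mem_Icc hi hin hk, t + 1, ⟨by linarith [ht.1], ?_⟩, ?_⟩
        · push_cast [List.length_cons]
          linarith [ht.2]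
        · rw [show θ₀ + ω + ω * t = θ₀ + ω * (t + 1) by ring]
          congr 1
          rw [strandPath]
          split_ifs with h
          · have : t = 0 := le_antisymm (by linarith) ht.1
            subst this
            rw [strandPath_of_nonpos _ _ le_rfl]
            simp [strandPoint_one, swapPos_swapPos]
          · rw [swapPos_swapPos, add_sub_cancel_right]
    · rintro ⟨k, hk, t, ht, rfl⟩
      rw [strandPath]
      split_ifs with h
      · left
        exact ⟨k, hk, t, ⟨ht.1, h⟩, by rw [max_eq_left ht.1]⟩
      · right
        have hv0 : v ≠ [] := by
          rintro rfl
          exact h (by simpa using ht.2)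
        rw [ih hv0 fun j hj => hv j (by simp [hj])]
        refine ⟨swapPos i k, swapPos_mem_Icc hi hin hk, t - 1, ⟨by linarith, ?_⟩, ?_⟩
        · have := ht.2
          push_cast [List.length_cons] at this
          linarith
        · congr 1
          ring

/-! ### The braid relations -/

/-- Layers `e` for the strands of a word, compatible with it: `f k` is the current position of
the strand `k`; at each crossing the upper strand has the higher layer, and strands of one layer
are never permuted. -/
def Layered (e : ℕ → ℤ) : List ℕ → (ℕ → ℕ) → Prop
  | [], _ => True
  | i :: v, f => (∀ k l, f k = i → f l = i + 1 → e l < e k) ∧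
      (∀ k l, k < l → e k = e l → f k < f l) ∧ Layered e v (fun k => swapPos i (f k))

/-- Where strands of different layers have the same radius, the one of the higher layer passes over
the other. -/
theorem Layered.over {e : ℕ → ℤ} {v : List ℕ} {f : ℕ → ℕ} (h : Layered e v f)
    (hf : Function.Injective f) (hv : v ≠ []) {k l : ℕ} (hkl : e l < e k) {t : ℝ}
    (ht : t ∈ Icc (0 : ℝ) v.length)
    (heq : (strandPath v (f k) t).1 = (strandPath v (f l) t).1) :
    (strandPath v (f l) t).2 < (strandPath v (f k) t).2 := by
  induction v generalizing f t with
  | nil => exact (hv rfl).elim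
  | cons i v ih =>
    obtain ⟨h1, -, h3⟩ := h
    rw [strandPath, strandPath] at heq ⊢
    split_ifs at heq ⊢ with ht1
    · rw [max_eq_left ht.1] at heq ⊢
      have hne : f k ≠ f l := fun h => by
        rw [hf h] at hkl
        exact hkl.false
      by_cases hA : f k = i ∧ f l = i + 1
      · rw [hA.1, hA.2] at heq ⊢
        exact strandPoint_over ⟨ht.1, ht1⟩ heq
      · have hB : ¬(f l = i ∧ f k = i + 1) := fun h => (h1 l k h.1 h.2).asymm hkl
        rcases lt_or_gt_of_ne hne with h | h
        · exact ((strandPoint_lt h hA t).ne heq).elim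
        · exact ((strandPoint_lt h hB t).ne' heq).elim
    · have hv0 : v ≠ [] := by
        rintro rfl
        exact ht1 (by simpa using ht.2)
      refine ih h3 ((swapPos_injective i).comp hf) hv0 ⟨by linarith, ?_⟩ heq
      have := ht.2
      push_cast [List.length_cons] at this
      linarith

/-- Strands of the same layer never have the same radius. -/
theorem Layered.lt {e : ℕ → ℤ} {v : List ℕ} {f : ℕ → ℕ} (h : Layered e v f)
    (hv : v ≠ []) {k l : ℕ} (hkl : k < l) (he : e k = e l) {t : ℝ}
    (ht : t ∈ Icc (0 : ℝ) v.length) :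
    (strandPath v (f k) t).1 < (strandPath v (f l) t).1 := by
  induction v generalizing f t with
  | nil => exact (hv rfl).elim
  | cons i v ih =>
    obtain ⟨h1, h2, h3⟩ := h
    rw [strandPath, strandPath]
    split_ifs with ht1
    · exact strandPoint_lt (h2 k l hkl he) (fun h => (h1 k l h.1 h.2).ne he.symm) _
    · have hv0 : v ≠ [] := by
        rintro rfl
        exact ht1 (by simpa using ht.2)
      refine ih h3 hv0 ⟨by linarith, ?_⟩
      have := ht.2
      push_cast [List.length_cons] at this
      linarith

/-- A part of the link over an interval of angles does not meet the part over the other angles. -/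
theorem cylPoint_ne_of_notMem {lo hi : ℝ} (hlo : 0 ≤ lo) (hhi : hi ≤ 2 * Real.pi) {p p' : Plane}
    (hp : 0 < p.1) (hp' : 0 < p'.1) {θ θ' : ℝ} (hθ : θ ∈ Ioo lo hi)
    (hθ' : θ' ∈ Icc 0 (2 * Real.pi)) (hnot : θ' ∉ Ioo lo hi) :
    cylPoint p θ ≠ cylPoint p' θ' := by
  intro h
  have h1 : θ ∈ Ioc 0 (0 + 2 * Real.pi) := ⟨by linarith [hθ.1], by linarith [hθ.2]⟩
  rcases hθ'.1.eq_or_lt with h0 | h0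
  · rw [← cylPoint_periodic p', ← h0] at h
    have := (cylPoint_inj hp hp' h1 ⟨by linarith [Real.pi_pos], le_rfl⟩ h).2
    linarith [hθ.2]
  · have := (cylPoint_inj hp hp' h1 ⟨h0, by linarith [hθ'.2]⟩ h).2
    exact hnot (this ▸ hθ)

/-- Two words with the same permutation and common compatible layers may replace each other in a
closed braid. -/
theorem linkEquiv_of_layered {n : ℕ} {ω : ℝ} (hω : 0 < ω) {u u' v₁ v₂ : List ℕ} (e : ℕ → ℤ)
    (hne : u ≠ []) (hlen : u.length = u'.length) (hend : ∀ k, endPos u k = endPos u' k)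
    (hu : ∀ i ∈ u, 1 ≤ i ∧ i ≠ n) (hu' : ∀ i ∈ u', 1 ≤ i ∧ i ≠ n)
    (hv₁ : ∀ i ∈ v₁, 1 ≤ i) (hv₂ : ∀ i ∈ v₂, 1 ≤ i)
    (hL : Layered e u id) (hL' : Layered e u' id)
    (hfit : ω * (v₁ ++ u ++ v₂).length ≤ 2 * Real.pi) (hshort : ω * u.length < 2 * Real.pi) :
    LinkEquiv (wideBraid n ω (v₁ ++ u ++ v₂)) (wideBraid n ω (v₁ ++ u' ++ v₂)) := by
  have hne' : u' ≠ [] := by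
    rintro rfl
    exact hne (List.length_eq_zero_iff.1 hlen)
  set lo := ω * v₁.length with hlo
  set hi := lo + ω * u.length with hhi
  have hlo0 : 0 ≤ lo := by positivity
  have hlohi : lo < hi := by
    have : (0 : ℝ) < u.length := by exact_mod_cast List.length_pos_of_ne_nil hne
    have := mul_pos hω this
    linarith
  have hfit' : hi + ω * v₂.length ≤ 2 * Real.pi := by
    push_cast [List.length_append] at hfit
    rw [hhi, hlo]
    linarith
  have hv₂0 : 0 ≤ ω * v₂.length := by positivity
  let L₀ : Set E3 := braidArc (Icc 1 n) ω v₁ 0 ∪ braidArc (Icc 1 n) ω v₂ hi ∪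
    restArc (Icc 1 n) (hi + ω * v₂.length) (2 * Real.pi)
  -- The cut of the chart is placed opposite to the middle of the sector.
  let α := (lo + hi) / 2 - Real.pi
  have hsplit : ∀ w : List ℕ, w ≠ [] → w.length = u.length → (∀ i ∈ w, 1 ≤ i ∧ i ≠ n) →
      wideBraid n ω (v₁ ++ w ++ v₂) = L₀ ∪ strandImage (cylChart α)
        (fun (k : Icc 1 n) θ => strandPath w k ((θ - lo) / ω)) lo hi := by
    intro w hw hwl hwn
    have h1 : braidArc (Icc 1 n) ω w lo = strandImage (cylChart α)
        (fun (k : Icc 1 n) θ => strandPath w k ((θ - lo) / ω)) lo hi := by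
      rw [braidArc_eq_strandPath hw hwn]
      ext x
      constructor
      · rintro ⟨k, hk, t, ht, rfl⟩
        refine ⟨⟨k, hk⟩, lo + ω * t, ⟨?_, ?_⟩, ?_⟩
        · have := mul_nonneg hω.le ht.1
          linarith
        · rw [hhi, ← hwl]
          gcongr
          exact ht.2
        · simp only [cylChart_apply]
          congr 2
          field_simp
          ring
      · rintro ⟨⟨k, hk⟩, θ, hθ, rfl⟩
        refine ⟨k, hk, (θ - lo) / ω, ⟨?_, ?_⟩, ?_⟩
        · exact div_nonneg (by linarith [hθ.1]) hω.le
        · rw [div_le_iff₀ hω, hwl]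
          linarith [hθ.2]
        · simp only [cylChart_apply]
          congr 1
          field_simp
          ring
    rw [wideBraid, braidArc_append, braidArc_append, ← h1]
    simp only [L₀, List.length_append, zero_add]
    push_cast
    rw [hwl, show ω * ((v₁.length : ℝ) + u.length) = hi by rw [hhi, hlo]; ring,
      show ω * ((v₁.length : ℝ) + u.length + v₂.length) = hi + ω * v₂.length by
        rw [hhi, hlo]; ring, ← hlo]
    ext x
    simp only [mem_union]
    tauto
  rw [hsplit u hne rfl hu, hsplit u' hne' hlen.symm hu']
  have hbefore : ∀ t, t ≤ lo → (t - lo) / ω ≤ 0 := fun t ht =>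
    div_nonpos_of_nonpos_of_nonneg (by linarith) hω.le
  have hafter : ∀ t, hi ≤ t → (u.length : ℝ) ≤ (t - lo) / ω := fun t ht => by
    rw [le_div_iff₀ hω]; linarith
  have hmem : ∀ t ∈ Icc lo hi, (t - lo) / ω ∈ Icc (0 : ℝ) u.length := fun t ht =>
    ⟨div_nonneg (by linarith [ht.1]) hω.le, by rw [div_le_iff₀ hω]; linarith [ht.2]⟩
  have hout : ∀ t, t ∉ Ioo lo hi → t ≤ lo ∨ hi ≤ t := fun t ht => by
    by_contra h
    rw [not_or, not_le, not_le] at h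
    exact ht h
  have hcont : ∀ (w : List ℕ) (k : Icc 1 n),
      Continuous fun θ => strandPath w k ((θ - lo) / ω) := fun w k =>
    (continuous_strandPath w k).comp (by fun_prop)
  refine linkEquiv_of_layers (hcont u) (hcont u') (by simp only [α]; linarith)
    (by simp only [α]; linarith) ?_ ?_
    (fun k θ => strandPath_pos (fun i hi => (hu i hi).1) k.2.1 _)
    (fun k θ => strandPath_pos (fun i hi => (hu' i hi).1) k.2.1 _) (fun k => e k) ?_ ?_ ?_ ?_
  · intro k t ht
    rcases hout t ht with h | h
    · simp only [strandPath_of_nonpos _ _ (hbefore t h)]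
    · simp only [strandPath_of_length_le u _ (hafter t h),
        strandPath_of_length_le u' _ (hlen ▸ hafter t h), hend]
  · intro k t ht
    rcases hout t ht with h | h
    · simp only [strandPath_of_nonpos _ _ (hbefore t h)]
    · simp only [strandPath_of_length_le u _ (hafter t h)]
  · intro k l hkl t ht heq
    exact hL.over Function.injective_id hne hkl (hmem t ht) heq
  · intro k l hkl t ht heq
    exact hL'.over Function.injective_id hne' hkl (hlen ▸ hmem t ht) heq
  · intro k l hkl he t ht
    rcases lt_or_gt_of_ne (fun h => hkl (Subtype.ext h) : (k : ℕ) ≠ l) with h | h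
    · exact Or.inl ⟨hL.lt hne h he (hmem t ht), hL'.lt hne' h he (hlen ▸ hmem t ht)⟩
    · exact Or.inr ⟨hL.lt hne h he.symm (hmem t ht), hL'.lt hne' h he.symm (hlen ▸ hmem t ht)⟩
  · intro p θ hp hθ hx
    have hhi2 : hi ≤ 2 * Real.pi := by linarith
    rcases hx with (hx | hx) | ⟨k, hk, θ', hθ', hx⟩
    · obtain ⟨p', θ', hp', hθ', h⟩ := exists_of_mem_braidArc hω.le hv₁ (fun k hk => hk.1) hx
      rw [zero_add] at hθ'
      exact cylPoint_ne_of_notMem hlo0 hhi2 hp hp' hθ ⟨hθ'.1, by linarith [hθ'.2]⟩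
        (fun h => by linarith [h.1, hθ'.2]) h
    · obtain ⟨p', θ', hp', hθ', h⟩ := exists_of_mem_braidArc hω.le hv₂ (fun k hk => hk.1) hx
      exact cylPoint_ne_of_notMem hlo0 hhi2 hp hp' hθ ⟨by linarith [hθ'.1], by linarith [hθ'.2]⟩
        (fun h => by linarith [h.2, hθ'.1]) h
    · have hk0 : (0 : ℝ) < k := by exact_mod_cast hk.1
      exact cylPoint_ne_of_notMem hlo0 hhi2 hp hk0 hθ ⟨by linarith [hθ'.1], by linarith [hθ'.2]⟩
        (fun h => by linarith [h.2, hθ'.1]) hx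

/-- Far commutation `σ_i σ_j = σ_j σ_i`. -/
theorem linkEquiv_comm {n : ℕ} {ω : ℝ} (hω : 0 < ω) {i j : ℕ} {v₁ v₂ : List ℕ}
    (hij : i + 2 ≤ j ∨ j + 2 ≤ i) (hi : 1 ≤ i ∧ i ≠ n) (hj : 1 ≤ j ∧ j ≠ n)
    (hv₁ : ∀ i ∈ v₁, 1 ≤ i) (hv₂ : ∀ i ∈ v₂, 1 ≤ i)
    (hfit : ω * (v₁ ++ [i, j] ++ v₂).length ≤ 2 * Real.pi) (hshort : ω * 2 < 2 * Real.pi) :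
    LinkEquiv (wideBraid n ω (v₁ ++ [i, j] ++ v₂)) (wideBraid n ω (v₁ ++ [j, i] ++ v₂)) := by
  refine linkEquiv_of_layered hω
    (fun k => if k = i ∨ k = j then 1 else if k = i + 1 ∨ k = j + 1 then -1 else 0)
    (by simp) rfl ?_ (by simp [hi, hj]) (by simp [hi, hj]) hv₁ hv₂ ?_ ?_ hfit
    (by simpa using hshort)
  · intro k
    simp only [endPos, swapPos]
    split_ifs <;> omega
  · simp only [Layered, swapPos, id]
    refine ⟨fun k l hk hl => ?_, fun k l hkl he => ?_, fun k l hk hl => ?_, fun k l hkl he => ?_,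
      trivial⟩ <;> grind
  · simp only [Layered, swapPos, id]
    refine ⟨fun k l hk hl => ?_, fun k l hkl he => ?_, fun k l hk hl => ?_, fun k l hkl he => ?_,
      trivial⟩ <;> grind

/-- The braid relation `σ_i σ_{i+1} σ_i = σ_{i+1} σ_i σ_{i+1}`: the strand from position `i` passes
over the two others, and the strand from position `i + 2` passes under them. -/
theorem linkEquiv_braid {n : ℕ} {ω : ℝ} (hω : 0 < ω) {i : ℕ} {v₁ v₂ : List ℕ}
    (hi : 1 ≤ i) (hin : i + 1 < n)
    (hv₁ : ∀ i ∈ v₁, 1 ≤ i) (hv₂ : ∀ i ∈ v₂, 1 ≤ i)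
    (hfit : ω * (v₁ ++ [i, i + 1, i] ++ v₂).length ≤ 2 * Real.pi)
    (hshort : ω * 3 < 2 * Real.pi) :
    LinkEquiv (wideBraid n ω (v₁ ++ [i, i + 1, i] ++ v₂))
      (wideBraid n ω (v₁ ++ [i + 1, i, i + 1] ++ v₂)) := by
  refine linkEquiv_of_layered hω
    (fun k => if k = i then 1 else if k = i + 2 then -1 else 0)
    (by simp) rfl ?_ ?_ ?_ hv₁ hv₂ ?_ ?_ hfit (by simpa using hshort)
  · intro k
    simp only [endPos, swapPos]
    split_ifs <;> omega
  · simp; omega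
  · simp; omega
  · simp only [Layered, swapPos, id]
    refine ⟨fun k l hk hl => ?_, fun k l hkl he => ?_, fun k l hk hl => ?_, fun k l hkl he => ?_,
      fun k l hk hl => ?_, fun k l hkl he => ?_, trivial⟩ <;> grind
  · simp only [Layered, swapPos, id]
    refine ⟨fun k l hk hl => ?_, fun k l hkl he => ?_, fun k l hk hl => ?_, fun k l hkl he => ?_,
      fun k l hk hl => ?_, fun k l hkl he => ?_, trivial⟩ <;> grind

/-! ### Rotation about the axis -/

theorem continuous_strip_cylPoint {f : ℝ → Plane} (hf : Continuous f) (a b : ℝ) :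
    Continuous fun t => cylPoint (f t) (a + b * t) :=
  continuous_cylPoint.comp (f := fun t => (f t, a + b * t)) (by fun_prop)

theorem isCompact_sweep {K : Set ℕ} (hK : K.Finite) (ω : ℝ) (i : ℕ) (θ₀ : ℝ) :
    IsCompact (sweep K ω i θ₀) := by
  have : sweep K ω i θ₀ =
      ⋃ k ∈ K, (fun t => cylPoint (strandPoint i k t) (θ₀ + ω * t)) '' Icc (0 : ℝ) 1 := by
    ext x
    simp [sweep, eq_comm]
  rw [this]
  exact hK.isCompact_biUnion fun k _ => isCompact_Icc.image
    (continuous_strip_cylPoint (continuous_strandPoint i k) _ _)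

theorem isCompact_braidArc {K : Set ℕ} (hK : K.Finite) (ω : ℝ) (v : List ℕ) (θ₀ : ℝ) :
    IsCompact (braidArc K ω v θ₀) := by
  induction v generalizing θ₀ with
  | nil => exact isCompact_empty
  | cons i v ih => exact (isCompact_sweep hK _ _ _).union (ih _)

theorem isCompact_restArc {K : Set ℕ} (hK : K.Finite) (a b : ℝ) : IsCompact (restArc K a b) := by
  have : restArc K a b = ⋃ k ∈ K, (fun θ => cylPoint ((k : ℝ), 0) θ) '' Icc a b := by
    ext x
    simp [restArc, eq_comm]
  rw [this]
  refine hK.isCompact_biUnion fun k _ => isCompact_Icc.image ?_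
  simpa using continuous_strip_cylPoint (f := fun _ => ((k : ℝ), 0)) continuous_const 0 1

theorem isCompact_wideBraid (n : ℕ) (ω : ℝ) (v : List ℕ) : IsCompact (wideBraid n ω v) :=
  (isCompact_braidArc (finite_Icc _ _) _ _ _).union (isCompact_restArc (finite_Icc _ _) _ _)

/-- The rotation by the angle `a` about the third axis. -/
def rotAxis (a : ℝ) (x : E3) : E3 :=
  !₂[x 0 * Real.cos a - x 1 * Real.sin a, x 0 * Real.sin a + x 1 * Real.cos a, x 2]

theorem rotAxis_zero (a : ℝ) (x : E3) :
    rotAxis a x 0 = x 0 * Real.cos a - x 1 * Real.sin a := rfl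
theorem rotAxis_one (a : ℝ) (x : E3) :
    rotAxis a x 1 = x 0 * Real.sin a + x 1 * Real.cos a := rfl
theorem rotAxis_two (a : ℝ) (x : E3) : rotAxis a x 2 = x 2 := rfl

theorem rotAxis_cylPoint (a : ℝ) (p : Plane) (θ : ℝ) :
    rotAxis a (cylPoint p θ) = cylPoint p (θ + a) := by
  refine cylPoint_ext ?_ ?_ ?_
  · rw [rotAxis_zero, cylPoint_zero, cylPoint_one, Real.cos_add]; ring
  · rw [rotAxis_one, cylPoint_zero, cylPoint_one, Real.sin_add]; ring
  · rw [rotAxis_two, cylPoint_two]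

theorem norm_rotAxis (a : ℝ) (x : E3) : ‖rotAxis a x‖ = ‖x‖ := by
  rw [EuclideanSpace.norm_eq, EuclideanSpace.norm_eq]
  congr 1
  simp only [Fin.sum_univ_three, Real.norm_eq_abs, sq_abs, rotAxis_zero, rotAxis_one, rotAxis_two]
  linear_combination (x 0 ^ 2 + x 1 ^ 2) * Real.sin_sq_add_cos_sq a

theorem rotAxis_neg (a : ℝ) (x : E3) : rotAxis (-a) (rotAxis a x) = x := by
  rw [exists_cylPoint 0 x, rotAxis_cylPoint, rotAxis_cylPoint]
  congr 1
  ring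

theorem continuous_rotAxis : Continuous fun q : ℝ × E3 => rotAxis q.1 q.2 := by
  unfold rotAxis
  refine (PiLp.continuous_toLp 2 _).comp (continuous_pi fun i => ?_)
  fin_cases i <;> simp <;> fun_prop

/-- A compact set may be rotated about the axis; the rotation is damped far away. -/
theorem linkEquiv_rotAxis {L : Set E3} (hL : IsCompact L) (a : ℝ) :
    LinkEquiv L (rotAxis a '' L) := by
  obtain ⟨R, hR⟩ := hL.isBounded.exists_norm_le
  let f : ℝ → E3 → ℝ := fun b x => b * max 0 (min 1 (R + 1 - ‖x‖))
  have hf : ∀ b, Continuous fun x => rotAxis (f b x) x := fun b =>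
    continuous_rotAxis.comp (f := fun x => (f b x, x)) (by fun_prop)
  have hinv : ∀ b x, rotAxis (f (-b) (rotAxis (f b x) x)) (rotAxis (f b x) x) = x := by
    intro b x
    have : f (-b) (rotAxis (f b x) x) = - f b x := by
      simp only [f, norm_rotAxis]
      ring
    rw [this, rotAxis_neg]
  let φ : E3 ≃ₜ E3 :=
    { toFun := fun x => rotAxis (f a x) x
      invFun := fun x => rotAxis (f (-a) x) x
      left_inv := hinv a
      right_inv := fun x => by simpa using hinv (-a) x
      continuous_toFun := hf a
      continuous_invFun := hf (-a) }
  refine ⟨φ, Metric.closedBall 0 (R + 1), isCompact_closedBall _ _, fun x hx => ?_, ?_⟩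
  · change rotAxis (f a x) x = x
    have h1 : R + 1 - ‖x‖ ≤ 0 := by
      simp at hx
      linarith
    have h2 : f a x = 0 := by
      simp only [f]
      rw [max_eq_left ((min_le_right _ _).trans h1), mul_zero]
    rw [h2, exists_cylPoint 0 x, rotAxis_cylPoint, add_zero]
  · refine image_congr fun x hx => ?_
    change rotAxis (f a x) x = _
    have h1 : (1 : ℝ) ≤ R + 1 - ‖x‖ := by linarith [hR x hx]
    simp [f, h1]

theorem rotAxis_image_braidArc (a : ℝ) (K : Set ℕ) (ω : ℝ) (v : List ℕ) (θ₀ : ℝ) :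
    rotAxis a '' braidArc K ω v θ₀ = braidArc K ω v (θ₀ + a) := by
  ext x
  simp only [mem_image, mem_braidArc]
  constructor
  · rintro ⟨_, ⟨j, k, hk, t, ht, rfl⟩, rfl⟩
    exact ⟨j, k, hk, t, ht, by rw [rotAxis_cylPoint]; congr 1; ring⟩
  · rintro ⟨j, k, hk, t, ht, rfl⟩
    exact ⟨_, ⟨j, k, hk, t, ht, rfl⟩, by rw [rotAxis_cylPoint]; congr 1; ring⟩

theorem rotAxis_image_restArc (a : ℝ) (K : Set ℕ) (b c : ℝ) :
    rotAxis a '' restArc K b c = restArc K (b + a) (c + a) := by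
  ext x
  constructor
  · rintro ⟨_, ⟨k, hk, θ, hθ, rfl⟩, rfl⟩
    exact ⟨k, hk, θ + a, ⟨by linarith [hθ.1], by linarith [hθ.2]⟩, rotAxis_cylPoint _ _ _⟩
  · rintro ⟨k, hk, θ, hθ, rfl⟩
    refine ⟨_, ⟨k, hk, θ - a, ⟨by linarith [hθ.1], by linarith [hθ.2]⟩, rfl⟩, ?_⟩
    rw [rotAxis_cylPoint, sub_add_cancel]

theorem braidArc_periodic (K : Set ℕ) (ω : ℝ) (v : List ℕ) (θ₀ : ℝ) :
    braidArc K ω v (θ₀ + 2 * Real.pi) = braidArc K ω v θ₀ := by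
  ext x
  simp only [mem_braidArc]
  refine exists_congr fun j => exists_congr fun k => and_congr_right fun _ =>
    exists_congr fun t => and_congr_right fun _ => ?_
  rw [add_right_comm, cylPoint_periodic]

/-- A letter that permutes none of the strands in `K` contributes parallel arcs. -/
theorem sweep_eq_restArc {K : Set ℕ} {ω : ℝ} (hω : 0 < ω) {i : ℕ} (hi : i ∉ K) (hi' : i + 1 ∉ K)
    (θ₀ : ℝ) : sweep K ω i θ₀ = restArc K θ₀ (θ₀ + ω) := by
  ext x
  constructor
  · rintro ⟨k, hk, t, ht, rfl⟩
    rw [strandPoint_of_ne (by rintro rfl; exact hi hk) (by rintro rfl; exact hi' hk)]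
    refine ⟨k, hk, _, ⟨?_, ?_⟩, rfl⟩
    · linarith [mul_nonneg hω.le ht.1]
    · linarith [mul_le_of_le_one_right hω.le ht.2]
  · rintro ⟨k, hk, θ, hθ, rfl⟩
    refine ⟨k, hk, (θ - θ₀) / ω, ⟨?_, ?_⟩, ?_⟩
    · exact div_nonneg (by linarith [hθ.1]) hω.le
    · rw [div_le_one hω]; linarith [hθ.2]
    · rw [strandPoint_of_ne (by rintro rfl; exact hi hk) (by rintro rfl; exact hi' hk)]
      congr 1
      field_simp
      ring

theorem restArc_union {K : Set ℕ} {a b c : ℝ} (hab : a ≤ b) (hbc : b ≤ c) :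
    restArc K a b ∪ restArc K b c = restArc K a c := by
  ext x
  constructor
  · rintro (⟨k, hk, θ, hθ, rfl⟩ | ⟨k, hk, θ, hθ, rfl⟩)
    · exact ⟨k, hk, θ, ⟨hθ.1, hθ.2.trans hbc⟩, rfl⟩
    · exact ⟨k, hk, θ, ⟨hab.trans hθ.1, hθ.2⟩, rfl⟩
  · rintro ⟨k, hk, θ, hθ, rfl⟩
    rcases le_total θ b with h | h
    · exact Or.inl ⟨k, hk, θ, ⟨hθ.1, h⟩, rfl⟩
    · exact Or.inr ⟨k, hk, θ, ⟨h, hθ.2⟩, rfl⟩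

theorem notMem_Icc_succ {n : ℕ} : n + 1 ∉ Icc 1 n ∧ n + 1 + 1 ∉ Icc 1 n := by
  simp

/-- A trivial letter at the end of a word may be dropped. -/
theorem wideBraid_append_trivial {n : ℕ} {ω : ℝ} (hω : 0 < ω) {v : List ℕ}
    (hfit : ω * (v.length + 1) ≤ 2 * Real.pi) :
    wideBraid n ω (v ++ [n + 1]) = wideBraid n ω v := by
  rw [wideBraid, wideBraid, braidArc_append, braidArc, braidArc, union_empty,
    sweep_eq_restArc hω notMem_Icc_succ.1 notMem_Icc_succ.2, union_assoc]
  push_cast [List.length_append, List.length_singleton]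
  rw [zero_add, mul_add, mul_one, restArc_union (by linarith) (by linarith)]

/-- Conjugation: the first letter of a word may be moved to its end.  The closed braid is rotated
by one sector, and the letter is then commuted with the trivial letter before it. -/
theorem linkEquiv_rotate {n : ℕ} {i : ℕ} {v : List ℕ} (hi : 1 ≤ i ∧ i < n)
    (hv : ∀ j ∈ v, 1 ≤ j) :
    LinkEquiv (closedBraid n (i :: v)) (closedBraid n (v ++ [i])) := by
  rcases eq_or_ne v [] with rfl | hne
  · exact LinkEquiv.refl _
  rw [closedBraid_eq_wideBraid, closedBraid_eq_wideBraid]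
  have hlen : (v ++ [i]).length = (i :: v).length := by simp
  rw [hlen]
  set ω : ℝ := 2 * Real.pi / ((i :: v).length + 1) with hω
  have hp := Real.pi_pos
  have hω0 : 0 < ω := by positivity
  have hω1 : ω * (v.length + 2) = 2 * Real.pi := by
    rw [hω]
    push_cast [List.length_cons]
    field_simp
    ring
  have hv1 : (1 : ℝ) ≤ v.length := by exact_mod_cast List.length_pos_of_ne_nil hne
  have h1 : rotAxis (-ω) '' wideBraid n ω (i :: v) = wideBraid n ω (v ++ [n + 1, i] ++ []) := by
    have h3 : restArc (Icc 1 n) (2 * Real.pi) (2 * Real.pi) ⊆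
        sweep (Icc 1 n) ω i (2 * Real.pi - ω) := by
      rintro _ ⟨k, hk, θ, hθ, rfl⟩
      refine ⟨swapPos i k, swapPos_mem_Icc hi.1 hi.2.ne hk, 1, by simp, ?_⟩
      rw [strandPoint_one, swapPos_swapPos]
      congr 1
      linarith [hθ.1, hθ.2]
    rw [wideBraid, image_union, rotAxis_image_braidArc, rotAxis_image_restArc, List.append_nil,
      wideBraid, braidArc_append, braidArc, braidArc, braidArc, braidArc, union_empty,
      sweep_eq_restArc hω0 notMem_Icc_succ.1 notMem_Icc_succ.2]
    have h4 : sweep (Icc 1 n) ω i (0 + -ω) = sweep (Icc 1 n) ω i (2 * Real.pi - ω) := by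
      have := braidArc_periodic (Icc 1 n) ω [i] (0 + -ω)
      simp only [braidArc, union_empty] at this
      rw [← this]
      congr 1
      ring
    rw [h4]
    push_cast [List.length_append, List.length_cons, List.length_nil]
    rw [show (0 : ℝ) + -ω + ω = 0 by ring,
      show ω * ((v.length : ℝ) + 1) + -ω = ω * v.length by ring,
      show 2 * Real.pi + -ω = 2 * Real.pi - ω by ring, zero_add,
      show ω * (v.length : ℝ) + ω = 2 * Real.pi - ω by linarith,
      hω1]
    ext x
    have := @h3 x
    simp only [mem_union]
    tauto
  have h5 := linkEquiv_rotAxis (isCompact_wideBraid n ω (i :: v)) (-ω)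
  rw [h1] at h5
  have h6 := linkEquiv_comm (n := n) hω0 (i := n + 1) (j := i) (v₁ := v) (v₂ := [])
    (by omega) (by omega) (by omega) hv (by simp)
    (by push_cast [List.length_append, List.length_cons, List.length_nil]; linarith)
    (by nlinarith)
  have h7 : wideBraid n ω (v ++ [i, n + 1] ++ []) = wideBraid n ω (v ++ [i]) := by
    rw [show v ++ [i, n + 1] ++ [] = (v ++ [i]) ++ [n + 1] by simp]
    refine wideBraid_append_trivial hω0 ?_
    push_cast [List.length_append, List.length_cons, List.length_nil]
    linarith
  rw [← h7]
  exact h5.trans h6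

/-! ### Changing the width of the sectors -/

/-- A reparametrization of angles: multiplication by `l ≤ 1` on `[0, b]`, and the identity off
`[0, β]`, where `b < β`. -/
def squeeze (l b β θ : ℝ) : ℝ := min θ (max (l * θ) (β - β / (β - b) * (β - θ)))

theorem continuous_squeeze (l b β : ℝ) : Continuous (squeeze l b β) := by
  unfold squeeze
  fun_prop

theorem squeeze_strictMono {l b β : ℝ} (hl : 0 < l) (hb : 0 ≤ b) (hbβ : b < β) :
    StrictMono (squeeze l b β) := by
  intro θ θ' h
  have h0 : 0 < β / (β - b) := div_pos (by linarith) (by linarith)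
  refine min_lt_min h (max_lt_max (mul_lt_mul_of_pos_left h hl) ?_)
  have := mul_lt_mul_of_pos_left h h0
  linarith

theorem squeeze_of_nonpos {l b β θ : ℝ} (hl1 : l ≤ 1) (hθ : θ ≤ 0) : squeeze l b β θ = θ := by
  refine min_eq_left (le_max_of_le_left ?_)
  nlinarith

theorem squeeze_of_le {l b β θ : ℝ} (hb : 0 ≤ b) (hbβ : b < β) (hθ : β ≤ θ) :
    squeeze l b β θ = θ := by
  refine min_eq_left (le_max_of_le_right ?_)
  have h0 : 1 ≤ β / (β - b) := by
    rw [one_le_div (by linarith)]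
    linarith
  nlinarith

theorem squeeze_of_mem {l b β θ : ℝ} (hl : 0 < l) (hl1 : l ≤ 1) (hb : 0 ≤ b) (hbβ : b < β)
    (hθ : θ ∈ Icc 0 b) : squeeze l b β θ = l * θ := by
  have h0 : β / (β - b) * (β - θ) ≥ β := by
    rw [ge_iff_le, div_mul_eq_mul_div, le_div_iff₀ (by linarith)]
    nlinarith [hθ.2]
  have h1 : 0 ≤ l * θ := mul_nonneg hl.le hθ.1
  rw [squeeze, max_eq_left (by linarith), min_eq_right (by nlinarith [hθ.1])]

theorem squeeze_image {l b β : ℝ} (hl : 0 < l) (hl1 : l ≤ 1) (hb : 0 ≤ b) (hbβ : b < β) :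
    squeeze l b β '' Icc b β = Icc (l * b) β := by
  have h1 : squeeze l b β b = l * b := squeeze_of_mem hl hl1 hb hbβ ⟨hb, le_rfl⟩
  have h2 : squeeze l b β β = β := squeeze_of_le hb hbβ le_rfl
  apply Subset.antisymm
  · rintro _ ⟨θ, hθ, rfl⟩
    have hm := (squeeze_strictMono hl hb hbβ).monotone
    exact ⟨h1 ▸ hm hθ.1, (hm hθ.2).trans_eq h2⟩
  · have := intermediate_value_Icc hbβ.le (continuous_squeeze l b β).continuousOn
    rwa [h1, h2] at this

theorem norm_sq_cylPoint (p : Plane) (θ : ℝ) : ‖cylPoint p θ‖ ^ 2 = p.1 ^ 2 + p.2 ^ 2 := by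
  rw [EuclideanSpace.norm_sq_eq]
  simp only [Fin.sum_univ_three, Real.norm_eq_abs, sq_abs, cylPoint_zero, cylPoint_one,
    cylPoint_two]
  linear_combination p.1 ^ 2 * Real.sin_sq_add_cos_sq θ

/-- The sectors of a closed braid may be narrowed by the factor `l`. -/
theorem linkEquiv_width_of_le {n : ℕ} {ω l : ℝ} (hω : 0 < ω) (hl : 0 < l) (hl1 : l ≤ 1)
    {v : List ℕ} (hv : ∀ i ∈ v, 1 ≤ i) (hfit : ω * v.length < 2 * Real.pi) :
    LinkEquiv (wideBraid n ω v) (wideBraid n (l * ω) v) := by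
  obtain ⟨R, hR⟩ := (isCompact_wideBraid n ω v).isBounded.exists_norm_le
  -- The letters of the word occupy the angles `[0, b]`; angles beyond `β` are left alone.
  set b := ω * v.length with hbdef
  have hb : 0 ≤ b := by positivity
  set β := (b + 2 * Real.pi) / 2 with hβ
  have hbβ : b < β := by rw [hβ]; linarith
  have hβ2 : β < 2 * Real.pi := by rw [hβ]; linarith
  set η := (2 * Real.pi - β) / 2 with hη
  have hη0 : 0 < η := by rw [hη]; linarith
  set g := squeeze l b β with hg
  have hgm : StrictMono g := squeeze_strictMono hl hb hbβ
  -- A cut-off: `1` on the strands, `0` near the axis and far away.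
  let χ : Plane → ℝ := fun p =>
    max 0 (min 1 (min (min (2 * p.1 - 1) (R + 1 - p.1)) (R + 1 - |p.2|)))
  have hχc : Continuous χ := by fun_prop
  have hχ0 : ∀ p, 0 ≤ χ p := fun p => le_max_left _ _
  have hχ1 : ∀ p, χ p ≤ 1 := fun p => max_le zero_le_one (min_le_left _ _)
  let f : Plane × ℝ → Plane × ℝ := fun q => (q.1, (1 - χ q.1) * q.2 + χ q.1 * g q.2)
  have hfc : Continuous f := by
    have := continuous_squeeze l b β
    fun_prop
  let K : Set (Plane × ℝ) := (Icc (1 / 2) (R + 1) ×ˢ Icc (-(R + 1)) (R + 1)) ×ˢ Icc 0 β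
  have hgid : ∀ θ, θ ∉ Icc 0 β → g θ = θ := by
    intro θ hθ
    rw [mem_Icc, not_and_or, not_le, not_le] at hθ
    rcases hθ with h | h
    · exact squeeze_of_nonpos hl1 h.le
    · exact squeeze_of_le hb hbβ h.le
  have hgid' : ∀ p θ, g θ = θ → f (p, θ) = (p, θ) := by
    intro p θ h
    simp only [f, h]
    congr 1
    ring
  have hfK : ∀ q, q ∉ K → f q = q := by
    rintro ⟨p, θ⟩ hq
    by_cases hθ : θ ∈ Icc 0 β
    · have : χ p = 0 := by
        refine max_eq_left ?_
        by_contra h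
        rw [not_le, lt_min_iff, lt_min_iff, lt_min_iff] at h
        obtain ⟨-, ⟨h1, h2⟩, h3⟩ := h
        have := abs_le.1 (by linarith : |p.2| ≤ R + 1)
        exact hq ⟨⟨⟨by linarith, by linarith⟩, this⟩, hθ⟩
      simp [f, this]
    · exact hgid' p θ (hgid θ hθ)
  have hfm : ∀ p, StrictMono fun θ => (1 - χ p) * θ + χ p * g θ := by
    intro p θ θ' h
    have h1 := hgm h
    have := convex_comb_pos ⟨hχ0 p, hχ1 p⟩ (sub_pos.2 h) (sub_pos.2 h1)
    simp only
    linarith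
  have hfb : Function.Bijective f := by
    constructor
    · rintro ⟨p, θ⟩ ⟨p', θ'⟩ h
      simp only [f, Prod.mk.injEq] at h
      obtain ⟨rfl, h⟩ := h
      rw [(hfm p).injective h]
    · rintro ⟨p, θ⟩
      by_cases hθ : θ ∈ Icc 0 β
      · have h0 : g 0 = 0 := squeeze_of_nonpos hl1 le_rfl
        have h1 : g β = β := squeeze_of_le hb hbβ le_rfl
        have hc : Continuous fun θ => (1 - χ p) * θ + χ p * g θ := by
          have := continuous_squeeze l b β
          fun_prop
        have := intermediate_value_Icc (hb.trans hbβ.le) hc.continuousOn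
        simp only [h0, h1] at this
        rw [show (1 - χ p) * 0 + χ p * 0 = 0 by ring,
          show (1 - χ p) * β + χ p * β = β by ring] at this
        obtain ⟨θ', -, h⟩ := this hθ
        exact ⟨(p, θ'), Prod.ext rfl h⟩
      · exact ⟨(p, θ), hgid' p θ (hgid θ hθ)⟩
  have hK : IsCompact K := (isCompact_Icc.prod isCompact_Icc).prod isCompact_Icc
  obtain ⟨ψ, hψ⟩ := exists_homeomorph_of_eq_off_compact hfc hfb hK hfK
  have hKs : K ⊆ (cylChart (-η)).source := by
    rintro ⟨p, θ⟩ ⟨⟨h1, -⟩, h2⟩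
    refine ⟨by linarith [h1.1], ?_, ?_⟩
    · linarith [h2.1]
    · simp only
      linarith [h2.2]
  have hψ1 : ∀ p θ, χ p = 1 → ψ (p, θ) = (p, g θ) := by
    intro p θ h
    simp [hψ, f, h]
  have hχp : ∀ p θ, 1 ≤ p.1 → cylPoint p θ ∈ wideBraid n ω v → χ p = 1 := by
    intro p θ hp hx
    have h1 := hR _ hx
    have h2 := norm_sq_cylPoint p θ
    have h3 : 0 ≤ ‖cylPoint p θ‖ := norm_nonneg _
    have h4 : p.1 ≤ R := by nlinarith [sq_nonneg p.2]
    have h5 : |p.2| ≤ R := by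
      rw [← abs_of_nonneg (h3.trans h1)]
      exact sq_le_sq.1 (by nlinarith [sq_nonneg p.1])
    simp only [χ]
    rw [min_eq_left, max_eq_right zero_le_one]
    refine le_min (le_min ?_ ?_) ?_ <;> linarith
  let A₁ : Set (Plane × ℝ) := {q | ∃ j : Fin v.length, ∃ k ∈ Icc 1 n, ∃ t ∈ Icc (0 : ℝ) 1,
    q = (strandPoint (v.get j) k t, ω * (((j : ℕ) : ℝ) + t))}
  let A₁' : Set (Plane × ℝ) := {q | ∃ j : Fin v.length, ∃ k ∈ Icc 1 n, ∃ t ∈ Icc (0 : ℝ) 1,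
    q = (strandPoint (v.get j) k t, l * ω * (((j : ℕ) : ℝ) + t))}
  let A₂ : ℝ → Set (Plane × ℝ) := fun c => {q | ∃ k ∈ Icc 1 n, ∃ θ ∈ Icc c β, q = (((k : ℝ), 0), θ)}
  have hbβ' : l * b ≤ β := by nlinarith
  have hL : wideBraid n ω v = restArc (Icc 1 n) β (2 * Real.pi) ∪ cylChart (-η) '' (A₁ ∪ A₂ b) := by
    rw [wideBraid, ← hbdef, ← restArc_union hbβ.le hβ2.le, image_union]
    have h1 : braidArc (Icc 1 n) ω v 0 = cylChart (-η) '' A₁ := by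
      ext x
      rw [mem_braidArc]
      constructor
      · rintro ⟨j, k, hk, t, ht, rfl⟩
        exact ⟨_, ⟨j, k, hk, t, ht, rfl⟩, by simp⟩
      · rintro ⟨_, ⟨j, k, hk, t, ht, rfl⟩, rfl⟩
        exact ⟨j, k, hk, t, ht, by simp⟩
    have h2 : restArc (Icc 1 n) b β = cylChart (-η) '' A₂ b := by
      ext x
      constructor
      · rintro ⟨k, hk, θ, hθ, rfl⟩
        exact ⟨_, ⟨k, hk, θ, hθ, rfl⟩, rfl⟩
      · rintro ⟨_, ⟨k, hk, θ, hθ, rfl⟩, rfl⟩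
        exact ⟨k, hk, θ, hθ, rfl⟩
    rw [h1, h2]
    ext x
    simp only [mem_union]
    tauto
  have hL' : wideBraid n (l * ω) v =
      restArc (Icc 1 n) β (2 * Real.pi) ∪ cylChart (-η) '' (A₁' ∪ A₂ (l * b)) := by
    rw [wideBraid, mul_assoc, ← hbdef, ← restArc_union hbβ' hβ2.le, image_union]
    have h1 : braidArc (Icc 1 n) (l * ω) v 0 = cylChart (-η) '' A₁' := by
      ext x
      rw [mem_braidArc]
      constructor
      · rintro ⟨j, k, hk, t, ht, rfl⟩
        exact ⟨_, ⟨j, k, hk, t, ht, rfl⟩, by simp⟩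
      · rintro ⟨_, ⟨j, k, hk, t, ht, rfl⟩, rfl⟩
        exact ⟨j, k, hk, t, ht, by simp⟩
    have h2 : restArc (Icc 1 n) (l * b) β = cylChart (-η) '' A₂ (l * b) := by
      ext x
      constructor
      · rintro ⟨k, hk, θ, hθ, rfl⟩
        exact ⟨_, ⟨k, hk, θ, hθ, rfl⟩, rfl⟩
      · rintro ⟨_, ⟨k, hk, θ, hθ, rfl⟩, rfl⟩
        exact ⟨k, hk, θ, hθ, rfl⟩
    rw [h1, h2]
    ext x
    simp only [mem_union]
    tauto
  have hone : ∀ i ∈ v, ∀ k ∈ Icc 1 n, ∀ t, 1 ≤ (strandPoint i k t).1 := by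
    intro i hi k hk t
    by_cases h : k = i ∨ k = i + 1
    · have : (1 : ℝ) ≤ i := by exact_mod_cast hv i hi
      exact this.trans (strandPoint_bounds i h t).1
    · rw [not_or] at h
      rw [strandPoint_of_ne h.1 h.2]
      exact Nat.one_le_cast.2 hk.1
  have hang : ∀ (j : Fin v.length) (t : ℝ), t ∈ Icc (0 : ℝ) 1 →
      ω * (((j : ℕ) : ℝ) + t) ∈ Icc 0 b := by
    intro j t ht
    have h1 : ((j : ℕ) : ℝ) + 1 ≤ v.length := by exact_mod_cast j.2
    refine ⟨mul_nonneg hω.le (add_nonneg (Nat.cast_nonneg _) ht.1), ?_⟩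
    rw [hbdef]
    gcongr
    linarith [ht.2]
  have hA₁ : ∀ q ∈ A₁, χ q.1 = 1 := by
    rintro _ ⟨j, k, hk, t, ht, rfl⟩
    refine hχp _ (ω * (((j : ℕ) : ℝ) + t)) (hone _ (List.get_mem _ _) k hk t) (Or.inl ?_)
    rw [mem_braidArc]
    exact ⟨j, k, hk, t, ht, by simp⟩
  have hrest : ∀ k ∈ Icc 1 n, χ ((k : ℝ), 0) = 1 := by
    intro k hk
    refine hχp _ (2 * Real.pi) (Nat.one_le_cast.2 hk.1) (Or.inr ?_)
    exact ⟨k, hk, _, ⟨hfit.le, le_rfl⟩, rfl⟩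
  rw [hL, hL']
  refine linkEquiv_of_chart (cylChart (-η)) ψ hK hKs (fun q hq => by rw [hψ, hfK q hq]) ?_ ?_ ?_
  · rintro _ (⟨j, k, hk, t, ht, rfl⟩ | ⟨k, hk, θ, hθ, rfl⟩)
    · have := hang j t ht
      exact ⟨zero_lt_one.trans_le (hone _ (List.get_mem _ _) k hk t), by linarith [this.1],
        by simp only; linarith [this.2]⟩
    · exact ⟨Nat.cast_pos.2 hk.1, by linarith [hθ.1], by simp only; linarith [hθ.2]⟩
  · rw [image_union]
    congr 1
    · ext q
      constructor
      · rintro ⟨_, ⟨j, k, hk, t, ht, rfl⟩, rfl⟩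
        refine ⟨j, k, hk, t, ht, ?_⟩
        rw [hψ1 _ _ (hA₁ _ ⟨j, k, hk, t, ht, rfl⟩), hg, squeeze_of_mem hl hl1 hb hbβ (hang j t ht),
          mul_assoc]
      · rintro ⟨j, k, hk, t, ht, rfl⟩
        refine ⟨_, ⟨j, k, hk, t, ht, rfl⟩, ?_⟩
        rw [hψ1 _ _ (hA₁ _ ⟨j, k, hk, t, ht, rfl⟩), hg, squeeze_of_mem hl hl1 hb hbβ (hang j t ht),
          mul_assoc]
    · have himg := squeeze_image hl hl1 hb hbβ
      ext q
      constructor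
      · rintro ⟨_, ⟨k, hk, θ, hθ, rfl⟩, rfl⟩
        exact ⟨k, hk, g θ, himg ▸ mem_image_of_mem _ hθ, hψ1 _ _ (hrest k hk)⟩
      · rintro ⟨k, hk, θ, hθ, rfl⟩
        rw [← himg] at hθ
        obtain ⟨θ', hθ', rfl⟩ := hθ
        exact ⟨_, ⟨k, hk, θ', hθ', rfl⟩, hψ1 _ _ (hrest k hk)⟩
  · rintro ⟨p, θ⟩ ⟨hp, hθ⟩ ⟨k, hk, θ', hθ', h⟩
    rw [hψ]
    refine hgid' p θ ?_
    by_cases hm : θ ∈ Ioo 0 β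
    · exact (cylPoint_ne_of_notMem le_rfl hβ2.le hp (Nat.cast_pos.2 hk.1) hm
        ⟨by linarith [hθ'.1], hθ'.2⟩ (fun h => by linarith [h.2, hθ'.1]) h).elim
    · rw [mem_Ioo, not_and_or, not_lt, not_lt] at hm
      rcases hm with h | h
      · exact squeeze_of_nonpos hl1 h
      · exact squeeze_of_le hb hbβ h

/-- The closed braid does not depend on the width of its sectors. -/
theorem linkEquiv_width {n : ℕ} {ω ω' : ℝ} (hω : 0 < ω) (hω' : 0 < ω')
    {v : List ℕ} (hv : ∀ i ∈ v, 1 ≤ i) (hfit : ω * v.length < 2 * Real.pi)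
    (hfit' : ω' * v.length < 2 * Real.pi) :
    LinkEquiv (wideBraid n ω v) (wideBraid n ω' v) := by
  rcases le_total ω' ω with h | h
  · have := linkEquiv_width_of_le (n := n) hω (div_pos hω' hω) ((div_le_one hω).2 h) hv hfit
    rwa [div_mul_cancel₀ _ hω.ne'] at this
  · have := linkEquiv_width_of_le (n := n) hω' (div_pos hω hω') ((div_le_one hω').2 h) hv hfit'
    rw [div_mul_cancel₀ _ hω'.ne'] at this
    exact this.symm

/-! ### Half-turns of the meridional half-planes -/

/-- The distance of a point of the half-plane from the centre `(c, 0)`. -/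
def centreDist (c : ℝ) (p : Plane) : ℝ := Real.sqrt ((p.1 - c) ^ 2 + p.2 ^ 2)

/-- The angle of the half-turn `flipPlane`, damped to zero at the distance `c - 1/2` from the
centre. -/
def flipAngle (c s : ℝ) (p : Plane) : ℝ :=
  s * Real.pi * max 0 (min 1 (2 * c - 1 - 2 * centreDist c p))

/-- The half-turn about `(c, 0)` (for `s = 1`) and its inverse (for `s = -1`): a rotation by `s π`
at distances at most `c - 1` from the centre, damped to the identity at the distance `c - 1/2`. -/
def flipPlane (c s : ℝ) (p : Plane) : Plane :=
  (c + ((p.1 - c) * Real.cos (flipAngle c s p) - p.2 * Real.sin (flipAngle c s p)),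
    (p.1 - c) * Real.sin (flipAngle c s p) + p.2 * Real.cos (flipAngle c s p))

theorem continuous_flipPlane (c s : ℝ) : Continuous (flipPlane c s) := by
  unfold flipPlane flipAngle centreDist
  fun_prop

theorem centreDist_flipPlane (c s : ℝ) (p : Plane) :
    centreDist c (flipPlane c s p) = centreDist c p := by
  simp only [centreDist, flipPlane]
  congr 1
  linear_combination ((p.1 - c) ^ 2 + p.2 ^ 2) * Real.sin_sq_add_cos_sq (flipAngle c s p)

theorem flipPlane_neg (c s : ℝ) (p : Plane) : flipPlane c (-s) (flipPlane c s p) = p := by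
  have h : flipAngle c (-s) (flipPlane c s p) = -flipAngle c s p := by
    simp only [flipAngle, centreDist_flipPlane]
    ring
  have h2 := Real.sin_sq_add_cos_sq (flipAngle c s p)
  ext
  · simp only [flipPlane, flipAngle] at h ⊢
    rw [h, Real.cos_neg, Real.sin_neg]
    simp only [flipAngle] at h2
    linear_combination (p.1 - c) * h2
  · simp only [flipPlane, flipAngle] at h ⊢
    rw [h, Real.cos_neg, Real.sin_neg]
    simp only [flipAngle] at h2
    linear_combination p.2 * h2

theorem flipPlane_of_far {c s : ℝ} {p : Plane} (h : c - 1 / 2 ≤ centreDist c p) :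
    flipPlane c s p = p := by
  have : flipAngle c s p = 0 := by
    rw [flipAngle, max_eq_left ((min_le_right _ _).trans (by linarith)), mul_zero]
  simp [flipPlane, this]

theorem flipPlane_of_near {c : ℝ} {p : Plane} (h : centreDist c p ≤ c - 1) :
    flipPlane c 1 p = (2 * c - p.1, -p.2) := by
  have : flipAngle c 1 p = Real.pi := by
    rw [flipAngle, min_eq_left (by linarith), max_eq_right zero_le_one]
    ring
  simp only [flipPlane, this, Real.cos_pi, Real.sin_pi]
  ext <;> simp only <;> ring

theorem flipPlane_fst_nonneg (c s : ℝ) {p : Plane} (hp : 0 ≤ p.1) :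
    0 ≤ (flipPlane c s p).1 := by
  by_cases h : c - 1 / 2 ≤ centreDist c p
  · rwa [flipPlane_of_far h]
  · have h1 := centreDist_flipPlane c s p
    have h2 : |(flipPlane c s p).1 - c| ≤ centreDist c (flipPlane c s p) :=
      Real.abs_le_sqrt (by linarith [sq_nonneg (flipPlane c s p).2])
    linarith [neg_abs_le ((flipPlane c s p).1 - c)]

/-- The map of `ℝ³` that applies `flipPlane` to every meridional half-plane. -/
def flipSpace (c s : ℝ) (x : E3) : E3 :=
  !₂[x 0 * ((flipPlane c s (rad x, x 2)).1 / rad x),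
    x 1 * ((flipPlane c s (rad x, x 2)).1 / rad x), (flipPlane c s (rad x, x 2)).2]

theorem flipPlane_of_fst_le {c s : ℝ} {p : Plane} (hp : p.1 ≤ 1 / 2) : flipPlane c s p = p := by
  refine flipPlane_of_far ?_
  have : |p.1 - c| ≤ centreDist c p := Real.abs_le_sqrt (by linarith [sq_nonneg p.2])
  linarith [neg_abs_le (p.1 - c)]

theorem flipSpace_cylPoint (c s : ℝ) {p : Plane} (hp : 0 ≤ p.1) (θ : ℝ) :
    flipSpace c s (cylPoint p θ) = cylPoint (flipPlane c s p) θ := by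
  have h : ((rad (cylPoint p θ), cylPoint p θ 2) : Plane) = p :=
    Prod.ext (rad_cylPoint hp θ) rfl
  have h2 : p.1 * ((flipPlane c s p).1 / p.1) = (flipPlane c s p).1 := by
    rcases hp.eq_or_lt with h0 | h0
    · rw [flipPlane_of_fst_le (by linarith), ← h0]; simp
    · field_simp
  unfold flipSpace
  rw [h, rad_cylPoint hp]
  refine cylPoint_ext ?_ ?_ rfl
  · change cylPoint p θ 0 * _ = _
    rw [cylPoint_zero]
    linear_combination Real.cos θ * h2
  · change cylPoint p θ 1 * _ = _
    rw [cylPoint_one]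
    linear_combination Real.sin θ * h2

theorem flipSpace_neg (c s : ℝ) (x : E3) : flipSpace c (-s) (flipSpace c s x) = x := by
  have h : 0 ≤ ((rad x, x 2) : Plane).1 := rad_nonneg x
  conv_rhs => rw [exists_cylPoint 0 x]
  conv_lhs => rw [exists_cylPoint 0 x]
  rw [flipSpace_cylPoint c s h, flipSpace_cylPoint c (-s) (flipPlane_fst_nonneg c s h),
    flipPlane_neg]

theorem flipSpace_of_far {c s : ℝ} {x : E3} (h : c - 1 / 2 ≤ centreDist c (rad x, x 2)) :
    flipSpace c s x = x := by
  have h0 : 0 ≤ ((rad x, x 2) : Plane).1 := rad_nonneg x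
  conv_rhs => rw [exists_cylPoint 0 x]
  conv_lhs => rw [exists_cylPoint 0 x]
  rw [flipSpace_cylPoint c s h0, flipPlane_of_far h]

theorem continuous_flipSpace (c s : ℝ) : Continuous (flipSpace c s) := by
  rw [continuous_iff_continuousAt]
  intro x
  have hr := continuous_rad
  rcases lt_or_ge (rad x) (1 / 2) with h | h
  · have hev : flipSpace c s =ᶠ[𝓝 x] id := by
      filter_upwards [(isOpen_lt hr continuous_const).mem_nhds h] with z hz
      have h0 : 0 ≤ ((rad z, z 2) : Plane).1 := rad_nonneg z
      have hz' : rad z < 1 / 2 := hz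
      conv_rhs => rw [exists_cylPoint 0 z]
      conv_lhs => rw [exists_cylPoint 0 z]
      rw [flipSpace_cylPoint c s h0, flipPlane_of_fst_le hz'.le]
      rfl
    exact continuousAt_id.congr hev.symm
  · have h0 : rad x ≠ 0 := by
      intro h0
      rw [h0] at h
      norm_num at h
    have hp : Continuous fun x : E3 => flipPlane c s (rad x, x 2) :=
      (continuous_flipPlane c s).comp (f := fun x : E3 => (rad x, x 2)) (by fun_prop)
    have hq : ContinuousAt (fun x : E3 => (flipPlane c s (rad x, x 2)).1 / rad x) x :=
      ContinuousAt.div hp.fst.continuousAt hr.continuousAt h0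
    refine ((PiLp.continuous_toLp 2 _).continuousAt).comp (continuousAt_pi.2 fun i => ?_)
    fin_cases i
    · exact (by fun_prop : Continuous fun x : E3 => x 0).continuousAt.mul hq
    · exact (by fun_prop : Continuous fun x : E3 => x 1).continuousAt.mul hq
    · exact hp.snd.continuousAt

theorem linkEquiv_flipSpace {c : ℝ} (hc : 1 ≤ c) (s : ℝ) (L : Set E3) :
    LinkEquiv L (flipSpace c s '' L) := by
  let φ : E3 ≃ₜ E3 :=
    { toFun := flipSpace c s
      invFun := flipSpace c (-s)
      left_inv := flipSpace_neg c s
      right_inv := fun x => by simpa using flipSpace_neg c (-s) x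
      continuous_toFun := continuous_flipSpace c s
      continuous_invFun := continuous_flipSpace c (-s) }
  -- Points at a distance greater than `2 c` from the origin are far from the centre `(c, 0)` of
  -- their half-plane.
  refine ⟨φ, Metric.closedBall 0 (2 * c), isCompact_closedBall _ _, fun x hx => ?_, rfl⟩
  refine flipSpace_of_far ?_
  simp only [Metric.mem_closedBall, dist_zero_right, not_le] at hx
  have h1 : ‖x‖ ^ 2 = rad x ^ 2 + x 2 ^ 2 := by
    conv_lhs => rw [exists_cylPoint 0 x]
    rw [norm_sq_cylPoint]
  have h2 : 0 ≤ rad x := rad_nonneg x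
  have h3 : rad x ≤ ‖x‖ := by nlinarith [sq_nonneg (x 2), norm_nonneg x]
  refine Real.le_sqrt_of_sq_le ?_
  simp only
  nlinarith

/-- The half-turn of the half-plane about `((n + 2) / 2, 0)` carries the half-turn of `σ_i` to
that of `σ_{n + 1 - i}`. -/
theorem flipPlane_strandPoint {n i k : ℕ} (hi : i ∈ Icc 1 n) (hk : k ∈ Icc 1 (n + 1)) (t : ℝ) :
    flipPlane ((n + 2) / 2) 1 (strandPoint i k t) =
      strandPoint (n + 1 - i) (n + 2 - k) t := by
  have hi1 : (1 : ℝ) ≤ i := by exact_mod_cast hi.1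
  have hi2 : (i : ℝ) ≤ n := by exact_mod_cast hi.2
  have hk1 : (1 : ℝ) ≤ k := by exact_mod_cast hk.1
  have hk2 : (k : ℝ) ≤ n + 1 := by exact_mod_cast hk.2
  have hc1 := Real.cos_le_one (Real.pi * t)
  have hc2 := Real.neg_one_le_cos (Real.pi * t)
  have hsc := Real.sin_sq_add_cos_sq (Real.pi * t)
  have hsub1 : ((n + 1 - i : ℕ) : ℝ) = n + 1 - i := by
    have := hi.2
    push_cast [Nat.cast_sub (show i ≤ n + 1 by omega)]
    rfl
  have hsub2 : ((n + 2 - k : ℕ) : ℝ) = n + 2 - k := by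
    have := hk.2
    push_cast [Nat.cast_sub (show k ≤ n + 2 by omega)]
    rfl
  have hnear : centreDist (((n : ℝ) + 2) / 2) (strandPoint i k t) ≤ ((n : ℝ) + 2) / 2 - 1 := by
    refine Real.sqrt_le_iff.2 ⟨by linarith, ?_⟩
    by_cases h : k = i
    · subst h
      rw [strandPoint_self]
      simp only
      nlinarith
    by_cases h' : k = i + 1
    · subst h'
      rw [strandPoint_succ]
      simp only
      nlinarith
    · rw [strandPoint_of_ne h h']
      simp only
      nlinarith
  rw [flipPlane_of_near hnear]
  have hin := hi.2
  have hkn := hk.2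
  by_cases h : k = i
  · subst h
    rw [show n + 2 - k = (n + 1 - k) + 1 by omega, strandPoint_self, strandPoint_succ, hsub1]
    ext <;> simp only
    ring
  by_cases h' : k = i + 1
  · subst h'
    rw [show n + 2 - (i + 1) = n + 1 - i by omega, strandPoint_self, strandPoint_succ, hsub1]
    ext <;> simp only <;> ring
  · rw [strandPoint_of_ne h h', strandPoint_of_ne (by omega) (by omega), hsub2]
    ext <;> simp only <;> ring

theorem flipSpace_image_braidArc {n : ℕ} {K K' : Set ℕ} (hK : K ⊆ Icc 1 (n + 1))
    (hKK' : (fun k => n + 2 - k) '' K = K') {v : List ℕ} (hv : ∀ i ∈ v, i ∈ Icc 1 n) (ω θ₀ : ℝ) :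
    flipSpace ((n + 2) / 2) 1 '' braidArc K ω v θ₀ =
      braidArc K' ω (v.map fun i => n + 1 - i) θ₀ := by
  induction v generalizing θ₀ with
  | nil => simp [braidArc]
  | cons i v ih =>
    rw [braidArc, image_union, ih fun j hj => hv j (by simp [hj]), List.map_cons, braidArc]
    congr 1
    have hi := hv i (by simp)
    have key : ∀ k ∈ K, ∀ t, flipSpace ((n + 2) / 2) 1 (cylPoint (strandPoint i k t) (θ₀ + ω * t)) =
        cylPoint (strandPoint (n + 1 - i) (n + 2 - k) t) (θ₀ + ω * t) := fun k hk t => by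
      rw [flipSpace_cylPoint _ _ (strandPoint_pos hi.1 (hK hk).1 t).le,
        flipPlane_strandPoint hi (hK hk)]
    rw [← hKK']
    ext x
    constructor
    · rintro ⟨_, ⟨k, hk, t, ht, rfl⟩, rfl⟩
      exact ⟨_, ⟨k, hk, rfl⟩, t, ht, key k hk t⟩
    · rintro ⟨_, ⟨k, hk, rfl⟩, t, ht, rfl⟩
      exact ⟨_, ⟨k, hk, t, ht, rfl⟩, key k hk t⟩

theorem flipSpace_image_restArc {n : ℕ} {K K' : Set ℕ} (hK : K ⊆ Icc 1 (n + 1))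
    (hKK' : (fun k => n + 2 - k) '' K = K') (hn : 1 ≤ n) (a b : ℝ) :
    flipSpace ((n + 2) / 2) 1 '' restArc K a b = restArc K' a b := by
  have key : ∀ k ∈ K, ∀ θ, flipSpace ((n + 2) / 2) 1 (cylPoint ((k : ℝ), 0) θ) =
      cylPoint (((n + 2 - k : ℕ) : ℝ), 0) θ := fun k hk θ => by
    have h := flipPlane_strandPoint (n := n) (i := 1) ⟨le_rfl, hn⟩ (hK hk) 0
    rw [strandPoint_zero, strandPoint_zero] at h
    rw [flipSpace_cylPoint _ _ (Nat.cast_nonneg k), h]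
  rw [← hKK']
  ext x
  constructor
  · rintro ⟨_, ⟨k, hk, θ, hθ, rfl⟩, rfl⟩
    exact ⟨_, ⟨k, hk, rfl⟩, θ, hθ, key k hk θ⟩
  · rintro ⟨_, ⟨k, hk, rfl⟩, θ, hθ, rfl⟩
    exact ⟨_, ⟨k, hk, θ, hθ, rfl⟩, key k hk θ⟩

/-! ### Destabilization -/

/-- The arc traced by the strand `f`, in time units of `ω` radians starting at the angle `θ₀`. -/
def arc (ω θ₀ : ℝ) (f : ℝ → Plane) (a b : ℝ) : Set E3 :=
  {x | ∃ t ∈ Icc a b, x = cylPoint (f t) (θ₀ + ω * t)}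

theorem arc_union {ω θ₀ : ℝ} {f : ℝ → Plane} {a b c : ℝ} (hab : a ≤ b) (hbc : b ≤ c) :
    arc ω θ₀ f a b ∪ arc ω θ₀ f b c = arc ω θ₀ f a c := by
  ext x
  constructor
  · rintro (⟨t, ht, rfl⟩ | ⟨t, ht, rfl⟩)
    · exact ⟨t, ⟨ht.1, ht.2.trans hbc⟩, rfl⟩
    · exact ⟨t, ⟨hab.trans ht.1, ht.2⟩, rfl⟩
  · rintro ⟨t, ht, rfl⟩
    rcases le_total t b with h | h
    · exact Or.inl ⟨t, ⟨ht.1, h⟩, rfl⟩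
    · exact Or.inr ⟨t, ⟨h, ht.2⟩, rfl⟩

theorem arc_congr {ω θ₀ : ℝ} {f g : ℝ → Plane} {a b : ℝ} (h : ∀ t ∈ Icc a b, f t = g t) :
    arc ω θ₀ f a b = arc ω θ₀ g a b := by
  ext x
  refine exists_congr fun t => and_congr_right fun ht => ?_
  rw [h t ht]

/-- A single strand may be moved along straight lines inside a region `V` that the rest of the
link does not meet. -/
theorem linkEquiv_arc {ω θ₀ : ℝ} (hω : 0 < ω) {f f' : ℝ → Plane} (hf : Continuous f)
    (hf' : Continuous f') {α a b : ℝ} (hα : α < θ₀ + ω * a) (hα' : θ₀ + ω * b < α + 2 * Real.pi)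
    (hends : ∀ t, t ∉ Ioo a b → f t = f' t) {V : Set (Plane × ℝ)} (hV : IsOpen V)
    (hVpos : ∀ q ∈ V, 0 < q.1.1)
    (hfV : ∀ t ∈ Icc a b, ∀ s ∈ Icc (0 : ℝ) 1, (f t + s • (f' t - f t), t) ∈ V)
    {L₀ : Set E3} (hL₀ : ∀ p t, (p, t) ∈ V → t ∈ Ioo a b → cylPoint p (θ₀ + ω * t) ∉ L₀) :
    LinkEquiv (L₀ ∪ arc ω θ₀ f a b) (L₀ ∪ arc ω θ₀ f' a b) := by
  have himg : ∀ g : ℝ → Plane, arc ω θ₀ g a b = strandImage (cylChart α)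
      (fun (_ : Unit) θ => g ((θ - θ₀) / ω)) (θ₀ + ω * a) (θ₀ + ω * b) := by
    intro g
    ext x
    constructor
    · rintro ⟨t, ht, rfl⟩
      refine ⟨(), θ₀ + ω * t, ⟨?_, ?_⟩, ?_⟩
      · gcongr; exact ht.1
      · gcongr; exact ht.2
      · simp only [cylChart_apply]
        congr 2
        field_simp
        ring
    · rintro ⟨-, θ, hθ, rfl⟩
      refine ⟨(θ - θ₀) / ω, ⟨?_, ?_⟩, ?_⟩
      · rw [le_div_iff₀ hω]; linarith [hθ.1]
      · rw [div_le_iff₀ hω]; linarith [hθ.2]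
      · simp only [cylChart_apply]
        congr 1
        field_simp
        ring
  have hmem : ∀ θ, θ ∈ Icc (θ₀ + ω * a) (θ₀ + ω * b) → (θ - θ₀) / ω ∈ Icc a b := fun θ hθ =>
    ⟨by rw [le_div_iff₀ hω]; linarith [hθ.1], by rw [div_le_iff₀ hω]; linarith [hθ.2]⟩
  have hmem' : ∀ θ, θ ∈ Ioo (θ₀ + ω * a) (θ₀ + ω * b) ↔ (θ - θ₀) / ω ∈ Ioo a b := fun θ => by
    rw [mem_Ioo, mem_Ioo, lt_div_iff₀ hω, div_lt_iff₀ hω]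
    constructor <;> rintro ⟨h1, h2⟩ <;> constructor <;> linarith
  rw [himg, himg]
  let g : Plane × ℝ → Plane × ℝ := fun q => (q.1, (q.2 - θ₀) / ω)
  have hg : Continuous g := by fun_prop
  refine linkEquiv_of_strandHomotopy (cylChart α) (fun _ => hf.comp (by fun_prop))
    (fun _ => hf'.comp (by fun_prop)) (fun _ θ hθ => hends _ fun h => hθ ((hmem' θ).2 h))
    (fun i j hij => (hij (Subsingleton.elim i j)).elim)
    (W := (cylChart α).source ∩ g ⁻¹' V) ((cylChart α).open_source.inter (hV.preimage hg))
    inter_subset_left ?_ ?_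
  · intro _ θ hθ s hs
    have h1 := hfV _ (hmem θ hθ) s hs
    have h2 := hVpos _ h1
    exact ⟨⟨h2, by linarith [hθ.1], by simp only; linarith [hθ.2]⟩, h1⟩
  · rintro ⟨p, θ⟩ ⟨-, hq⟩ hθ
    have := hL₀ _ _ hq ((hmem' θ).1 hθ)
    rwa [mul_div_cancel₀ _ hω.ne', add_sub_cancel] at this

/-- The lemma `cylPoint_ne_of_notMem` in time units of `ω` radians; one turn takes the time `M`. -/
theorem cylPoint_ne_of_notMem_time {ω θ₀ M : ℝ} (hω : 0 < ω) (hM : ω * M = 2 * Real.pi) {a b : ℝ}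
    (ha : 0 ≤ a) (hb : b ≤ M) {p p' : Plane} (hp : 0 < p.1) (hp' : 0 < p'.1) {t t' : ℝ}
    (ht : t ∈ Ioo a b) (ht' : t' ∈ Icc 0 M) (hnot : t' ∉ Ioo a b) :
    cylPoint p (θ₀ + ω * t) ≠ cylPoint p' (θ₀ + ω * t') := by
  intro h
  have h1 := congrArg (rotAxis (-θ₀)) h
  rw [rotAxis_cylPoint, rotAxis_cylPoint, add_neg_cancel_comm, add_neg_cancel_comm] at h1
  refine cylPoint_ne_of_notMem (lo := ω * a) (hi := ω * b) (by positivity) (by rw [← hM]; gcongr)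
    hp hp' ⟨?_, ?_⟩ ⟨?_, ?_⟩ (fun h2 => hnot ⟨?_, ?_⟩) h1
  · exact mul_lt_mul_of_pos_left ht.1 hω
  · exact mul_lt_mul_of_pos_left ht.2 hω
  · exact mul_nonneg hω.le ht'.1
  · rw [← hM]; exact mul_le_mul_of_nonneg_left ht'.2 hω.le
  · exact lt_of_mul_lt_mul_left h2.1 hω.le
  · exact lt_of_mul_lt_mul_left h2.2 hω.le

/-- The lower strand of the crossing `σ₁`, resting before `t = 0` and after `t = 1`. -/
def underStrand (t : ℝ) : Plane := strandPoint 1 2 (max 0 (min 1 t))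

/-- The upper strand of the crossing `σ₁`, resting before `t = 0` and after `t = 1`. -/
def overStrand (t : ℝ) : Plane := strandPoint 1 1 (max 0 (min 1 t))

theorem continuous_underStrand : Continuous underStrand :=
  (continuous_strandPoint 1 2).comp (by fun_prop)

theorem continuous_overStrand : Continuous overStrand :=
  (continuous_strandPoint 1 1).comp (by fun_prop)

theorem clamp_of_mem {t : ℝ} (ht : t ∈ Icc (0 : ℝ) 1) : max 0 (min 1 t) = t := by
  rw [min_eq_right ht.2, max_eq_right ht.1]

theorem strandPoint_one_two (t : ℝ) : strandPoint 1 2 t =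
    (3 / 2 + Real.cos (Real.pi * t) / 2, -(Real.sin (Real.pi * t) / 2)) := by
  rw [show strandPoint 1 2 t = _ from strandPoint_succ 1 t]
  ext <;> norm_num

theorem strandPoint_one_one (t : ℝ) : strandPoint 1 1 t =
    (3 / 2 - Real.cos (Real.pi * t) / 2, Real.sin (Real.pi * t) / 2) := by
  rw [strandPoint_self]
  ext <;> norm_num

theorem underStrand_of_mem {t : ℝ} (ht : t ∈ Icc (0 : ℝ) 1) : underStrand t =
    (3 / 2 + Real.cos (Real.pi * t) / 2, -(Real.sin (Real.pi * t) / 2)) := by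
  rw [underStrand, clamp_of_mem ht, strandPoint_one_two]

theorem underStrand_of_nonpos {t : ℝ} (ht : t ≤ 0) : underStrand t = (2, 0) := by
  rw [underStrand, min_eq_right (by linarith), max_eq_left ht, strandPoint_zero]
  norm_num

theorem underStrand_of_ge {t : ℝ} (ht : 1 ≤ t) : underStrand t = (1, 0) := by
  rw [underStrand, min_eq_left ht, max_eq_right zero_le_one, strandPoint_one]
  norm_num [swapPos]

/-- The half-turn about a radial axis exchanges the two strands of the crossing. -/
theorem overStrand_eq (t : ℝ) :
    overStrand t = ((underStrand (1 - t)).1, -(underStrand (1 - t)).2) := by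
  have h : max 0 (min 1 (1 - t)) = 1 - max 0 (min 1 t) := by
    rcases le_total t 0 with h | h
    · rw [min_eq_left (by linarith), min_eq_right (by linarith), max_eq_right zero_le_one,
        max_eq_left h]; ring
    rcases le_total 1 t with h' | h'
    · rw [min_eq_right (by linarith), min_eq_left h', max_eq_left (by linarith),
        max_eq_right zero_le_one]; ring
    · rw [clamp_of_mem ⟨h, h'⟩, clamp_of_mem ⟨by linarith, by linarith⟩]
  rw [overStrand, underStrand, h, strandPoint_one_two, strandPoint_one_one,
    mul_sub, mul_one, Real.cos_pi_sub, Real.sin_pi_sub]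
  ext
  · simp only; ring
  · simp only; ring

theorem underStrand_bounds (t : ℝ) : 1 ≤ (underStrand t).1 ∧ (underStrand t).1 ≤ 2 := by
  have := strandPoint_bounds 1 (k := 2) (Or.inr rfl) (max 0 (min 1 t))
  norm_num at this
  exact this

theorem underStrand_snd_neg {t : ℝ} (ht : t ∈ Ioo (0 : ℝ) 1) : (underStrand t).2 < 0 := by
  rw [underStrand_of_mem (Ioo_subset_Icc_self ht)]
  have : 0 < Real.sin (Real.pi * t) := Real.sin_pos_of_pos_of_lt_pi (mul_pos Real.pi_pos ht.1)
    (mul_lt_of_lt_one_right Real.pi_pos ht.2)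
  simp only
  linarith

theorem underStrand_fst_antitone : Antitone fun t => (underStrand t).1 := by
  intro t t' h
  have h0 : max 0 (min 1 t) ≤ max 0 (min 1 t') := max_le_max le_rfl (min_le_min le_rfl h)
  have h1 : 0 ≤ max 0 (min 1 t) := le_max_left _ _
  have h2 : max 0 (min 1 t') ≤ 1 := max_le zero_le_one (min_le_left _ _)
  simp only [underStrand, strandPoint_one_two]
  have := Real.cos_le_cos_of_nonneg_of_le_pi (mul_nonneg Real.pi_pos.le h1)
    (mul_le_of_le_one_right Real.pi_pos.le h2) (mul_le_mul_of_nonneg_left h0 Real.pi_pos.le)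
  linarith

theorem underStrand_half : (underStrand (1 / 2)).1 = 3 / 2 := by
  rw [underStrand_of_mem (by norm_num), show Real.pi * (1 / 2) = Real.pi / 2 by ring]
  simp

theorem half_le_sqrt_two_div_two : (1 : ℝ) / 2 ≤ Real.sqrt 2 / 2 := by
  have : (1 : ℝ) ≤ Real.sqrt 2 := Real.one_le_sqrt.2 (by norm_num)
  linarith

theorem underStrand_quarter :
    7 / 4 ≤ (underStrand (1 / 4)).1 ∧ (underStrand (1 / 4)).2 ≤ -(1 / 4) := by
  have := half_le_sqrt_two_div_two
  rw [underStrand_of_mem (by norm_num), show Real.pi * (1 / 4) = Real.pi / 4 by ring,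
    Real.cos_pi_div_four, Real.sin_pi_div_four]
  constructor <;> simp only <;> linarith

theorem underStrand_three_eighths : (underStrand (3 / 8)).1 < 7 / 4 := by
  rw [underStrand_of_mem (by norm_num)]
  have h := Real.cos_lt_cos_of_nonneg_of_le_pi (x := Real.pi / 3) (y := Real.pi * (3 / 8))
    (by linarith [Real.pi_pos]) (by linarith [Real.pi_pos]) (by linarith [Real.pi_pos])
  rw [Real.cos_pi_div_three] at h
  simp only
  linarith

/-- The height of the lower strand in its new position: it agrees with that of the lower strand of
`σ₁` up to `t = 1/4`, is at most `-1/4` on `[1/4, 3/8]`, and increases at a constant rate from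
`-1/4` to `0` on `[3/8, M]`. -/
def lowHeight (M t : ℝ) : ℝ :=
  max 0 (min 1 (3 - 8 * t)) * ((underStrand (min t (1 / 4))).2 + 1 / 4) -
    1 / 4 * max 0 (min 1 ((M - t) / (M - 3 / 8)))

theorem continuous_lowHeight (M : ℝ) : Continuous (lowHeight M) := by
  have := continuous_underStrand
  unfold lowHeight
  fun_prop

theorem lowHeight_of_le_quarter {M t : ℝ} (hM : 1 ≤ M) (ht : t ≤ 1 / 4) :
    lowHeight M t = (underStrand t).2 := by
  have h : 1 ≤ (M - t) / (M - 3 / 8) := by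
    rw [one_le_div (by linarith)]
    linarith
  rw [lowHeight, min_eq_left ht, min_eq_left h, min_eq_left (by linarith),
    max_eq_right zero_le_one]
  ring

theorem lowHeight_of_mem_Icc {M t : ℝ} (hM : 1 ≤ M) (ht : t ∈ Icc (1 / 4 : ℝ) (3 / 8)) :
    lowHeight M t ≤ -(1 / 4) := by
  have h : 1 ≤ (M - t) / (M - 3 / 8) := by
    rw [one_le_div (by linarith)]
    linarith [ht.2]
  rw [lowHeight, min_eq_right ht.1, min_eq_left h, max_eq_right zero_le_one]
  have h1 := underStrand_quarter.2
  have h2 : 0 ≤ max 0 (min 1 (3 - 8 * t)) := le_max_left _ _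
  nlinarith

theorem lowHeight_of_le {M t : ℝ} (hM : 1 ≤ M) (ht : t ∈ Icc (3 / 8) M) :
    lowHeight M t = -(1 / 4 * ((M - t) / (M - 3 / 8))) := by
  have h : (M - t) / (M - 3 / 8) ≤ 1 := by
    rw [div_le_one (by linarith)]
    linarith [ht.1]
  have h' : 0 ≤ (M - t) / (M - 3 / 8) := div_nonneg (by linarith [ht.2]) (by linarith)
  rw [lowHeight, clamp_of_mem ⟨h', h⟩,
    max_eq_left ((min_le_right _ _).trans (by linarith [ht.1]))]
  ring

theorem lowHeight_of_ge {M t : ℝ} (hM : 1 ≤ M) (ht : M ≤ t) : lowHeight M t = 0 := by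
  have h : (M - t) / (M - 3 / 8) ≤ 0 :=
    div_nonpos_of_nonpos_of_nonneg (by linarith) (by linarith)
  rw [lowHeight, max_eq_left ((min_le_right _ _).trans h),
    max_eq_left ((min_le_right _ _).trans (by linarith))]
  ring

theorem lowHeight_neg {M t : ℝ} (hM : 1 ≤ M) (ht : t ∈ Ioo 0 M) : lowHeight M t < 0 := by
  rcases le_total t (1 / 4) with h | h
  · rw [lowHeight_of_le_quarter hM h]
    exact underStrand_snd_neg ⟨ht.1, by linarith⟩
  rcases le_total t (3 / 8) with h' | h'
  · linarith [lowHeight_of_mem_Icc hM ⟨h, h'⟩]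
  · rw [lowHeight_of_le hM ⟨h', ht.2.le⟩]
    have : 0 < (M - t) / (M - 3 / 8) := div_pos (by linarith [ht.2]) (by linarith)
    linarith

theorem lowHeight_nonpos {M t : ℝ} (hM : 1 ≤ M) (ht : 0 ≤ t) : lowHeight M t ≤ 0 := by
  rcases ht.eq_or_lt with rfl | h
  · rw [lowHeight_of_le_quarter hM (by norm_num), underStrand_of_nonpos le_rfl]
  rcases lt_or_ge t M with h' | h'
  · exact (lowHeight_neg hM ⟨h, h'⟩).le
  · rw [lowHeight_of_ge hM h']

/-- The lower strand, continued around the axis for `1 ≤ t ≤ M`, in its new position. -/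
def lowStrand (M t : ℝ) : Plane := ((underStrand t).1, lowHeight M t)

/-- The upper strand in its new position: the mirror image of a lower one. -/
def highStrand (t : ℝ) : Plane := ((overStrand t).1, -lowHeight 1 (1 - t))

theorem continuous_lowStrand (M : ℝ) : Continuous (lowStrand M) :=
  continuous_underStrand.fst.prodMk (continuous_lowHeight M)

theorem continuous_highStrand : Continuous highStrand := by
  have := continuous_overStrand
  have := continuous_lowHeight 1
  unfold highStrand
  fun_prop

theorem highStrand_eq (t : ℝ) :
    highStrand t = ((lowStrand 1 (1 - t)).1, -(lowStrand 1 (1 - t)).2) := by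
  rw [highStrand, overStrand_eq]
  rfl

theorem lowStrand_of_le_quarter {M t : ℝ} (hM : 1 ≤ M) (ht : t ≤ 1 / 4) :
    lowStrand M t = underStrand t := Prod.ext rfl (lowHeight_of_le_quarter hM ht)

theorem highStrand_of_ge {t : ℝ} (ht : 3 / 4 ≤ t) : highStrand t = overStrand t := by
  rw [highStrand_eq, lowStrand_of_le_quarter le_rfl (by linarith), overStrand_eq]

theorem underStrand_quarter_lt : (underStrand (1 / 4)).1 < 2 := by
  rw [underStrand_of_mem (by norm_num), show Real.pi * (1 / 4) = Real.pi / 4 by ring,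
    Real.cos_pi_div_four]
  have : Real.sqrt 2 < 2 := by rw [Real.sqrt_lt' (by norm_num)]; norm_num
  simp only
  linarith

theorem smul_interp_fst (p p' : Plane) (s : ℝ) :
    (p + s • (p' - p)).1 = (1 - s) * p.1 + s * p'.1 := by
  simp; ring

theorem smul_interp_snd (p p' : Plane) (s : ℝ) :
    (p + s • (p' - p)).2 = (1 - s) * p.2 + s * p'.2 := by
  simp; ring

theorem convex_comb_lt {s x y z : ℝ} (hs : s ∈ Icc (0 : ℝ) 1) (hx : x < z) (hy : y < z) :
    (1 - s) * x + s * y < z := by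
  have := convex_comb_pos hs (sub_pos.2 hx) (sub_pos.2 hy)
  linarith

section
variable {ω θ₀ M : ℝ} {L₂ : Set E3}

/-- The lower strand of the crossing, continued around the axis, is lowered to a strand that climbs
strictly. -/
theorem linkEquiv_lower (hω : 0 < ω) (hM1 : 1 < M) (hM : ω * M = 2 * Real.pi)
    (hL₂ : ∀ p θ, 0 < p.1 → p.1 < 2 → cylPoint p θ ∉ L₂) :
    LinkEquiv (L₂ ∪ arc ω θ₀ underStrand 0 (1 / 4) ∪ arc ω θ₀ overStrand 0 1 ∪
        arc ω θ₀ underStrand (1 / 4) M)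
      (L₂ ∪ arc ω θ₀ underStrand 0 (1 / 4) ∪ arc ω θ₀ overStrand 0 1 ∪
        arc ω θ₀ (lowStrand M) (1 / 4) M) := by
  -- The region `V` keeps below the upper strand during the crossing (`y < 0`); after the time
  -- `1/2`, the upper strand has left the radii `ρ < 3/2`, and there `y` is arbitrary.
  refine linkEquiv_arc hω continuous_underStrand (continuous_lowStrand M) (α := θ₀ + ω / 8)
    (by linarith) (by linarith) ?_
    (V := {q | (0 < q.1.1 ∧ q.1.1 < 2) ∧ (q.1.2 < 0 ∨ (q.1.1 < 3 / 2 ∧ 1 / 2 < q.2))}) ?_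
    (fun q hq => hq.1.1) ?_ ?_
  · intro t ht
    rcases le_or_gt t (1 / 4) with h | h
    · rw [lowStrand_of_le_quarter hM1.le h]
    · have h' : M ≤ t := not_lt.1 fun h' => ht ⟨h, h'⟩
      rw [underStrand_of_ge (by linarith), lowStrand, underStrand_of_ge (by linarith),
        lowHeight_of_ge hM1.le h']
  · refine IsOpen.inter (IsOpen.inter ?_ ?_) (IsOpen.union ?_ (IsOpen.inter ?_ ?_))
    · exact isOpen_lt continuous_const continuous_fst.fst
    · exact isOpen_lt continuous_fst.fst continuous_const
    · exact isOpen_lt continuous_fst.snd continuous_const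
    · exact isOpen_lt continuous_fst.fst continuous_const
    · exact isOpen_lt continuous_const continuous_snd
  · intro t ht s hs
    have h1 : (underStrand t).1 < 2 :=
      (underStrand_fst_antitone ht.1).trans_lt underStrand_quarter_lt
    have h2 := (underStrand_bounds t).1
    have hf : (underStrand t + s • (lowStrand M t - underStrand t)).1 = (underStrand t).1 := by
      rw [smul_interp_fst, lowStrand]; ring
    refine ⟨⟨by simp only [hf]; linarith, by simpa only [hf]⟩, ?_⟩
    simp only [hf, smul_interp_snd]
    rcases lt_or_ge t 1 with h | h
    · left
      exact convex_comb_lt hs (underStrand_snd_neg ⟨by linarith [ht.1], h⟩)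
        (lowHeight_neg hM1.le ⟨by linarith [ht.1], by linarith⟩)
    · right
      rw [underStrand_of_ge h]
      exact ⟨by norm_num, by linarith⟩
  · rintro p t ⟨⟨hp, hp2⟩, hq⟩ ht
    simp only at hp hp2 hq
    rintro ((h | ⟨t', ht', h⟩) | ⟨t', ht', h⟩)
    · exact hL₂ p _ hp hp2 h
    · exact cylPoint_ne_of_notMem_time hω hM (by norm_num) le_rfl hp
        (by linarith [(underStrand_bounds t').1]) ht ⟨ht'.1, by linarith [ht'.2]⟩
        (fun h => by linarith [h.1, ht'.2]) h
    · have hpo : 0 < (overStrand t').1 := by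
        rw [overStrand_eq]
        exact zero_lt_one.trans_le (underStrand_bounds _).1
      have hpe := cylPoint_inj_left hp hpo h
      have h0 : 0 ≤ (overStrand t').2 := by
        rw [overStrand_eq]
        rcases ht'.1.eq_or_lt with h1 | h1
        · rw [← h1, underStrand_of_ge (by norm_num)]; simp
        rcases ht'.2.eq_or_lt with h2 | h2
        · rw [h2, underStrand_of_nonpos (by norm_num)]; simp
        · have := underStrand_snd_neg (t := 1 - t') ⟨by linarith, by linarith⟩
          simp only
          linarith
      rw [hpe] at hq
      rcases hq with hq | ⟨hq, hq'⟩
      · linarith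
      · have h1 : t' < 1 / 2 := by
          by_contra h1
          have := underStrand_fst_antitone (show 1 - t' ≤ 1 / 2 by linarith)
          simp only [underStrand_half] at this
          rw [overStrand_eq] at hq
          simp only at hq
          linarith
        exact cylPoint_ne_of_notMem_time hω hM (a := 1 / 2) (by norm_num) le_rfl hp hpo
          ⟨hq', ht.2⟩ ⟨ht'.1, by linarith [ht'.2]⟩ (fun h => by linarith [h.1]) h

/-- The upper strand of the crossing is raised so that it climbs strictly, too. -/
theorem linkEquiv_raise (hω : 0 < ω) (hM1 : 1 < M) (hM : ω * M = 2 * Real.pi)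
    (hL₂ : ∀ p θ, 0 < p.1 → p.1 < 2 → cylPoint p θ ∉ L₂) :
    LinkEquiv (L₂ ∪ arc ω θ₀ (lowStrand M) 0 M ∪ arc ω θ₀ overStrand (3 / 4) 1 ∪
        arc ω θ₀ overStrand 0 (3 / 4))
      (L₂ ∪ arc ω θ₀ (lowStrand M) 0 M ∪ arc ω θ₀ overStrand (3 / 4) 1 ∪
        arc ω θ₀ highStrand 0 (3 / 4)) := by
  have hfst : ∀ t, 1 ≤ (overStrand t).1 := fun t => by
    rw [overStrand_eq]
    exact (underStrand_bounds _).1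
  -- The region `V` keeps above the lower strand (`y > 0`); before the time `1/8`, the lower strand
  -- has not reached the radii `ρ < 3/2` yet, and there `y` is arbitrary.
  refine linkEquiv_arc hω continuous_overStrand continuous_highStrand (α := θ₀ - ω / 8)
    (by linarith) (by nlinarith) ?_
    (V := {q | (0 < q.1.1 ∧ q.1.1 < 2) ∧ (0 < q.1.2 ∨ (q.1.1 < 3 / 2 ∧ q.2 < 1 / 8))}) ?_
    (fun q hq => hq.1.1) ?_ ?_
  · intro t ht
    rcases le_or_gt (3 / 4) t with h | h
    · rw [highStrand_of_ge h]
    · have h' : t ≤ 0 := not_lt.1 fun h' => ht ⟨h', h⟩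
      rw [highStrand_eq, overStrand_eq, lowStrand, underStrand_of_ge (by linarith),
        lowHeight_of_ge le_rfl (by linarith)]
  · refine IsOpen.inter (IsOpen.inter ?_ ?_) (IsOpen.union ?_ (IsOpen.inter ?_ ?_))
    · exact isOpen_lt continuous_const continuous_fst.fst
    · exact isOpen_lt continuous_fst.fst continuous_const
    · exact isOpen_lt continuous_const continuous_fst.snd
    · exact isOpen_lt continuous_fst.fst continuous_const
    · exact isOpen_lt continuous_snd continuous_const
  · intro t ht s hs
    have h1 : (overStrand t).1 < 2 := by
      rw [overStrand_eq]
      exact (underStrand_fst_antitone (show 1 / 4 ≤ 1 - t by linarith [ht.2])).trans_lt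
        underStrand_quarter_lt
    have hf : (overStrand t + s • (highStrand t - overStrand t)).1 = (overStrand t).1 := by
      rw [smul_interp_fst, highStrand]; ring
    refine ⟨⟨by simp only [hf]; linarith [hfst t], by simpa only [hf]⟩, ?_⟩
    simp only [hf, smul_interp_snd]
    rcases ht.1.eq_or_lt with h | h
    · right
      rw [← h, overStrand_eq, underStrand_of_ge (by norm_num)]
      constructor <;> norm_num
    · left
      have h2 := underStrand_snd_neg (t := 1 - t) ⟨by linarith [ht.2], by linarith⟩
      have h3 := lowHeight_neg (M := 1) (t := 1 - t) le_rfl ⟨by linarith [ht.2], by linarith⟩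
      refine convex_comb_pos hs ?_ ?_
      · rw [overStrand_eq]; simp only; linarith
      · simp only [highStrand]; linarith
  · rintro p t ⟨⟨hp, hp2⟩, hq⟩ ht
    simp only at hp hp2 hq
    rintro ((h | ⟨t', ht', h⟩) | ⟨t', ht', h⟩)
    · exact hL₂ p _ hp hp2 h
    · have hpo : 0 < (lowStrand M t').1 := zero_lt_one.trans_le (underStrand_bounds _).1
      have hpe := cylPoint_inj_left hp hpo h
      rw [hpe] at hq
      rcases hq with hq | ⟨hq, hq'⟩
      · have := lowHeight_nonpos hM1.le ht'.1
        simp only [lowStrand] at hq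
        linarith
      · have h1 : 1 / 8 ≤ t' := by
          by_contra h1
          have := underStrand_fst_antitone (show t' ≤ 1 / 2 by linarith)
          simp only [underStrand_half] at this
          simp only [lowStrand] at hq
          linarith
        exact cylPoint_ne_of_notMem_time hω hM (b := 1 / 8) le_rfl (by linarith) hp hpo
          ⟨ht.1, hq'⟩ ht' (fun h => by linarith [h.2]) h
    · exact cylPoint_ne_of_notMem_time hω hM le_rfl (by linarith) hp
        (by linarith [hfst t']) ht ⟨by linarith [ht'.1], by linarith [ht'.2]⟩
        (fun h => by linarith [h.2, ht'.1]) h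

end

/-! ### Pulling a strand across the axis -/

/-- Horizontal planes as levels: `ℝ³` as the product of a horizontal plane and the third axis. -/
def levelChart : (Plane × ℝ) ≃ₜ E3 where
  toFun q := !₂[q.1.1, q.1.2, q.2]
  invFun x := ((x 0, x 1), x 2)
  left_inv _ := rfl
  right_inv x := by
    ext i
    fin_cases i <;> rfl
  continuous_toFun := by
    refine (PiLp.continuous_toLp 2 _).comp (continuous_pi fun i => ?_)
    fin_cases i <;> simp <;> fun_prop
  continuous_invFun := by fun_prop

/-- The point with polar coordinates `(r, θ)` in a horizontal plane. -/
def polarPoint (r θ : ℝ) : Plane := (r * Real.cos θ, r * Real.sin θ)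

theorem levelChart_polarPoint (r θ y : ℝ) :
    levelChart (polarPoint r θ, y) = cylPoint (r, y) θ := rfl

theorem rad_levelChart (q : Plane × ℝ) :
    rad (levelChart q) = Real.sqrt (q.1.1 ^ 2 + q.1.2 ^ 2) := rfl

theorem sq_add_sq_polarPoint (r θ : ℝ) :
    (polarPoint r θ).1 ^ 2 + (polarPoint r θ).2 ^ 2 = r ^ 2 := by
  simp only [polarPoint]
  linear_combination r ^ 2 * Real.sin_sq_add_cos_sq θ

/-- The radius of `lowStrand` at the time `3/8` and of `highStrand` at the time `5/8`. -/
def innerRadius : ℝ := (underStrand (3 / 8)).1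

/-- The short way from `lowStrand` at the time `3/8`, at the height `-1/4`, to `highStrand` at the
time `5/8`, at the height `1/4`. -/
def midStrand (t : ℝ) : Plane := (innerRadius, 2 * t - 1)

/-- The strand that climbs once around the axis from the height `-1/4` to `1/4`, as a function of
its height `y`: for `y ≤ 0` it is the point of `lowStrand M` with this height, which is reached
at the time `M + 4 y (M - 3/8)`, and for `y > 0` that of `highStrand`, reached at the time
`5 y / 2`. It is constant for `y ≤ -1/4` and for `y ≥ 1/4`. -/
def climb (ω θ₀ M y : ℝ) : Plane :=
  if y ≤ 0 then
    polarPoint (underStrand (M + 4 * max (-(1 / 4)) y * (M - 3 / 8))).1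
      (θ₀ + ω * (M + 4 * max (-(1 / 4)) y * (M - 3 / 8)))
  else
    polarPoint (overStrand (5 / 2 * min (1 / 4) y)).1 (θ₀ + ω * (5 / 2 * min (1 / 4) y))

/-- The strand `midStrand` as a function of its height `y`, constant for `y ≤ -1/4` and for
`y ≥ 1/4`. -/
def climbShort (ω θ₀ y : ℝ) : Plane :=
  polarPoint innerRadius (θ₀ + ω * (1 / 2 + max (-(1 / 4)) (min (1 / 4) y) / 2))

theorem continuous_polarPoint : Continuous fun q : ℝ × ℝ => polarPoint q.1 q.2 := by
  unfold polarPoint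
  fun_prop

theorem continuous_climb {ω θ₀ M : ℝ} (hM1 : 1 < M) (hM : ω * M = 2 * Real.pi) :
    Continuous (climb ω θ₀ M) := by
  have h1 := continuous_underStrand
  have h2 := continuous_overStrand
  refine Continuous.if_le ?_ ?_ continuous_id continuous_const ?_
  · exact continuous_polarPoint.comp (f := fun y =>
      ((underStrand (M + 4 * max (-(1 / 4)) y * (M - 3 / 8))).1,
      θ₀ + ω * (M + 4 * max (-(1 / 4)) y * (M - 3 / 8)))) (by fun_prop)
  · exact continuous_polarPoint.comp (f := fun y =>
      ((overStrand (5 / 2 * min (1 / 4) y)).1, θ₀ + ω * (5 / 2 * min (1 / 4) y))) (by fun_prop)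
  · rintro y rfl
    rw [max_eq_right (by norm_num), min_eq_right (by norm_num), overStrand_eq]
    simp only [mul_zero, zero_mul, add_zero, sub_zero]
    rw [underStrand_of_ge hM1.le, underStrand_of_ge le_rfl, hM]
    simp [polarPoint]

theorem continuous_climbShort (ω θ₀ : ℝ) : Continuous (climbShort ω θ₀) :=
  continuous_polarPoint.comp (f := fun y =>
    (innerRadius, θ₀ + ω * (1 / 2 + max (-(1 / 4)) (min (1 / 4) y) / 2))) (by fun_prop)

theorem overStrand_five_eighths : (overStrand (5 / 8)).1 = innerRadius := by
  rw [overStrand_eq, innerRadius]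
  norm_num

theorem climb_sq_lt {ω θ₀ M : ℝ} (hM1 : 1 < M) (y : ℝ) :
    (climb ω θ₀ M y).1 ^ 2 + (climb ω θ₀ M y).2 ^ 2 < (7 / 4) ^ 2 := by
  unfold climb
  split_ifs with h
  · rw [sq_add_sq_polarPoint]
    have h0 : (0 : ℝ) < M - 3 / 8 := by linarith
    have h1 := le_max_left (-(1 / 4)) y
    have h2 := (underStrand_fst_antitone
      (show 3 / 8 ≤ M + 4 * max (-(1 / 4)) y * (M - 3 / 8) by nlinarith)).trans_lt
      underStrand_three_eighths
    have h3 := (underStrand_bounds (M + 4 * max (-(1 / 4)) y * (M - 3 / 8))).1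
    simp only at h2
    nlinarith
  · rw [sq_add_sq_polarPoint]
    have h1 := min_le_left (1 / 4) y
    have h2 := (underStrand_fst_antitone
      (show 3 / 8 ≤ 1 - 5 / 2 * min (1 / 4) y by linarith)).trans_lt
      underStrand_three_eighths
    have h3 := (underStrand_bounds (1 - 5 / 2 * min (1 / 4) y)).1
    rw [overStrand_eq]
    simp only at h2 ⊢
    nlinarith

theorem climb_eq_of_notMem {ω θ₀ M y : ℝ} (hy : y ∉ Ioo (-(1 / 4) : ℝ) (1 / 4)) :
    climb ω θ₀ M y = climbShort ω θ₀ y := by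
  unfold climb climbShort
  split_ifs with h
  · have h1 : y ≤ -(1 / 4) := not_lt.1 fun h' => hy ⟨h', by linarith⟩
    rw [max_eq_left h1, min_eq_right (by linarith), max_eq_left h1,
      show M + 4 * -(1 / 4) * (M - 3 / 8) = 3 / 8 by ring, ← innerRadius]
    norm_num
  · have h1 : 1 / 4 ≤ y := not_lt.1 fun h' => hy ⟨by linarith, h'⟩
    rw [min_eq_left h1, max_eq_right (by norm_num),
      show (5 / 2 * (1 / 4) : ℝ) = 5 / 8 by norm_num, overStrand_five_eighths]
    norm_num

theorem strandImage_climb {ω θ₀ M : ℝ} (hM1 : 1 < M) (hM : ω * M = 2 * Real.pi) :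
    strandImage levelChart (fun (_ : Unit) => climb ω θ₀ M) (-(1 / 4)) (1 / 4) =
      arc ω θ₀ (lowStrand M) (3 / 8) M ∪ arc ω θ₀ highStrand 0 (5 / 8) := by
  have h0 : (0 : ℝ) < M - 3 / 8 := by linarith
  have hlow : ∀ t ∈ Icc (3 / 8) M, lowHeight M t ∈ Icc (-(1 / 4) : ℝ) 0 ∧
      M + 4 * lowHeight M t * (M - 3 / 8) = t := by
    intro t ht
    rw [lowHeight_of_le hM1.le ht]
    have h1 : (M - t) / (M - 3 / 8) ≤ 1 := by
      rw [div_le_one h0]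
      linarith [ht.1]
    have h2 : 0 ≤ (M - t) / (M - 3 / 8) := div_nonneg (by linarith [ht.2]) h0.le
    refine ⟨⟨by linarith, by linarith⟩, ?_⟩
    linear_combination -(div_mul_cancel₀ (M - t) h0.ne')
  have hhigh : ∀ t ∈ Icc (0 : ℝ) (5 / 8), (highStrand t).2 = 2 / 5 * t := by
    intro t ht
    rw [highStrand]
    simp only
    rw [lowHeight_of_le le_rfl ⟨by linarith [ht.2], by linarith [ht.1]⟩]
    ring
  ext x
  constructor
  · rintro ⟨-, y, hy, rfl⟩
    rcases le_or_gt y 0 with h | h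
    · left
      have ht : M + 4 * y * (M - 3 / 8) ∈ Icc (3 / 8) M := ⟨by nlinarith [hy.1], by nlinarith⟩
      refine ⟨_, ht, ?_⟩
      have h1 : lowHeight M (M + 4 * y * (M - 3 / 8)) = y := by
        rw [lowHeight_of_le hM1.le ht,
          show M - (M + 4 * y * (M - 3 / 8)) = -(4 * y) * (M - 3 / 8) by ring,
          mul_div_cancel_right₀ _ h0.ne']
        ring
      change levelChart (climb ω θ₀ M y, y) = _
      rw [climb, if_pos h, max_eq_right hy.1, levelChart_polarPoint, lowStrand, h1]
    · right
      have ht : 5 / 2 * y ∈ Icc (0 : ℝ) (5 / 8) := ⟨by linarith, by linarith [hy.2]⟩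
      refine ⟨_, ht, ?_⟩
      have h1 : highStrand (5 / 2 * y) = ((overStrand (5 / 2 * y)).1, y) :=
        Prod.ext rfl (by rw [hhigh _ ht]; ring)
      change levelChart (climb ω θ₀ M y, y) = _
      rw [climb, if_neg h.not_ge, min_eq_right hy.2, levelChart_polarPoint, h1]
  · have hleft : arc ω θ₀ (lowStrand M) (3 / 8) M ⊆
        strandImage levelChart (fun (_ : Unit) => climb ω θ₀ M) (-(1 / 4)) (1 / 4) := by
      rintro _ ⟨t, ht, rfl⟩
      obtain ⟨hy, h1⟩ := hlow t ht
      refine ⟨(), lowHeight M t, ⟨hy.1, by linarith [hy.2]⟩, ?_⟩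
      change _ = levelChart (climb ω θ₀ M (lowHeight M t), lowHeight M t)
      rw [climb, if_pos hy.2, max_eq_right hy.1, levelChart_polarPoint, h1, lowStrand]
    rintro (hx | ⟨t, ht, rfl⟩)
    · exact hleft hx
    · rcases ht.1.eq_or_lt with h | h
      · refine hleft ⟨M, ⟨by linarith, le_rfl⟩, ?_⟩
        rw [← h, hM, cylPoint_periodic, mul_zero, add_zero, highStrand_eq, lowStrand, lowStrand,
          underStrand_of_ge hM1.le, lowHeight_of_ge hM1.le le_rfl,
          underStrand_of_ge (by norm_num), lowHeight_of_ge le_rfl (by norm_num)]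
        simp
      · refine ⟨(), 2 / 5 * t, ⟨by linarith, by linarith [ht.2]⟩, ?_⟩
        change _ = levelChart (climb ω θ₀ M (2 / 5 * t), 2 / 5 * t)
        have h1 : highStrand t = ((overStrand t).1, 2 / 5 * t) := Prod.ext rfl (hhigh t ht)
        rw [climb, if_neg (by linarith), min_eq_right (by linarith [ht.2]), levelChart_polarPoint,
          show 5 / 2 * (2 / 5 * t) = t by ring, h1]

theorem strandImage_climbShort (ω θ₀ : ℝ) :
    strandImage levelChart (fun (_ : Unit) => climbShort ω θ₀) (-(1 / 4)) (1 / 4) =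
      arc ω θ₀ midStrand (3 / 8) (5 / 8) := by
  ext x
  constructor
  · rintro ⟨-, y, hy, rfl⟩
    refine ⟨1 / 2 + y / 2, ⟨by linarith [hy.1], by linarith [hy.2]⟩, ?_⟩
    change levelChart (climbShort ω θ₀ y, y) = _
    rw [climbShort, min_eq_right hy.2, max_eq_right hy.1, levelChart_polarPoint, midStrand]
    congr 2
    ring
  · rintro ⟨t, ht, rfl⟩
    refine ⟨(), 2 * t - 1, ⟨by linarith [ht.1], by linarith [ht.2]⟩, ?_⟩
    change _ = levelChart (climbShort ω θ₀ (2 * t - 1), 2 * t - 1)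
    rw [climbShort, min_eq_right (by linarith [ht.2]), max_eq_right (by linarith [ht.1]),
      levelChart_polarPoint, midStrand]
    congr 2
    ring

theorem innerRadius_bounds : 1 ≤ innerRadius ∧ innerRadius < 7 / 4 :=
  ⟨(underStrand_bounds _).1, underStrand_three_eighths⟩

/-- The strand that climbs around the axis is pulled across the axis, level by level, to the short
way.  At the heights in question there is nothing else inside the cylinder of radius `7/4`. -/
theorem linkEquiv_unwind {ω θ₀ M : ℝ} {L₂ : Set E3} (hM1 : 1 < M)
    (hM : ω * M = 2 * Real.pi) (hL₂ : ∀ x ∈ L₂, 2 ≤ rad x) :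
    LinkEquiv (L₂ ∪ arc ω θ₀ (lowStrand M) 0 (3 / 8) ∪ arc ω θ₀ highStrand (5 / 8) 1 ∪
        (arc ω θ₀ (lowStrand M) (3 / 8) M ∪ arc ω θ₀ highStrand 0 (5 / 8)))
      (L₂ ∪ arc ω θ₀ (lowStrand M) 0 (3 / 8) ∪ arc ω θ₀ highStrand (5 / 8) 1 ∪
        arc ω θ₀ midStrand (3 / 8) (5 / 8)) := by
  rw [← strandImage_climb hM1 hM, ← strandImage_climbShort]
  refine linkEquiv_of_strandHomotopy levelChart.toOpenPartialHomeomorph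
    (c := fun _ => climb ω θ₀ M) (c' := fun _ => climbShort ω θ₀)
    (fun _ => continuous_climb hM1 hM) (fun _ => continuous_climbShort ω θ₀)
    (fun _ y hy => climb_eq_of_notMem hy) (fun i j hij => (hij (Subsingleton.elim i j)).elim)
    (W := {q | q.1.1 ^ 2 + q.1.2 ^ 2 < (7 / 4) ^ 2}) ?_ (fun _ _ => trivial) ?_ ?_
  · have : Continuous fun q : Plane × ℝ => q.1.1 ^ 2 + q.1.2 ^ 2 := by fun_prop
    exact isOpen_lt this continuous_const
  · intro _ y hy s hs
    have h1 := climb_sq_lt (ω := ω) (θ₀ := θ₀) hM1 y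
    have h2 : (climbShort ω θ₀ y).1 ^ 2 + (climbShort ω θ₀ y).2 ^ 2 < (7 / 4) ^ 2 := by
      rw [climbShort, sq_add_sq_polarPoint]
      have := innerRadius_bounds
      nlinarith
    simp only [mem_ofPred_eq, strandHomotopy_fst, strandHomotopy_snd]
    have h3 := convex_comb_lt hs h1 h2
    have h4 : 0 ≤ s * (1 - s) := mul_nonneg hs.1 (by linarith [hs.2])
    have h5 := mul_nonneg h4 (sq_nonneg ((climb ω θ₀ M y).1 - (climbShort ω θ₀ y).1))
    have h6 := mul_nonneg h4 (sq_nonneg ((climb ω θ₀ M y).2 - (climbShort ω θ₀ y).2))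
    nlinarith
  · -- At the heights between `-1/4` and `1/4`, the rest of the link has a radius of at least `7/4`.
    rintro q hq hy hx
    have hr : rad (levelChart q) < 7 / 4 := by
      rw [rad_levelChart]
      exact (Real.sqrt_lt' (by norm_num)).2 hq
    have hz : levelChart q 2 = q.2 := rfl
    have hlow : ∀ M : ℝ, 1 ≤ M → ∀ t ∈ Icc (0 : ℝ) (3 / 8),
        7 / 4 ≤ (lowStrand M t).1 ∨ (lowStrand M t).2 ≤ -(1 / 4) := by
      intro M hM t ht
      rcases le_total t (1 / 4) with h | h
      · exact Or.inl (underStrand_quarter.1.trans (underStrand_fst_antitone h))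
      · exact Or.inr (lowHeight_of_mem_Icc hM ⟨h, ht.2⟩)
    change levelChart q ∈ _ at hx
    rcases hx with (hx | ⟨t, ht, hx⟩) | ⟨t, ht, hx⟩
    · linarith [hL₂ _ hx]
    · rw [hx, rad_cylPoint (p := lowStrand M t) (zero_le_one.trans (underStrand_bounds _).1)] at hr
      rw [hx, cylPoint_two] at hz
      rcases hlow M hM1.le t ht with h | h
      · exact hr.not_ge h
      · linarith [hy.1]
    · have h1 : (highStrand t).1 = (lowStrand 1 (1 - t)).1 := by rw [highStrand_eq]
      have h2 : (highStrand t).2 = -(lowStrand 1 (1 - t)).2 := by rw [highStrand_eq]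
      rw [hx, rad_cylPoint (p := highStrand t)
        (by rw [h1]; exact zero_le_one.trans (underStrand_bounds _).1), h1] at hr
      rw [hx, cylPoint_two, h2] at hz
      rcases hlow 1 le_rfl (1 - t) ⟨by linarith [ht.2], by linarith [ht.1]⟩ with h | h
      · exact hr.not_ge h
      · linarith [hy.2]

/-- The strand that remains when the turn around the axis has been removed: it follows
`lowStrand` down, then `midStrand` upwards, and then `highStrand`. -/
def shortStrand (M t : ℝ) : Plane :=
  if t ≤ 3 / 8 then lowStrand M t else if t ≤ 5 / 8 then midStrand t else highStrand t

theorem lowStrand_three_eighths {M : ℝ} (hM : 1 ≤ M) : lowStrand M (3 / 8) = midStrand (3 / 8) := by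
  refine Prod.ext rfl ?_
  simp only [lowStrand, midStrand]
  rw [lowHeight_of_le hM ⟨le_rfl, by linarith⟩, div_self (by linarith)]
  norm_num

theorem highStrand_five_eighths : highStrand (5 / 8) = midStrand (5 / 8) := by
  rw [highStrand_eq, show (1 : ℝ) - 5 / 8 = 3 / 8 by norm_num, lowStrand_three_eighths le_rfl]
  simp only [midStrand]
  norm_num

theorem continuous_shortStrand {M : ℝ} (hM : 1 ≤ M) : Continuous (shortStrand M) := by
  have hmid : Continuous midStrand := by unfold midStrand; fun_prop
  refine Continuous.if_le (continuous_lowStrand M) ?_ continuous_id continuous_const ?_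
  · refine Continuous.if_le hmid continuous_highStrand continuous_id continuous_const ?_
    rintro t rfl
    exact highStrand_five_eighths.symm
  · rintro t rfl
    rw [if_pos (by norm_num), lowStrand_three_eighths hM]

theorem shortStrand_bounds (M t : ℝ) : 1 ≤ (shortStrand M t).1 ∧ (shortStrand M t).1 ≤ 2 := by
  unfold shortStrand
  split_ifs
  · exact underStrand_bounds t
  · have := innerRadius_bounds
    exact ⟨this.1, by simp only [midStrand]; linarith⟩
  · rw [highStrand_eq]
    exact underStrand_bounds (1 - t)

theorem arc_shortStrand {ω θ₀ M : ℝ} (hM : 1 ≤ M) :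
    arc ω θ₀ (shortStrand M) 0 1 = arc ω θ₀ (lowStrand M) 0 (3 / 8) ∪
      arc ω θ₀ midStrand (3 / 8) (5 / 8) ∪ arc ω θ₀ highStrand (5 / 8) 1 := by
  rw [← arc_union (f := shortStrand M) (show (0 : ℝ) ≤ 3 / 8 by norm_num) (by norm_num),
    ← arc_union (f := shortStrand M) (show (3 / 8 : ℝ) ≤ 5 / 8 by norm_num) (by norm_num),
    ← union_assoc]
  congr 1
  · congr 1
    · exact arc_congr fun t ht => if_pos ht.2
    · refine arc_congr fun t ht => ?_
      rcases ht.1.eq_or_lt with h | h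
      · rw [← h, shortStrand, if_pos le_rfl, lowStrand_three_eighths hM]
      · rw [shortStrand, if_neg h.not_ge, if_pos ht.2]
  · refine arc_congr fun t ht => ?_
    rw [shortStrand, if_neg (by linarith [ht.1])]
    rcases ht.1.eq_or_lt with h | h
    · rw [← h, if_pos le_rfl, highStrand_five_eighths]
    · rw [if_neg h.not_ge]

/-- The core of destabilization: a strand that passes under another part of itself from the radius
`2` to the radius `1`, runs once around the axis, and passes over to the radius `2` again, can be
replaced by an arc at the radius `2`, if nothing else lies inside the cylinder of radius `2`.
The strand is first moved to one that climbs strictly along its turn around the axis. -/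
theorem linkEquiv_unloop {ω θ₀ M : ℝ} {L₂ : Set E3} (hω : 0 < ω) (hM1 : 1 < M)
    (hM : ω * M = 2 * Real.pi) (hL₂ : ∀ x ∈ L₂, 2 ≤ rad x)
    (hL₂' : ∀ p t, 0 < p.1 → p.1 < 5 / 2 → t ∈ Ioo (0 : ℝ) 1 → cylPoint p (θ₀ + ω * t) ∉ L₂) :
    LinkEquiv (L₂ ∪ arc ω θ₀ underStrand 0 M ∪ arc ω θ₀ overStrand 0 1)
      (L₂ ∪ arc ω θ₀ (fun _ => (2, 0)) 0 1) := by
  have hL : ∀ p θ, 0 < p.1 → p.1 < 2 → cylPoint p θ ∉ L₂ := fun p θ hp hp2 h => by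
    have := hL₂ _ h
    rw [rad_cylPoint hp.le] at this
    linarith
  have hu : arc ω θ₀ underStrand 0 (1 / 4) = arc ω θ₀ (lowStrand M) 0 (1 / 4) :=
    arc_congr fun t ht => (lowStrand_of_le_quarter hM1.le ht.2).symm
  have ho : arc ω θ₀ overStrand (3 / 4) 1 = arc ω θ₀ highStrand (3 / 4) 1 :=
    arc_congr fun t ht => (highStrand_of_ge ht.1).symm
  have step1 := linkEquiv_lower (θ₀ := θ₀) hω hM1 hM hL
  have step2 := linkEquiv_raise (θ₀ := θ₀) hω hM1 hM hL
  have step3 := linkEquiv_unwind (ω := ω) (θ₀ := θ₀) hM1 hM hL₂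
  have step4 : LinkEquiv (L₂ ∪ arc ω θ₀ (shortStrand M) 0 1)
      (L₂ ∪ arc ω θ₀ (fun _ => (2, 0)) 0 1) := by
    refine linkEquiv_arc hω (continuous_shortStrand hM1.le) continuous_const
      (α := θ₀ - ω * (M - 1) / 2) (by nlinarith) (by nlinarith) ?_
      (V := {q | 0 < q.1.1 ∧ q.1.1 < 5 / 2}) ?_ (fun q hq => hq.1) ?_ ?_
    · intro t ht
      rcases le_or_gt t 0 with h | h
      · rw [shortStrand, if_pos (by linarith), lowStrand_of_le_quarter hM1.le (by linarith),
          underStrand_of_nonpos h]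
      · have h' : 1 ≤ t := not_lt.1 fun h' => ht ⟨h, h'⟩
        rw [shortStrand, if_neg (by linarith), if_neg (by linarith),
          highStrand_of_ge (by linarith), overStrand_eq, underStrand_of_nonpos (by linarith)]
        simp
    · exact (isOpen_lt continuous_const continuous_fst.fst).inter
        (isOpen_lt continuous_fst.fst continuous_const)
    · intro t ht s hs
      have h := shortStrand_bounds M t
      simp only [mem_ofPred_eq, smul_interp_fst]
      exact ⟨convex_comb_pos hs (by linarith) (by norm_num),
        convex_comb_lt hs (by linarith) (by norm_num)⟩
    · rintro p t ⟨h1, h2⟩ ht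
      exact hL₂' p t h1 h2 ht
  have e1 : L₂ ∪ arc ω θ₀ underStrand 0 M ∪ arc ω θ₀ overStrand 0 1 =
      L₂ ∪ arc ω θ₀ underStrand 0 (1 / 4) ∪ arc ω θ₀ overStrand 0 1 ∪
        arc ω θ₀ underStrand (1 / 4) M := by
    rw [← arc_union (f := underStrand) (show (0 : ℝ) ≤ 1 / 4 by norm_num)
      (show 1 / 4 ≤ M by linarith)]
    ext x; simp only [mem_union]; tauto
  have e2 : L₂ ∪ arc ω θ₀ underStrand 0 (1 / 4) ∪ arc ω θ₀ overStrand 0 1 ∪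
        arc ω θ₀ (lowStrand M) (1 / 4) M =
      L₂ ∪ arc ω θ₀ (lowStrand M) 0 M ∪ arc ω θ₀ overStrand (3 / 4) 1 ∪
        arc ω θ₀ overStrand 0 (3 / 4) := by
    rw [hu, ← arc_union (f := overStrand) (show (0 : ℝ) ≤ 3 / 4 by norm_num)
      (show (3 / 4 : ℝ) ≤ 1 by norm_num), ← arc_union (f := lowStrand M)
      (show (0 : ℝ) ≤ 1 / 4 by norm_num) (show 1 / 4 ≤ M by linarith)]
    ext x; simp only [mem_union]; tauto
  have e3 : L₂ ∪ arc ω θ₀ (lowStrand M) 0 M ∪ arc ω θ₀ overStrand (3 / 4) 1 ∪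
        arc ω θ₀ highStrand 0 (3 / 4) =
      L₂ ∪ arc ω θ₀ (lowStrand M) 0 (3 / 8) ∪ arc ω θ₀ highStrand (5 / 8) 1 ∪
        (arc ω θ₀ (lowStrand M) (3 / 8) M ∪ arc ω θ₀ highStrand 0 (5 / 8)) := by
    rw [ho, ← arc_union (f := lowStrand M) (show (0 : ℝ) ≤ 3 / 8 by norm_num)
      (show 3 / 8 ≤ M by linarith), ← arc_union (f := highStrand) (a := 5 / 8) (b := 3 / 4) (c := 1)
      (by norm_num) (by norm_num), ← arc_union (f := highStrand) (a := 0) (b := 5 / 8) (c := 3 / 4)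
      (by norm_num) (by norm_num)]
    ext x; simp only [mem_union]; tauto
  have e4 : L₂ ∪ arc ω θ₀ (lowStrand M) 0 (3 / 8) ∪ arc ω θ₀ highStrand (5 / 8) 1 ∪
        arc ω θ₀ midStrand (3 / 8) (5 / 8) = L₂ ∪ arc ω θ₀ (shortStrand M) 0 1 := by
    rw [arc_shortStrand hM1.le]
    ext x; simp only [mem_union]; tauto
  rw [e1]
  rw [e2] at step1
  rw [e3] at step2
  rw [e4] at step3
  exact step1.trans (step2.trans (step3.trans step4))

theorem braidArc_union (K K' : Set ℕ) (ω : ℝ) (v : List ℕ) (θ₀ : ℝ) :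
    braidArc (K ∪ K') ω v θ₀ = braidArc K ω v θ₀ ∪ braidArc K' ω v θ₀ := by
  ext x
  simp only [mem_union, mem_braidArc]
  constructor
  · rintro ⟨j, k, hk | hk, t, ht, rfl⟩
    · exact Or.inl ⟨j, k, hk, t, ht, rfl⟩
    · exact Or.inr ⟨j, k, hk, t, ht, rfl⟩
  · rintro (⟨j, k, hk, t, ht, rfl⟩ | ⟨j, k, hk, t, ht, rfl⟩)
    · exact ⟨j, k, Or.inl hk, t, ht, rfl⟩
    · exact ⟨j, k, Or.inr hk, t, ht, rfl⟩

theorem restArc_union_left (K K' : Set ℕ) (a b : ℝ) :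
    restArc (K ∪ K') a b = restArc K a b ∪ restArc K' a b := by
  ext x
  constructor
  · rintro ⟨k, hk | hk, θ, hθ, rfl⟩
    · exact Or.inl ⟨k, hk, θ, hθ, rfl⟩
    · exact Or.inr ⟨k, hk, θ, hθ, rfl⟩
  · rintro (⟨k, hk, θ, hθ, rfl⟩ | ⟨k, hk, θ, hθ, rfl⟩)
    · exact ⟨k, Or.inl hk, θ, hθ, rfl⟩
    · exact ⟨k, Or.inr hk, θ, hθ, rfl⟩

theorem restArc_union_braidArc {K : Set ℕ} {ω : ℝ} (hω : 0 < ω) {v : List ℕ}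
    (hv : ∀ i ∈ v, i ∉ K ∧ i + 1 ∉ K) {a θ₀ : ℝ} (ha : a ≤ θ₀) :
    restArc K a θ₀ ∪ braidArc K ω v θ₀ = restArc K a (θ₀ + ω * v.length) := by
  induction v generalizing θ₀ with
  | nil => simp [braidArc]
  | cons i v ih =>
    obtain ⟨h1, h2⟩ := hv i (by simp)
    rw [braidArc, sweep_eq_restArc hω h1 h2, ← union_assoc, restArc_union ha (by linarith),
      ih (fun j hj => hv j (by simp [hj])) (by linarith)]
    congr 1
    push_cast [List.length_cons]
    ring

theorem restArc_periodic (K : Set ℕ) (a b : ℝ) :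
    restArc K (a - 2 * Real.pi) (b - 2 * Real.pi) = restArc K a b := by
  ext x
  constructor
  · rintro ⟨k, hk, θ, hθ, rfl⟩
    exact ⟨k, hk, θ + 2 * Real.pi, ⟨by linarith [hθ.1], by linarith [hθ.2]⟩,
      (cylPoint_periodic _ _).symm⟩
  · rintro ⟨k, hk, θ, hθ, rfl⟩
    exact ⟨k, hk, θ - 2 * Real.pi, ⟨by linarith [hθ.1], by linarith [hθ.2]⟩,
      (cylPoint_sub_two_pi _ _).symm⟩

theorem restArc_singleton {ω θ₀ : ℝ} (hω : 0 < ω) (k : ℕ) (a b : ℝ) :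
    restArc {k} (θ₀ + ω * a) (θ₀ + ω * b) = arc ω θ₀ (fun _ => ((k : ℝ), 0)) a b := by
  ext x
  constructor
  · rintro ⟨_, rfl, θ, hθ, rfl⟩
    refine ⟨(θ - θ₀) / ω, ⟨?_, ?_⟩, ?_⟩
    · rw [le_div_iff₀ hω]; linarith [hθ.1]
    · rw [div_le_iff₀ hω]; linarith [hθ.2]
    · congr 1
      field_simp
      ring
  · rintro ⟨t, ht, rfl⟩
    refine ⟨k, rfl, _, ⟨?_, ?_⟩, rfl⟩
    · gcongr; exact ht.1
    · gcongr; exact ht.2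

theorem rad_of_mem_braidArc {K : Set ℕ} {ω : ℝ} {v : List ℕ} (hv : ∀ i ∈ v, 2 ≤ i)
    (hK : ∀ k ∈ K, 2 ≤ k) {θ₀ : ℝ} {x : E3} (hx : x ∈ braidArc K ω v θ₀) : 2 ≤ rad x := by
  obtain ⟨j, k, hk, t, ht, rfl⟩ := mem_braidArc.1 hx
  have hi := hv _ (List.get_mem v j)
  have h2 : 2 ≤ (strandPoint (v.get j) k t).1 := by
    by_cases h : k = v.get j ∨ k = v.get j + 1
    · have : (2 : ℝ) ≤ (v.get j : ℕ) := by exact_mod_cast hi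
      exact this.trans (strandPoint_bounds _ h t).1
    · rw [not_or] at h
      rw [strandPoint_of_ne h.1 h.2]
      exact Nat.ofNat_le_cast.2 (hK k hk)
  rwa [rad_cylPoint (by linarith)]

theorem rad_of_mem_restArc {K : Set ℕ} (hK : ∀ k ∈ K, 2 ≤ k) {a b : ℝ} {x : E3}
    (hx : x ∈ restArc K a b) : 2 ≤ rad x := by
  obtain ⟨k, hk, θ, hθ, rfl⟩ := hx
  rw [rad_cylPoint (Nat.cast_nonneg k)]
  exact Nat.ofNat_le_cast.2 (hK k hk)

/-- The innermost strand of a closed braid is removed if it is involved in a single crossing,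
the last one. -/
theorem linkEquiv_innermost {n : ℕ} (hn : 1 ≤ n) {ω : ℝ} (hω : 0 < ω) {v : List ℕ}
    (hv : ∀ i ∈ v, 2 ≤ i) (hfit : ω * (v.length + 1) < 2 * Real.pi) :
    LinkEquiv (wideBraid (n + 1) ω (v ++ [1]))
      (braidArc (Icc 2 (n + 1)) ω v 0 ∪ restArc (Icc 2 (n + 1)) (ω * v.length) (2 * Real.pi)) := by
  set θ₀ := ω * v.length with hθ₀
  have hθ₀0 : 0 ≤ θ₀ := by positivity
  have hfit' : θ₀ + ω < 2 * Real.pi := by rw [hθ₀]; linarith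
  set M := 2 * Real.pi / ω with hMdef
  have hM : ω * M = 2 * Real.pi := by rw [hMdef]; field_simp
  have hM1 : 1 < M := by rw [hMdef, one_lt_div hω]; linarith
  -- The rest `L₂` of the link: what lies outside the last sector in the positions `k ≥ 2`, and the
  -- uninvolved strands inside it.
  let L₂ : Set E3 := braidArc (Icc 2 (n + 1)) ω v 0 ∪
    restArc (Icc 2 (n + 1)) (θ₀ + ω) (2 * Real.pi) ∪ restArc (Icc 3 (n + 1)) θ₀ (θ₀ + ω)
  have hI : Icc 1 (n + 1) = {1} ∪ Icc 2 (n + 1) := by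
    ext k; simp only [mem_Icc, mem_union, mem_singleton_iff]; omega
  have hI2 : Icc 2 (n + 1) = {2} ∪ Icc 3 (n + 1) := by
    ext k; simp only [mem_Icc, mem_union, mem_singleton_iff]; omega
  have hrest3 : sweep (Icc 1 (n + 1)) ω 1 θ₀ =
      arc ω θ₀ underStrand 0 1 ∪ arc ω θ₀ overStrand 0 1 ∪
        restArc (Icc 3 (n + 1)) θ₀ (θ₀ + ω) := by
    rw [← sweep_eq_restArc hω (i := 1) (by simp) (by simp)]
    ext x
    constructor
    · rintro ⟨k, hk, t, ht, rfl⟩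
      rw [mem_Icc] at hk
      rcases (by omega : k = 1 ∨ k = 2 ∨ 3 ≤ k) with rfl | rfl | h
      · exact Or.inl (Or.inr ⟨t, ht, by rw [overStrand, clamp_of_mem ht]⟩)
      · exact Or.inl (Or.inl ⟨t, ht, by rw [underStrand, clamp_of_mem ht]⟩)
      · exact Or.inr ⟨k, ⟨h, hk.2⟩, t, ht, rfl⟩
    · rintro ((⟨t, ht, rfl⟩ | ⟨t, ht, rfl⟩) | ⟨k, hk, t, ht, rfl⟩)
      · exact ⟨2, ⟨by norm_num, by omega⟩, t, ht, by rw [underStrand, clamp_of_mem ht]⟩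
      · exact ⟨1, ⟨le_rfl, by omega⟩, t, ht, by rw [overStrand, clamp_of_mem ht]⟩
      · exact ⟨k, ⟨le_trans (by norm_num) hk.1, hk.2⟩, t, ht, rfl⟩
  have hloop : braidArc {1} ω v 0 ∪ restArc {1} (θ₀ + ω) (2 * Real.pi) =
      arc ω θ₀ underStrand 1 M := by
    have h1 : restArc {1} (θ₀ + ω) (2 * Real.pi) = restArc {1} (θ₀ + ω - 2 * Real.pi) 0 := by
      rw [← restArc_periodic, sub_self]
    have h2 : arc ω θ₀ underStrand 1 M = arc ω θ₀ (fun _ => (((1 : ℕ) : ℝ), 0)) 1 M :=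
      arc_congr fun t ht => by rw [underStrand_of_ge ht.1, Nat.cast_one]
    rw [h1, union_comm, restArc_union_braidArc hω (fun i hi => ?_) (by linarith), zero_add, ← hθ₀,
      h2, ← restArc_singleton hω, hM, mul_one, ← restArc_periodic {1} (θ₀ + ω),
      add_sub_cancel_right]
    have := hv i hi
    simp only [mem_singleton_iff]
    omega
  have e1 : wideBraid (n + 1) ω (v ++ [1]) =
      L₂ ∪ arc ω θ₀ underStrand 0 M ∪ arc ω θ₀ overStrand 0 1 := by
    rw [wideBraid, braidArc_append, braidArc, braidArc, union_empty, zero_add, ← hθ₀, hrest3]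
    push_cast [List.length_append, List.length_cons, List.length_nil]
    rw [show ω * ((v.length : ℝ) + 1) = θ₀ + ω by rw [hθ₀]; ring, hI, braidArc_union,
      restArc_union_left, ← arc_union (f := underStrand) zero_le_one hM1.le, ← hloop]
    simp only [L₂]
    ext x; simp only [mem_union]; tauto
  have e2 : L₂ ∪ arc ω θ₀ (fun _ => (2, 0)) 0 1 =
      braidArc (Icc 2 (n + 1)) ω v 0 ∪ restArc (Icc 2 (n + 1)) θ₀ (2 * Real.pi) := by
    have h1 : arc ω θ₀ (fun _ => (2, 0)) 0 1 = restArc {2} θ₀ (θ₀ + ω) := by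
      have := restArc_singleton (θ₀ := θ₀) hω 2 0 1
      rw [mul_zero, add_zero, mul_one] at this
      rw [this]
      norm_num
    have h3 : restArc (Icc 2 (n + 1)) θ₀ (θ₀ + ω) =
        restArc {2} θ₀ (θ₀ + ω) ∪ restArc (Icc 3 (n + 1)) θ₀ (θ₀ + ω) := by
      rw [hI2, restArc_union_left]
    rw [h1, ← restArc_union (show θ₀ ≤ θ₀ + ω by linarith) hfit'.le, h3]
    simp only [L₂]
    ext x; simp only [mem_union]; tauto
  rw [e1, ← e2]
  refine linkEquiv_unloop hω hM1 hM ?_ ?_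
  · rintro x ((hx | hx) | hx)
    · exact rad_of_mem_braidArc hv (fun k hk => hk.1) hx
    · exact rad_of_mem_restArc (fun k hk => hk.1) hx
    · exact rad_of_mem_restArc (fun k hk => le_trans (by norm_num) hk.1) hx
  · intro p t hp hp2 ht hx
    have hθ : θ₀ + ω * t ∈ Ioo θ₀ (θ₀ + ω) :=
      ⟨by linarith [mul_pos hω ht.1], by linarith [mul_lt_of_lt_one_right hω ht.2]⟩
    rcases hx with (hx | ⟨k, hk, θ', hθ', hx⟩) | ⟨k, hk, θ', hθ', hx⟩
    · obtain ⟨p', θ', hp', hθ', h⟩ := exists_of_mem_braidArc hω.le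
        (fun i hi => le_trans (by norm_num) (hv i hi)) (fun k hk => le_trans (by norm_num) hk.1) hx
      rw [zero_add, ← hθ₀] at hθ'
      exact cylPoint_ne_of_notMem hθ₀0 hfit'.le hp hp' hθ ⟨hθ'.1, by linarith [hθ'.2]⟩
        (fun h => by linarith [h.1, hθ'.2]) h
    · exact cylPoint_ne_of_notMem hθ₀0 hfit'.le hp (Nat.cast_pos.2 (by have := hk.1; omega)) hθ
        ⟨by linarith [hθ'.1], hθ'.2⟩ (fun h => by linarith [h.2, hθ'.1]) hx
    · have hk3 : (3 : ℝ) ≤ k := by exact_mod_cast hk.1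
      have := cylPoint_inj_left hp (Nat.cast_pos.2 (by have := hk.1; omega)) hx
      rw [this] at hp2
      simp only at hp2
      linarith

/-- Markov destabilization: the outermost strand of a closed braid is removed if it is
involved in a single crossing.  A half-turn of the half-planes makes it the innermost one, and
another half-turn restores the order of the remaining strands. -/
theorem linkEquiv_destabilize {n : ℕ} (hn : 1 ≤ n) {w : List ℕ} (hw : IsPositiveBraidWord n w) :
    LinkEquiv (closedBraid (n + 1) (w ++ [n])) (closedBraid n w) := by
  have hp := Real.pi_pos
  rw [closedBraid_eq_wideBraid, closedBraid_eq_wideBraid]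
  set ω : ℝ := 2 * Real.pi / ((w ++ [n]).length + 1) with hω
  have hω0 : 0 < ω := by positivity
  have hωe : ω * (w.length + 2) = 2 * Real.pi := by
    rw [hω]
    push_cast [List.length_append, List.length_cons, List.length_nil]
    field_simp
    ring
  have hc : (1 : ℝ) ≤ ((n : ℝ) + 2) / 2 := by linarith [Nat.cast_nonneg (α := ℝ) n]
  have hflip1 : (fun k => n + 2 - k) '' Icc 1 (n + 1) = Icc 1 (n + 1) := by
    ext k
    simp only [mem_image, mem_Icc]
    exact ⟨by rintro ⟨k, h, rfl⟩; omega, fun h => ⟨n + 2 - k, by omega, by omega⟩⟩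
  have hflip2 : (fun k => n + 2 - k) '' Icc 2 (n + 1) = Icc 1 n := by
    ext k
    simp only [mem_image, mem_Icc]
    exact ⟨by rintro ⟨k, h, rfl⟩; omega, fun h => ⟨n + 2 - k, by omega, by omega⟩⟩
  have hmap : (w.map fun i => n + 1 - i).map (fun i => n + 1 - i) = w := by
    rw [List.map_map]
    conv_rhs => rw [← List.map_id w]
    refine List.map_congr_left fun i hi => ?_
    have := hw i hi
    simp only [Function.comp, id]
    omega
  have step1 := linkEquiv_flipSpace hc 1 (wideBraid (n + 1) ω (w ++ [n]))
  rw [wideBraid, image_union, flipSpace_image_braidArc Subset.rfl hflip1 (by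
      intro i hi
      rcases List.mem_append.1 hi with h | h
      · have := hw i h
        exact ⟨this.1, this.2.le⟩
      · rw [List.mem_singleton.1 h]
        exact ⟨hn, le_rfl⟩), flipSpace_image_restArc Subset.rfl hflip1 hn] at step1
  have step2 := linkEquiv_innermost hn hω0 (v := w.map fun i => n + 1 - i)
    (by
      intro i hi
      obtain ⟨j, hj, rfl⟩ := List.mem_map.1 hi
      have := hw j hj
      omega)
    (by rw [List.length_map]; linarith)
  have step3 := linkEquiv_flipSpace hc 1
    (braidArc (Icc 2 (n + 1)) ω (w.map fun i => n + 1 - i) 0 ∪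
      restArc (Icc 2 (n + 1)) (ω * (w.map fun i => n + 1 - i).length) (2 * Real.pi))
  have hsub : Icc 2 (n + 1) ⊆ Icc 1 (n + 1) := Icc_subset_Icc_left (by norm_num)
  rw [image_union, flipSpace_image_braidArc hsub hflip2 (by
      intro i hi
      obtain ⟨j, hj, rfl⟩ := List.mem_map.1 hi
      have := hw j hj
      rw [mem_Icc]
      omega), flipSpace_image_restArc hsub hflip2 hn, hmap, List.length_map] at step3
  have e1 : wideBraid (n + 1) ω ((w.map fun i => n + 1 - i) ++ [1]) =
      braidArc (Icc 1 (n + 1)) ω ((w ++ [n]).map fun i => n + 1 - i) 0 ∪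
        restArc (Icc 1 (n + 1)) (ω * (w ++ [n]).length) (2 * Real.pi) := by
    rw [wideBraid, List.map_append]
    simp
  rw [e1] at step2
  rw [List.length_map] at step2
  have step4 := linkEquiv_width (n := n) (ω := ω) (ω' := 2 * Real.pi / (w.length + 1)) hω0
    (by positivity) (fun i hi => (hw i hi).1) (by linarith)
    (by rw [div_mul_eq_mul_div, div_lt_iff₀ (by positivity)]; nlinarith)
  exact step1.trans (step2.trans (step3.trans step4))

/-! ### The positive braid monoid -/

/-- The defining relations of the positive braid monoid on infinitely many strands. -/
inductive BraidRel : FreeMonoid ℕ → FreeMonoid ℕ → Prop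
  | comm (i j : ℕ) (hi : 1 ≤ i) (hij : i + 2 ≤ j) :
      BraidRel (FreeMonoid.ofList [i, j]) (FreeMonoid.ofList [j, i])
  | braid (i : ℕ) (hi : 1 ≤ i) :
      BraidRel (FreeMonoid.ofList [i, i + 1, i]) (FreeMonoid.ofList [i + 1, i, i + 1])

/-- The positive braid monoid on infinitely many strands. -/
abbrev PosBraid : Type := (conGen BraidRel).Quotient

/-- The positive braid that a word stands for. -/
def braidOf (w : List ℕ) : PosBraid := ((FreeMonoid.ofList w : FreeMonoid ℕ) : PosBraid)

theorem braidOf_nil : braidOf [] = 1 := rfl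

theorem braidOf_append (v w : List ℕ) : braidOf (v ++ w) = braidOf v * braidOf w := rfl

theorem braidOf_cons (i : ℕ) (w : List ℕ) : braidOf (i :: w) = braidOf [i] * braidOf w := rfl

theorem braidOf_comm {i j : ℕ} (hi : 1 ≤ i) (hij : i + 2 ≤ j) :
    braidOf [i] * braidOf [j] = braidOf [j] * braidOf [i] :=
  (Con.eq _).2 (ConGen.Rel.of _ _ (BraidRel.comm i j hi hij))

theorem braidOf_braid {i : ℕ} (hi : 1 ≤ i) :
    braidOf [i] * braidOf [i + 1] * braidOf [i] =
      braidOf [i + 1] * braidOf [i] * braidOf [i + 1] :=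
  (Con.eq _).2 (ConGen.Rel.of _ _ (BraidRel.braid i hi))

theorem isPositiveBraidWord_append {n : ℕ} {v w : List ℕ} :
    IsPositiveBraidWord n (v ++ w) ↔ IsPositiveBraidWord n v ∧ IsPositiveBraidWord n w :=
  List.forall_mem_append

theorem closedBraid_comm {n i j : ℕ} {a b : List ℕ} (hij : i + 2 ≤ j ∨ j + 2 ≤ i)
    (h : IsPositiveBraidWord n (a ++ [i, j] ++ b)) :
    LinkEquiv (closedBraid n (a ++ [i, j] ++ b)) (closedBraid n (a ++ [j, i] ++ b)) := by
  obtain ⟨⟨ha, hc⟩, hb⟩ := (isPositiveBraidWord_append.trans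
    (and_congr_left' isPositiveBraidWord_append)).1 h
  have hi := hc i (by simp)
  have hj := hc j (by simp)
  have hp := Real.pi_pos
  have hl : (a ++ [j, i] ++ b).length = (a ++ [i, j] ++ b).length := by simp
  rw [closedBraid_eq_wideBraid, closedBraid_eq_wideBraid, hl]
  have h2 : 2 ≤ (a ++ [i, j] ++ b).length := by simp; omega
  have h2' : (2 : ℝ) ≤ ((a ++ [i, j] ++ b).length : ℝ) := by exact_mod_cast h2
  refine linkEquiv_comm (by positivity) hij ⟨hi.1, hi.2.ne⟩ ⟨hj.1, hj.2.ne⟩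
    (fun k hk => (ha k hk).1) (fun k hk => (hb k hk).1) ?_ ?_
  · rw [div_mul_eq_mul_div, div_le_iff₀ (by positivity)]
    nlinarith
  · rw [div_mul_eq_mul_div, div_lt_iff₀ (by positivity)]
    nlinarith

theorem closedBraid_braid {n i : ℕ} {a b : List ℕ}
    (h : IsPositiveBraidWord n (a ++ [i, i + 1, i] ++ b)) :
    LinkEquiv (closedBraid n (a ++ [i, i + 1, i] ++ b))
      (closedBraid n (a ++ [i + 1, i, i + 1] ++ b)) := by
  obtain ⟨⟨ha, hc⟩, hb⟩ := (isPositiveBraidWord_append.trans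
    (and_congr_left' isPositiveBraidWord_append)).1 h
  have hi := hc i (by simp)
  have hj := hc (i + 1) (by simp)
  have hp := Real.pi_pos
  have hl : (a ++ [i + 1, i, i + 1] ++ b).length = (a ++ [i, i + 1, i] ++ b).length := by simp
  rw [closedBraid_eq_wideBraid, closedBraid_eq_wideBraid, hl]
  have h3 : 3 ≤ (a ++ [i, i + 1, i] ++ b).length := by simp; omega
  have h3' : (3 : ℝ) ≤ ((a ++ [i, i + 1, i] ++ b).length : ℝ) := by exact_mod_cast h3
  refine linkEquiv_braid (by positivity) hi.1 hj.2
    (fun k hk => (ha k hk).1) (fun k hk => (hb k hk).1) ?_ ?_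
  · rw [div_mul_eq_mul_div, div_le_iff₀ (by positivity)]
    nlinarith
  · rw [div_mul_eq_mul_div, div_lt_iff₀ (by positivity)]
    nlinarith

/-- Two words are interchangeable if they have the same letters, and one may be replaced
by the other inside any closed positive braid.  The first condition makes sure that the replacement
does not lead out of the braid words on `n` strands. -/
def closureCon : Con (FreeMonoid ℕ) where
  r x y := (∀ i, i ∈ FreeMonoid.toList x ↔ i ∈ FreeMonoid.toList y) ∧ ∀ n (a b : List ℕ),
    IsPositiveBraidWord n (a ++ FreeMonoid.toList x ++ b) →
      LinkEquiv (closedBraid n (a ++ FreeMonoid.toList x ++ b))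
        (closedBraid n (a ++ FreeMonoid.toList y ++ b))
  iseqv := by
    have hpos : ∀ {x y : FreeMonoid ℕ} {n : ℕ} {a b : List ℕ},
        (∀ i, i ∈ FreeMonoid.toList x ↔ i ∈ FreeMonoid.toList y) →
        IsPositiveBraidWord n (a ++ FreeMonoid.toList x ++ b) →
        IsPositiveBraidWord n (a ++ FreeMonoid.toList y ++ b) := by
      intro x y n a b h hx i hi
      refine hx i ?_
      simpa only [List.mem_append, h i] using hi
    refine ⟨fun x => ⟨fun i => Iff.rfl, fun n a b _ => LinkEquiv.refl _⟩, ?_, ?_⟩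
    · rintro x y ⟨h1, h2⟩
      exact ⟨fun i => (h1 i).symm, fun n a b h =>
        (h2 n a b (hpos (fun i => (h1 i).symm) h)).symm⟩
    · rintro x y z ⟨h1, h2⟩ ⟨h3, h4⟩
      exact ⟨fun i => (h1 i).trans (h3 i), fun n a b h =>
        (h2 n a b h).trans (h4 n a b (hpos h1 h))⟩
  mul' := by
    rintro x x' y y' ⟨h1, h2⟩ ⟨h3, h4⟩
    refine ⟨fun i => ?_, fun n a b h => ?_⟩
    · simp only [FreeMonoid.toList_mul, List.mem_append, h1 i, h3 i]
    · simp only [FreeMonoid.toList_mul] at h ⊢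
      have e1 := h2 n a (FreeMonoid.toList y ++ b) (by simpa only [List.append_assoc] using h)
      have e2 := h4 n (a ++ FreeMonoid.toList x') b (fun i hi => h i (by
        simpa only [List.mem_append, h1 i, or_assoc] using hi))
      simp only [List.append_assoc] at e1 e2 ⊢
      exact e1.trans e2

theorem conGen_le_closureCon : conGen BraidRel ≤ closureCon := by
  refine Con.conGen_le.2 ?_
  rintro _ _ (⟨i, j, hi, hij⟩ | ⟨i, hi⟩)
  · exact ⟨fun k => by simp [or_comm], fun n a b h => closedBraid_comm (Or.inl hij) h⟩
  · exact ⟨fun k => by simp; tauto, fun n a b h => closedBraid_braid h⟩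

/-- Words for the same positive braid have the same closure. -/
theorem closedBraid_congr {n : ℕ} {v w : List ℕ} (h : braidOf v = braidOf w)
    (hv : IsPositiveBraidWord n v) : LinkEquiv (closedBraid n v) (closedBraid n w) := by
  have := (conGen_le_closureCon ((Con.eq _).1 h)).2 n [] []
  simpa only [FreeMonoid.toList_ofList, List.nil_append, List.append_nil, hv, forall_const]
    using this

theorem closedBraid_append_comm {n : ℕ} {v w : List ℕ} (h : IsPositiveBraidWord n (v ++ w)) :
    LinkEquiv (closedBraid n (v ++ w)) (closedBraid n (w ++ v)) := by
  induction v generalizing w with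
  | nil => rw [List.append_nil]; exact LinkEquiv.refl _
  | cons i v ih =>
    have h1 : LinkEquiv (closedBraid n (i :: (v ++ w))) (closedBraid n (v ++ w ++ [i])) :=
      linkEquiv_rotate (h i (by simp)) fun j hj => (h j (List.mem_cons_of_mem _ hj)).1
    have h2 : IsPositiveBraidWord n (v ++ (w ++ [i])) := fun j hj => h j (by
      simp only [List.mem_append, List.cons_append, List.mem_cons] at hj ⊢
      tauto)
    rw [List.append_assoc] at h1
    have h3 := h1.trans (ih h2)
    rwa [List.append_assoc] at h3

/-! ### Powers of the torus braid -/

/-- The braid `σ₁ σ₂ ⋯ σ_m` on `m + 1` strands. -/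
def torusBraid (m : ℕ) : PosBraid := braidOf (List.range' 1 m)

theorem torusBraid_zero : torusBraid 0 = 1 := rfl

theorem torusBraid_succ (m : ℕ) : torusBraid (m + 1) = torusBraid m * braidOf [m + 1] := by
  rw [torusBraid, List.range'_1_concat, braidOf_append, add_comm 1 m, torusBraid]

theorem braidOf_torusWord (m s : ℕ) : braidOf (torusWord (m + 1) s) = torusBraid m ^ s := by
  induction s with
  | zero => rfl
  | succ s ih =>
    rw [torusWord, List.replicate_succ, List.flatten_cons, braidOf_append, pow_succ', ← ih]
    rfl

theorem torusBraid_comm {m j : ℕ} (hj : m + 2 ≤ j) :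
    braidOf [j] * torusBraid m = torusBraid m * braidOf [j] := by
  induction m with
  | zero => rw [torusBraid_zero, one_mul, mul_one]
  | succ m ih =>
    rw [torusBraid_succ, ← mul_assoc, ih (by omega), mul_assoc, mul_assoc,
      braidOf_comm (by omega) hj]

/-- Conjugation by the torus braid takes every generator but the last one to the next one. -/
theorem torusBraid_shift {m i : ℕ} (hi : 1 ≤ i) (him : i < m) :
    braidOf [i + 1] * torusBraid m = torusBraid m * braidOf [i] := by
  induction m with
  | zero => omega
  | succ m ih =>
    rcases (Nat.lt_succ_iff.1 him).eq_or_lt with rfl | h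
    · obtain ⟨k, rfl⟩ := Nat.exists_eq_add_of_le' hi
      simp only [torusBraid_succ]
      rw [← mul_assoc, ← mul_assoc, torusBraid_comm (by omega)]
      simp only [mul_assoc]
      congr 1
      simpa only [mul_assoc] using (braidOf_braid hi).symm
    · rw [torusBraid_succ, ← mul_assoc, ih h, mul_assoc, mul_assoc,
        braidOf_comm hi (by omega)]

theorem torusBraid_pow_shift {m i b : ℕ} (hi : 1 ≤ i) (hib : i + b ≤ m) :
    braidOf [i + b] * torusBraid m ^ b = torusBraid m ^ b * braidOf [i] := by
  induction b with
  | zero => simp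
  | succ b ih =>
    rw [pow_succ', ← mul_assoc, ← add_assoc, torusBraid_shift (by omega) (by omega), mul_assoc,
      ih (by omega), mul_assoc]

theorem torusBraid_pow_shift_word {m b : ℕ} {v : List ℕ} (hv : ∀ i ∈ v, 1 ≤ i ∧ i + b ≤ m) :
    braidOf (v.map (· + b)) * torusBraid m ^ b = torusBraid m ^ b * braidOf v := by
  induction v with
  | nil => rw [List.map_nil, braidOf_nil, one_mul, mul_one]
  | cons i v ih =>
    obtain ⟨h1, h2⟩ := hv i (by simp)
    rw [List.map_cons, braidOf_cons, mul_assoc, ih fun j hj => hv j (List.mem_cons_of_mem _ hj),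
      ← mul_assoc, torusBraid_pow_shift h1 h2, mul_assoc, ← braidOf_cons]

/-- The remainder `σ₂ ⋯ σ_m` of the torus braid after its first letter is a shift of
`σ₁ ⋯ σ_{m-1}`. -/
theorem torusBraid_eq_mul {m M : ℕ} (hm : 1 ≤ m) (hM : m ≤ M) :
    ∃ x, torusBraid m = braidOf [1] * x ∧ x * torusBraid M = torusBraid M * torusBraid (m - 1) := by
  induction m, hm using Nat.le_induction with
  | base => exact ⟨1, rfl, by rw [one_mul, Nat.sub_self, torusBraid_zero, mul_one]⟩
  | succ m hm ih =>
    obtain ⟨x, h1, h2⟩ := ih (by omega)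
    refine ⟨x * braidOf [m + 1], by rw [torusBraid_succ, h1, mul_assoc], ?_⟩
    obtain ⟨k, rfl⟩ := Nat.exists_eq_add_of_le' hm
    rw [mul_assoc, torusBraid_shift hm (by omega), ← mul_assoc, h2, mul_assoc]
    simp only [Nat.add_sub_cancel]
    rw [← torusBraid_succ]

/-- Conjugation by the square of the torus braid takes the last generator to the first one. -/
theorem torusBraid_wrap {m : ℕ} (hm : 1 ≤ m) :
    torusBraid m ^ 2 * braidOf [m] = braidOf [1] * torusBraid m ^ 2 := by
  obtain ⟨x, h1, h2⟩ := torusBraid_eq_mul hm le_rfl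
  obtain ⟨k, rfl⟩ := Nat.exists_eq_add_of_le' hm
  have h3 : torusBraid (k + 1) ^ 2 =
      braidOf [1] * (torusBraid (k + 1) * torusBraid k) := by
    rw [Nat.add_sub_cancel] at h2
    rw [sq]
    nth_rewrite 1 [h1]
    rw [mul_assoc, h2]
  rw [h3, mul_assoc, mul_assoc, ← torusBraid_succ, ← sq]
  rw [← h3]

/-- The generator `σ_{m+1-j}` passes through `s > j` torus braids: `j - 1` of them take it to `σ_m`,
two take it from there to `σ₁`, and the others to `σ_{s-j}`. -/
theorem torusBraid_pow_wrap {m s j : ℕ} (hj : 1 ≤ j) (hjs : j < s) (hs : s ≤ m) :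
    torusBraid m ^ s * braidOf [m + 1 - j] = braidOf [s - j] * torusBraid m ^ s := by
  have h1 := torusBraid_pow_shift (m := m) (i := m + 1 - j) (b := j - 1) (by omega) (by omega)
  have h2 := torusBraid_wrap (m := m) (by omega)
  have h3 := torusBraid_pow_shift (m := m) (i := 1) (b := s - j - 1) le_rfl (by omega)
  rw [show m + 1 - j + (j - 1) = m by omega] at h1
  rw [show 1 + (s - j - 1) = s - j by omega] at h3
  have h4 : torusBraid m ^ s =
      torusBraid m ^ (s - j - 1) * (torusBraid m ^ 2 * torusBraid m ^ (j - 1)) := by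
    rw [← pow_add, ← pow_add]
    congr 1
    omega
  rw [h4, mul_assoc, mul_assoc, ← h1, ← mul_assoc (torusBraid m ^ 2), h2, ← mul_assoc, ← mul_assoc,
    ← h3]
  simp only [mul_assoc]

/-- The word `σ_a σ_{a-1} ⋯ σ_{a-s+1}`. -/
def descWord : ℕ → ℕ → List ℕ
  | _, 0 => []
  | a, s + 1 => a :: descWord (a - 1) s

theorem mem_descWord {a s i : ℕ} (hs : s ≤ a) (hi : i ∈ descWord a s) : a < i + s ∧ i ≤ a := by
  induction s generalizing a with
  | zero => simp [descWord] at hi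
  | succ s ih =>
    rcases List.mem_cons.1 hi with rfl | hi
    · omega
    · have := ih (by omega) hi
      omega

theorem descWord_map_succ {a s : ℕ} (hs : s ≤ a) :
    (descWord a s).map (· + 1) = descWord (a + 1) s := by
  induction s generalizing a with
  | zero => rfl
  | succ s ih =>
    rw [descWord, descWord, List.map_cons, ih (by omega), Nat.sub_add_cancel (by omega),
      Nat.add_sub_cancel]

/-- The powers of the torus braid on `m + 2` strands in terms of the one on `m + 1` strands: the
contribution of the last strand is collected on the right. -/
theorem torusBraid_succ_pow {m s : ℕ} (hs : s ≤ m + 1) :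
    torusBraid (m + 1) ^ s = torusBraid m ^ s * braidOf (descWord (m + 1) s) := by
  induction s with
  | zero => rfl
  | succ s ih =>
    have h1 := torusBraid_pow_shift_word (m := m + 1) (b := 1) (v := descWord m s)
      (fun i hi => by have := mem_descWord (by omega) hi; omega)
    rw [pow_one, descWord_map_succ (by omega)] at h1
    rw [pow_succ, ih (by omega), mul_assoc, h1, torusBraid_succ, mul_assoc, ← braidOf_cons,
      ← mul_assoc, ← pow_succ, descWord, Nat.add_sub_cancel]

theorem torusBraid_pow_wrap_word {m s j k : ℕ} (hj : 1 ≤ j) (hjk : j + k ≤ s) (hs : s ≤ m) :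
    torusBraid m ^ s * braidOf (descWord (m + 1 - j) k) =
      braidOf (descWord (s - j) k) * torusBraid m ^ s := by
  induction k generalizing j with
  | zero => rw [descWord, descWord, braidOf_nil, one_mul, mul_one]
  | succ k ih =>
    have h1 := ih (j := j + 1) (by omega) (by omega)
    rw [descWord, descWord, braidOf_cons, ← mul_assoc, torusBraid_pow_wrap hj (by omega) hs,
      mul_assoc, show m + 1 - j - 1 = m + 1 - (j + 1) by omega, h1, Nat.sub_sub,
      ← mul_assoc, ← braidOf_cons]

/-! ### T-links -/

/-- A link that is equivalent to the closure of a positive braid with a full twist. -/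
def HasFullTwist (L : Set E3) : Prop :=
  ∃ (n : ℕ) (w : List ℕ), 1 ≤ n ∧ IsPositiveBraidWord n w ∧ fullTwistWord n <:+: w ∧
    LinkEquiv L (closedBraid n w)

theorem HasFullTwist.of_linkEquiv {L L' : Set E3} (h : LinkEquiv L L') (h' : HasFullTwist L') :
    HasFullTwist L := by
  obtain ⟨n, w, h1, h2, h3, h4⟩ := h'
  exact ⟨n, w, h1, h2, h3, h.trans h4⟩

theorem isPositiveBraidWord_torusWord {r n : ℕ} (hr : r ≤ n) (s : ℕ) :
    IsPositiveBraidWord n (torusWord r s) := by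
  intro i hi
  obtain ⟨u, hu, hi⟩ := List.mem_flatten.1 hi
  rw [List.eq_of_mem_replicate hu, List.mem_range'_1] at hi
  omega

theorem torusWord_add (r s t : ℕ) : torusWord r (s + t) = torusWord r s ++ torusWord r t := by
  rw [torusWord, List.replicate_add, List.flatten_append]
  rfl

theorem isPositiveBraidWord_tLinkWord {l : List (ℕ × ℕ)} {n : ℕ} (hl : ∀ p ∈ l, p.1 ≤ n) :
    IsPositiveBraidWord n (tLinkWord l) := by
  intro i hi
  obtain ⟨p, hp, hi⟩ := List.mem_flatMap.1 hi
  exact isPositiveBraidWord_torusWord (hl p hp) _ i hi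

theorem tLinkWord_append (l l' : List (ℕ × ℕ)) :
    tLinkWord (l ++ l') = tLinkWord l ++ tLinkWord l' := List.flatMap_append

theorem tLinkWord_singleton (p : ℕ × ℕ) : tLinkWord [p] = torusWord p.1 p.2 := by
  simp [tLinkWord]

/-- A letter `σ_{m+1}` that occurs only once in a word on `m + 2` strands can be removed, together
with the last strand. -/
theorem closedBraid_destabilize {m : ℕ} {a b : List ℕ} (ha : IsPositiveBraidWord (m + 1) a)
    (hb : IsPositiveBraidWord (m + 1) b) :
    LinkEquiv (closedBraid (m + 2) (a ++ (m + 1) :: b)) (closedBraid (m + 1) (a ++ b)) := by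
  have hmono : ∀ {w : List ℕ}, IsPositiveBraidWord (m + 1) w → IsPositiveBraidWord (m + 2) w :=
    fun hw i hi => ⟨(hw i hi).1, (hw i hi).2.trans (Nat.lt_succ_self _)⟩
  have h1 : IsPositiveBraidWord (m + 2) ((a ++ [m + 1]) ++ b) :=
    isPositiveBraidWord_append.2 ⟨isPositiveBraidWord_append.2 ⟨hmono ha, by
      intro i hi
      rw [List.mem_singleton.1 hi]
      omega⟩, hmono hb⟩
  have h2 := closedBraid_append_comm h1
  have h3 : IsPositiveBraidWord (m + 1) (b ++ a) := isPositiveBraidWord_append.2 ⟨hb, ha⟩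
  have h4 := linkEquiv_destabilize (by omega) h3
  have h5 := closedBraid_append_comm h3
  rw [← List.append_assoc] at h2
  have := h2.trans (h4.trans h5)
  rwa [List.append_assoc, List.singleton_append] at this

theorem hasFullTwist_of_le {m s : ℕ} {w : List ℕ} (hw : IsPositiveBraidWord (m + 1) w)
    (hs : m + 1 ≤ s) : HasFullTwist (closedBraid (m + 1) (w ++ torusWord (m + 1) s)) := by
  refine ⟨m + 1, _, by omega, isPositiveBraidWord_append.2
    ⟨hw, isPositiveBraidWord_torusWord le_rfl s⟩, ?_, LinkEquiv.refl _⟩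
  refine ⟨w, torusWord (m + 1) (s - (m + 1)), ?_⟩
  rw [fullTwistWord, List.append_assoc, ← torusWord_add, Nat.add_sub_cancel' hs]

/-- If a word on `m + 1` strands is followed by at most `m + 1` torus braids on `m + 2` strands,
then the last strand can be removed. -/
theorem closedBraid_reduce {m s : ℕ} {w : List ℕ} (hw : IsPositiveBraidWord (m + 1) w)
    (hs : 1 ≤ s) (hsm : s ≤ m + 1) :
    LinkEquiv (closedBraid (m + 2) (w ++ torusWord (m + 2) s))
      (closedBraid (m + 1) (w ++ torusWord (m + 1) s ++ descWord m (s - 1))) := by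
  have hd : IsPositiveBraidWord (m + 1) (descWord m (s - 1)) := fun i hi => by
    have := mem_descWord (by omega) hi
    omega
  have hw' := isPositiveBraidWord_append.2 ⟨hw, isPositiveBraidWord_torusWord le_rfl s⟩
  refine (closedBraid_congr ?_ (isPositiveBraidWord_append.2
    ⟨fun i hi => ?_, isPositiveBraidWord_torusWord le_rfl s⟩)).trans
    (closedBraid_destabilize hw' hd)
  · obtain ⟨t, rfl⟩ := Nat.exists_eq_add_of_le' hs
    rw [braidOf_append, braidOf_torusWord, torusBraid_succ_pow hsm, braidOf_append, braidOf_append,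
      braidOf_torusWord, mul_assoc]
    rfl
  · have := hw i hi
    omega

/-- The induction over the number `m + 1` of strands and, for a fixed number, over the list `l`. The
last power of the torus braid on all `m + 1` strands either contains a full twist, or meets another
power of the same torus braid and is combined with it, or loses a strand by destabilization. The
word `v`, in the generators `σ_i` with `i < s`, collects the letters that appear on the way: it can
pass through the powers of the next torus braids as long as they do not complete a full twist. -/
theorem hasFullTwist_closedBraid (m : ℕ) : ∀ (l : List (ℕ × ℕ)) (v : List ℕ) (s : ℕ),
    l.Pairwise (fun p q => p.1 < q.1) → (∀ p ∈ l, p.1 ≤ m + 1) →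
    (∀ i ∈ v, 1 ≤ i ∧ i < s ∧ i ≤ m) → 1 ≤ s →
    HasFullTwist (closedBraid (m + 1) (tLinkWord l ++ v ++ torusWord (m + 1) s)) := by
  have hpos : ∀ {m : ℕ} {l : List (ℕ × ℕ)} {v : List ℕ} {s : ℕ}, (∀ p ∈ l, p.1 ≤ m + 1) →
      (∀ i ∈ v, 1 ≤ i ∧ i < s ∧ i ≤ m) → IsPositiveBraidWord (m + 1) (tLinkWord l ++ v) :=
    fun hl hv => isPositiveBraidWord_append.2 ⟨isPositiveBraidWord_tLinkWord hl,
      fun i hi => ⟨(hv i hi).1, Nat.lt_succ_of_le (hv i hi).2.2⟩⟩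
  induction m with
  | zero => exact fun l v s _ hl hv hs => hasFullTwist_of_le (hpos hl hv) hs
  | succ k ihk =>
    -- If `W` involves only the first `k + 1` strands, the last strand is removed.
    have hreduce : ∀ (l : List (ℕ × ℕ)) (v : List ℕ) (s : ℕ),
        l.Pairwise (fun p q => p.1 < q.1) → (∀ p ∈ l, p.1 ≤ k + 1) →
        (∀ i ∈ v, 1 ≤ i ∧ i < s ∧ i ≤ k + 1) → 1 ≤ s → s ≤ k + 1 →
        HasFullTwist (closedBraid (k + 2) (tLinkWord l ++ v ++ torusWord (k + 2) s)) := by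
      intro l v s hp hl hv hs hsk
      have hv' : ∀ i ∈ v, 1 ≤ i ∧ i < s ∧ i ≤ k := fun i hi => by have := hv i hi; omega
      have hw := hpos hl hv'
      have hd : IsPositiveBraidWord (k + 1) (descWord k (s - 1)) := fun i hi => by
        have := mem_descWord (by omega) hi
        omega
      have hwd : IsPositiveBraidWord (k + 1)
          (tLinkWord l ++ v ++ torusWord (k + 1) s ++ descWord k (s - 1)) :=
        isPositiveBraidWord_append.2 ⟨isPositiveBraidWord_append.2
          ⟨hw, isPositiveBraidWord_torusWord le_rfl s⟩, hd⟩
      refine HasFullTwist.of_linkEquiv (closedBraid_reduce hw hs hsk) ?_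
      rcases hsk.eq_or_lt with rfl | h
      · exact ⟨k + 1, _, hs, hwd, ⟨_, _, rfl⟩, LinkEquiv.refl _⟩
      · have h1 := ihk l (v ++ descWord (s - 1) (s - 1)) s hp hl (fun i hi => by
          rcases List.mem_append.1 hi with hi | hi
          · exact hv' i hi
          · have := mem_descWord le_rfl hi
            omega) hs
        refine HasFullTwist.of_linkEquiv (closedBraid_congr ?_ hwd) h1
        have h2 := torusBraid_pow_wrap_word (m := k) (s := s) (j := 1) (k := s - 1) le_rfl
          (by omega) (by omega)
        rw [Nat.add_sub_cancel] at h2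
        simp only [braidOf_append, braidOf_torusWord, mul_assoc, h2]
    intro l
    induction l using List.reverseRecOn with
    | nil =>
      intro v s hp hl hv hs
      rcases le_or_gt (k + 2) s with h | h
      · exact hasFullTwist_of_le (hpos hl hv) h
      · exact hreduce [] v s hp (by simp) hv hs (by omega)
    | append_singleton l p ihl =>
      intro v s hp hl hv hs
      rcases le_or_gt (k + 2) s with h | h
      · exact hasFullTwist_of_le (hpos hl hv) h
      obtain ⟨hp1, -, hp2⟩ := List.pairwise_append.1 hp
      have hlp : ∀ q ∈ l, q.1 < p.1 := fun q hq => hp2 q hq p (by simp)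
      have hpk := hl p (by simp)
      have hl' : ∀ q ∈ l, q.1 ≤ k + 2 := fun q hq => hl q (by simp [hq])
      have hw : IsPositiveBraidWord (k + 2)
          (tLinkWord (l ++ [p]) ++ v ++ torusWord (k + 2) s) :=
        isPositiveBraidWord_append.2 ⟨hpos hl hv, isPositiveBraidWord_torusWord le_rfl s⟩
      rcases hpk.eq_or_lt with he | he
      · obtain ⟨r, a⟩ := p
        simp only at he
        subst he
        rcases le_or_gt (k + 2) (a + s) with has | has
        · -- The two torus braids complete a full twist, and `v` passes through the part of the
          -- first one that is needed for it.
          have hsh : ∀ i ∈ v, 1 ≤ i ∧ i + (k + 2 - s) ≤ k + 1 := fun i hi => by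
            have := hv i hi
            omega
          have h1 := hasFullTwist_of_le (m := k + 1) (s := k + 2)
            (w := tLinkWord l ++ torusWord (k + 2) (a - (k + 2 - s)) ++ v.map (· + (k + 2 - s)))
            (isPositiveBraidWord_append.2 ⟨isPositiveBraidWord_append.2
              ⟨isPositiveBraidWord_tLinkWord hl', isPositiveBraidWord_torusWord le_rfl _⟩,
              fun i hi => by
                obtain ⟨j, hj, rfl⟩ := List.mem_map.1 hi
                have := hsh j hj
                omega⟩) le_rfl
          refine HasFullTwist.of_linkEquiv (closedBraid_congr ?_ hw) h1
          have h2 := torusBraid_pow_shift_word hsh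
          have ha : torusBraid (k + 1) ^ a = torusBraid (k + 1) ^ (a - (k + 2 - s)) *
              torusBraid (k + 1) ^ (k + 2 - s) := by
            rw [← pow_add]; congr 1; omega
          have hf : torusBraid (k + 1) ^ (k + 2) =
              torusBraid (k + 1) ^ (k + 2 - s) * torusBraid (k + 1) ^ s := by
            rw [← pow_add]; congr 1; omega
          simp only [tLinkWord_append, tLinkWord_singleton, braidOf_append, braidOf_torusWord]
          rw [ha, hf]
          simp only [mul_assoc]
          rw [← mul_assoc (braidOf (v.map _)), h2]
          simp only [mul_assoc]
        · -- The two torus braids are combined; `v` passes through the first one.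
          have hsh : ∀ i ∈ v, 1 ≤ i ∧ i + a ≤ k + 1 := fun i hi => by
            have := hv i hi
            omega
          have h1 := ihl (v.map (· + a)) (a + s) hp1 hl' (fun i hi => by
            obtain ⟨j, hj, rfl⟩ := List.mem_map.1 hi
            have := hv j hj
            omega) (by omega)
          refine HasFullTwist.of_linkEquiv (closedBraid_congr ?_ hw) h1
          have h2 := torusBraid_pow_shift_word hsh
          simp only [tLinkWord_append, tLinkWord_singleton, braidOf_append, braidOf_torusWord]
          rw [pow_add]
          simp only [mul_assoc]
          rw [← mul_assoc (braidOf (v.map _)), h2]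
          simp only [mul_assoc]
      · refine hreduce _ v s hp (fun q hq => ?_) hv hs (by omega)
        rcases List.mem_append.1 hq with hq | hq
        · have := hlp q hq
          omega
        · rw [List.mem_singleton.1 hq]
          omega
end

theorem mainTheorem2 (l : List (ℕ × ℕ)) (hl : l ≠ []) (hT : IsTLinkData l) :
    ∃ (n : ℕ) (w : List ℕ), 1 ≤ n ∧ IsPositiveBraidWord n w ∧ fullTwistWord n <:+: w ∧
      AmbientIsotopic (tLink l hl) (closedBraid n w) := by
  obtain ⟨l, ⟨r, s⟩, rfl⟩ := List.eq_nil_or_concat' l |>.resolve_left hl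
  obtain ⟨hT1, hT2⟩ := hT
  have hr := hT1 (r, s) (by simp)
  obtain ⟨m, rfl⟩ := Nat.exists_eq_add_of_le' (show 1 ≤ r by linarith [hr.1])
  obtain ⟨hp, -, hlt⟩ := List.pairwise_append.1 hT2
  obtain ⟨n, w, h1, h2, h3, h4⟩ := hasFullTwist_closedBraid m l [] s hp
    (fun p hp => (hlt p hp (m + 1, s) (by simp)).le) (by simp) hr.2
  refine ⟨n, w, h1, h2, h3, LinkEquiv.ambientIsotopic ?_⟩
  rwa [tLink, List.getLast_append_singleton, tLinkWord_append, tLinkWord_singleton,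
    ← List.append_nil (tLinkWord l)]
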